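/- Let $(M_2,g_2)$ be a non-empty supermanifold of dimension $q|n$ (a second countable Hausdorff space with a sheaf of $\mathbb Z_2$-graded algebras locally isomorphic to $C^\infty_U\otimes\Lambda\mathbb R^n$, $U\subseteq\mathbb R^q$ open) with an even Riemannian metric $g_2$ (a non-degenerate, supersymmetric pairing of degree $0$ on vector fields, of arbitrary signature). Let $h:\mathbb R\to\mathbb R$ be a smooth nowhere vanishing function, and let $M=\mathbb R^{1|0}\times M_2$ carry the warped product metric $g_\mu=-dt\otimes dt+h(t)^2g_2$, $\mu=h^2$. Write $\nabla^{L,\mu}$ and $\nabla^{L,M_2}$ for the Levi-Civita connections (the torsion-free metric-compatible affine connections) of $g_\mu$ and $g_2$. Put $P=\partial_t$ and let $$\widehat\nabla^\mu_XY=\nabla^{L,\mu}_XY+(-1)^{|X||Y|}g_\mu(Y,P)\,X$$ for homogeneous vector fields $X,Y$ on $M$ (the semi-symmetric non-metric connection). For an affine connection $\nabla$ let $R_\nabla(X,Y)Z=\nabla_X\nabla_YZ-(-1)^{|X||Y|}\nabla_Y\nabla_XZ-\nabla_{[X,Y]}Z$ and $$\mathrm{Ric}_\nabla(X,Y)=\sum_I(-1)^{|\partial_{x^I}|(|\partial_{x^I}|+|X|+|Y|)}\,\tfrac12\big[R_\nabla(\partial_{x^I},X)Y+(-1)^{|X||Y|}R_\nabla(\partial_{x^I},Y)X\big]^I,$$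 where $[\;\cdot\;]^I$ is the coefficient of $\partial_{x^I}$. A triple $(N,g,\nabla)$ is Einstein with Einstein constant $\lambda\in\mathbb R$ if $\mathrm{Ric}_\nabla(X,Y)=\lambda\,g(X,Y)$ for all vector fields $X,Y$. Assume $q-n\notin\{0,1\}$ and let $\lambda_0\in\mathbb R$. Then $(M,g_\mu,\widehat\nabla^\mu)$ is Einstein with Einstein constant $-\lambda_0$ if and only if there is a $\lambda_N\in\mathbb R$ such that $(M_2,g_2,\nabla^{L,M_2})$ is Einstein with Einstein constant $-\lambda_N$ and one of the following two conditions holds: (1) $\lambda_0=\lambda_N=0$ and $h(t)=c_1e^{t}$ for all $t$, with a constant $c_1$; (2) $\lambda_0=q-n$ and $h$ is a constant $c_1=\pm\sqrt{\lambda_N/(q-n)}$ (so $c_1=\sqrt{\lambda_N/(q-n)}$ if $h>0$). -/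

import Mathlib

open scoped TensorProduct ContDiff
open TopologicalSpace

universe u v


noncomputable section

namespace SuperGeom

/-! ### Smooth functions on an open subset of `ℝ^ι` -/

section Smooth

variable {ι : Type} [Fintype ι] [DecidableEq ι] {ι' : Type} [Fintype ι'] [DecidableEq ι']

/-- Extension by zero of a function defined on an open set. -/
def ext0 {U : Opens (ι → ℝ)} (f : U → ℝ) : (ι → ℝ) → ℝ :=
  Function.extend (Subtype.val : U → (ι → ℝ)) f 0

theorem ext0_apply {U : Opens (ι → ℝ)} (f : U → ℝ) (x : U) : ext0 f x = f x :=
  Subtype.val_injective.extend_apply f 0 x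

/-- Smoothness on `U` may be tested on any function that agrees with `f` on `U`. -/
theorem contDiffOn_ext0_iff {U : Opens (ι → ℝ)} (f : U → ℝ) (g : (ι → ℝ) → ℝ)
    (h : ∀ x : U, f x = g x) :
    ContDiffOn ℝ ∞ (ext0 f) U ↔ ContDiffOn ℝ ∞ g U := by
  apply contDiffOn_congr
  intro x hx
  rw [← h ⟨x, hx⟩]
  exact ext0_apply f ⟨x, hx⟩

/-- The algebra `C^∞(U)` of smooth real functions on the open set `U ⊆ ℝ^ι`. -/
def CInf (U : Opens (ι → ℝ)) : Subalgebra ℝ (U → ℝ) where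
  carrier := {f | ContDiffOn ℝ ∞ (ext0 f) U}
  mul_mem' {f g} hf hg :=
    (contDiffOn_ext0_iff (f * g) (ext0 f * ext0 g)
      fun x => by simp [ext0_apply]).2 (ContDiffOn.mul hf hg)
  add_mem' {f g} hf hg :=
    (contDiffOn_ext0_iff (f + g) (ext0 f + ext0 g)
      fun x => by simp [ext0_apply]).2 (ContDiffOn.add hf hg)
  algebraMap_mem' r :=
    (contDiffOn_ext0_iff _ (fun _ => r) fun x => by simp).2 contDiffOn_const

/-- Restriction to `U` of a function that is smooth on `U`. -/
def CInf.mk {U : Opens (ι → ℝ)} (g : (ι → ℝ) → ℝ) (hg : ContDiffOn ℝ ∞ g U) : CInf U :=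
  ⟨fun x => g x, (contDiffOn_ext0_iff _ g fun _ => rfl).2 hg⟩

theorem CInf.contDiffOn {U : Opens (ι → ℝ)} (f : CInf U) : ContDiffOn ℝ ∞ (ext0 f.1) U := f.2

theorem CInf.differentiableAt {U : Opens (ι → ℝ)} (f : CInf U) (x : U) :
    DifferentiableAt ℝ (ext0 f.1) x :=
  ((CInf.contDiffOn f).differentiableOn (by simp)).differentiableAt (U.isOpen.mem_nhds x.2)

/-- If `f` is the restriction of `g`, the derivative of `f` is that of `g`. -/
theorem CInf.fderiv_eq {U : Opens (ι → ℝ)} (f : U → ℝ) (g : (ι → ℝ) → ℝ)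
    (h : ∀ x : U, f x = g x) (x : U) : fderiv ℝ (ext0 f) x = fderiv ℝ g x := by
  apply Filter.EventuallyEq.fderiv_eq
  filter_upwards [U.isOpen.mem_nhds x.2] with y hy
  rw [← h ⟨y, hy⟩]
  exact ext0_apply f ⟨y, hy⟩

/-- The partial derivative `∂/∂x^a` on `C^∞(U)`. -/
def CInf.pderiv (U : Opens (ι → ℝ)) (a : ι) : CInf U →ₗ[ℝ] CInf U where
  toFun f := CInf.mk (fun x => fderiv ℝ (ext0 f.1) x (Pi.single a 1))
    (((CInf.contDiffOn f).fderiv_of_isOpen U.isOpen (m := ∞) (by simp)).clm_apply contDiffOn_const)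
  map_add' f g := by
    apply Subtype.ext
    funext x
    show fderiv ℝ (ext0 (f.1 + g.1)) x _ = fderiv ℝ (ext0 f.1) x _ + fderiv ℝ (ext0 g.1) x _
    rw [CInf.fderiv_eq (f.1 + g.1) (ext0 f.1 + ext0 g.1) (fun x => by simp [ext0_apply]) x,
      fderiv_add (CInf.differentiableAt f x) (CInf.differentiableAt g x)]
    rfl
  map_smul' r f := by
    apply Subtype.ext
    funext x
    show fderiv ℝ (ext0 (r • f.1)) x _ = r • fderiv ℝ (ext0 f.1) x _
    rw [CInf.fderiv_eq (r • f.1) (r • ext0 f.1) (fun x => by simp [ext0_apply]) x,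
      fderiv_const_smul (CInf.differentiableAt f x)]
    rfl

theorem CInf.pderiv_apply {U : Opens (ι → ℝ)} (a : ι) (f : CInf U) (x : U) :
    (CInf.pderiv U a f).1 x = fderiv ℝ (ext0 f.1) x (Pi.single a 1) := rfl

theorem CInf.pderiv_mul {U : Opens (ι → ℝ)} (a : ι) (f g : CInf U) :
    CInf.pderiv U a (f * g) = f * CInf.pderiv U a g + CInf.pderiv U a f * g := by
  apply Subtype.ext
  funext x
  show fderiv ℝ (ext0 (f.1 * g.1)) x _ =
    f.1 x * fderiv ℝ (ext0 g.1) x _ + fderiv ℝ (ext0 f.1) x _ * g.1 x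
  rw [CInf.fderiv_eq (f.1 * g.1) (ext0 f.1 * ext0 g.1) (fun x => by simp [ext0_apply]) x,
    fderiv_mul (CInf.differentiableAt f x) (CInf.differentiableAt g x)]
  simp [ext0_apply]
  ring

/-- The coordinate function `x^a`. -/
def CInf.coord (U : Opens (ι → ℝ)) (a : ι) : CInf U :=
  CInf.mk (fun x => x a) (contDiff_apply ℝ ℝ a).contDiffOn

/-- Pull-back of smooth functions along the smooth map `U → V` with components `u`. -/
def CInf.pull {U : Opens (ι' → ℝ)} {V : Opens (ι → ℝ)} (u : ι → CInf U)
    (h : ∀ x : U, (fun a => (u a).1 x) ∈ V) : CInf V →ₐ[ℝ] CInf U where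
  toFun f := ⟨fun x => f.1 ⟨fun a => (u a).1 x, h x⟩, by
    refine (contDiffOn_ext0_iff _ (ext0 f.1 ∘ fun x a => ext0 (u a).1 x) fun x => ?_).2 ?_
    · simp only [Function.comp, ext0_apply]
      exact (ext0_apply f.1 ⟨fun a => (u a).1 x, h x⟩).symm
    · refine (CInf.contDiffOn f).comp (contDiffOn_pi.2 fun a => CInf.contDiffOn (u a)) fun x hx => ?_
      have := h ⟨x, hx⟩
      have e : (fun a => ext0 (u a).1 x) = fun a => (u a).1 ⟨x, hx⟩ :=
        funext fun a => ext0_apply (u a).1 ⟨x, hx⟩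
      show (fun a => ext0 (u a).1 x) ∈ V
      rw [e]
      exact this⟩
  map_one' := rfl
  map_mul' _ _ := rfl
  map_zero' := rfl
  map_add' _ _ := rfl
  commutes' _ := rfl

end Smooth

/-! ### Superdomains -/

section Superdomain

variable {ι : Type} [Fintype ι] [DecidableEq ι] {ι' : Type} [Fintype ι'] [DecidableEq ι']
  {κ : Type} [Fintype κ] [DecidableEq κ]

/-- The exterior algebra `Λ ℝ^κ`. -/
abbrev Grass (κ : Type) : Type := ExteriorAlgebra ℝ (κ → ℝ)

/-- The algebra `C^∞(U) ⊗ Λ ℝ^κ` of superfunctions on the superdomain over `U`. -/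
abbrev SFun (κ : Type) (U : Opens (ι → ℝ)) : Type := CInf U ⊗[ℝ] Grass κ

instance (U : Opens (ι → ℝ)) : Ring (SFun κ U) := Algebra.TensorProduct.instRing

instance (U : Opens (ι → ℝ)) : AddGroup (SFun κ U) := Ring.toAddCommGroup.toAddGroup

/-- The odd coordinate `ξ^B` as an element of the exterior algebra. -/
def xi (B : κ) : Grass κ := ExteriorAlgebra.ι ℝ (Pi.single B 1)

/-- The sign `(-1)^{a b}`. -/
def sgn (a b : ZMod 2) : ℝ := (-1) ^ (a.val * b.val)

/-- The degree of the coordinate `x^I` (and of `∂_{x^I}`): the even coordinates are indexed by `ι`,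
the odd ones by `κ`. -/
def deg : ι ⊕ κ → ZMod 2 := Sum.elim (fun _ => 0) (fun _ => 1)

/-- A smooth function as a superfunction. -/
def SFun.ofCInf {U : Opens (ι → ℝ)} : CInf U →ₐ[ℝ] SFun κ U :=
  Algebra.TensorProduct.includeLeft

/-- A constant Grassmann element as a superfunction. -/
def SFun.ofGrass {U : Opens (ι → ℝ)} : Grass κ →ₐ[ℝ] SFun κ U :=
  Algebra.TensorProduct.includeRight

/-- The superfunctions of degree `p`. -/
def SFun.homog (κ : Type) (U : Opens (ι → ℝ)) (p : ZMod 2) : Submodule ℝ (SFun κ U) :=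
  LinearMap.range (LinearMap.lTensor (CInf U)
    (CliffordAlgebra.evenOdd (0 : QuadraticForm ℝ (κ → ℝ)) p).subtype)

/-- The operator `f ↦ (-1)^{p |f|} f`. -/
def SFun.twist {U : Opens (ι → ℝ)} (p : ZMod 2) : SFun κ U →ₗ[ℝ] SFun κ U :=
  if p = 0 then LinearMap.id
  else LinearMap.lTensor (CInf U)
    (CliffordAlgebra.involute (Q := (0 : QuadraticForm ℝ (κ → ℝ)))).toLinearMap

/-- The body of a superfunction: the smooth function obtained by throwing away the odd
coordinates. -/
def SFun.body {U : Opens (ι → ℝ)} : SFun κ U →ₐ[ℝ] CInf U :=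
  (Algebra.TensorProduct.rid ℝ ℝ (CInf U)).toAlgHom.comp
    (Algebra.TensorProduct.map (AlgHom.id ℝ (CInf U)) ExteriorAlgebra.algebraMapInv)

/-- The coordinate vector fields `∂_{x^I}` acting on superfunctions: partial derivatives for the
even coordinates, left derivatives (contractions) for the odd ones. -/
def SFun.d {U : Opens (ι → ℝ)} : ι ⊕ κ → SFun κ U →ₗ[ℝ] SFun κ U
  | Sum.inl a => LinearMap.rTensor (Grass κ) (CInf.pderiv U a)
  | Sum.inr B => LinearMap.lTensor (CInf U)
      (CliffordAlgebra.contractLeft (Q := (0 : QuadraticForm ℝ (κ → ℝ))) (LinearMap.proj B))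

/-- The coordinate superfunctions `x^I`. -/
def SFun.coord (U : Opens (ι → ℝ)) : ι ⊕ κ → SFun κ U
  | Sum.inl a => SFun.ofCInf (CInf.coord U a)
  | Sum.inr B => SFun.ofGrass (xi B)

/-- Pull-back of superfunctions along the smooth map `U → V` with components `u`, the odd
coordinates being preserved. -/
def SFun.pull {U : Opens (ι' → ℝ)} {V : Opens (ι → ℝ)} (u : ι → CInf U)
    (h : ∀ x : U, (fun a => (u a).1 x) ∈ V) : SFun κ V →ₐ[ℝ] SFun κ U :=
  Algebra.TensorProduct.map (CInf.pull u h) (AlgHom.id ℝ (Grass κ))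

/-- Restriction of superfunctions to a smaller open set. -/
def SFun.res {U V : Opens (ι → ℝ)} (h : U ≤ V) : SFun κ V →ₐ[ℝ] SFun κ U :=
  SFun.pull (CInf.coord U) fun x => h x.2

theorem SFun.pull_tmul {U : Opens (ι' → ℝ)} {V : Opens (ι → ℝ)} (u : ι → CInf U)
    (h : ∀ x : U, (fun a => (u a).1 x) ∈ V) (f : CInf V) (w : Grass κ) :
    SFun.pull u h (f ⊗ₜ w) = CInf.pull u h f ⊗ₜ w := rfl

theorem SFun.tmul_mem_homog {U : Opens (ι → ℝ)} {p : ZMod 2} (f : CInf U) (w : Grass κ)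
    (hw : w ∈ CliffordAlgebra.evenOdd (0 : QuadraticForm ℝ (κ → ℝ)) p) :
    f ⊗ₜ w ∈ SFun.homog κ U p :=
  ⟨f ⊗ₜ ⟨w, hw⟩, rfl⟩

theorem SFun.homog_induction {U : Opens (ι → ℝ)} {p : ZMod 2} {P : SFun κ U → Prop}
    (h0 : P 0) (ht : ∀ f : CInf U, ∀ w : Grass κ,
      w ∈ CliffordAlgebra.evenOdd (0 : QuadraticForm ℝ (κ → ℝ)) p → P (f ⊗ₜ w))
    (ha : ∀ x y, P x → P y → P (x + y)) {x : SFun κ U} (hx : x ∈ SFun.homog κ U p) : P x := by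
  obtain ⟨y, rfl⟩ := hx
  induction y using TensorProduct.induction_on with
  | zero => simpa using h0
  | tmul f w => exact ht f w.1 w.2
  | add a b h1 h2 => rw [map_add]; exact ha _ _ h1 h2

theorem SFun.pull_mem_homog {U : Opens (ι' → ℝ)} {V : Opens (ι → ℝ)} (u : ι → CInf U)
    (h : ∀ x : U, (fun a => (u a).1 x) ∈ V) {p : ZMod 2} {x : SFun κ V}
    (hx : x ∈ SFun.homog κ V p) : SFun.pull u h x ∈ SFun.homog κ U p := by
  refine SFun.homog_induction (P := fun x => SFun.pull u h x ∈ SFun.homog κ U p)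
    ?_ ?_ ?_ hx
  · simp
  · intro f w hw
    exact SFun.tmul_mem_homog _ _ hw
  · intro x y h1 h2
    rw [map_add]
    exact Submodule.add_mem _ h1 h2

theorem SFun.ofCInf_mul_mem_homog {U : Opens (ι → ℝ)} (f : CInf U) {p : ZMod 2} {x : SFun κ U}
    (hx : x ∈ SFun.homog κ U p) : SFun.ofCInf f * x ∈ SFun.homog κ U p := by
  refine SFun.homog_induction (P := fun x => SFun.ofCInf f * x ∈ SFun.homog κ U p)
    ?_ ?_ ?_ hx
  · simp
  · intro g w hw
    have : SFun.ofCInf f * (g ⊗ₜ[ℝ] w) = (f * g) ⊗ₜ[ℝ] w := by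
      simp [SFun.ofCInf, Algebra.TensorProduct.tmul_mul_tmul]
    rw [this]
    exact SFun.tmul_mem_homog _ _ hw
  · intro x y h1 h2
    rw [mul_add]
    exact Submodule.add_mem _ h1 h2

theorem SFun.ofCInf_mem_homog {U : Opens (ι → ℝ)} (f : CInf U) :
    (SFun.ofCInf f : SFun κ U) ∈ SFun.homog κ U 0 :=
  SFun.tmul_mem_homog f 1
    (CliffordAlgebra.one_le_evenOdd_zero _ (Submodule.one_le.1 le_rfl))

theorem SFun.ofCInf_comm {U : Opens (ι → ℝ)} (f : CInf U) (x : SFun κ U) :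
    SFun.ofCInf f * x = x * SFun.ofCInf f := by
  induction x using TensorProduct.induction_on with
  | zero => simp
  | tmul g w => simp [SFun.ofCInf, Algebra.TensorProduct.tmul_mul_tmul, mul_comm]
  | add a b h1 h2 => rw [mul_add, add_mul, h1, h2]

/-- Composition of pull-backs. -/
theorem SFun.pull_pull {ι'' : Type} [Fintype ι''] [DecidableEq ι''] {U : Opens (ι'' → ℝ)}
    {V : Opens (ι' → ℝ)} {W : Opens (ι → ℝ)} (u : ι' → CInf U)
    (hu : ∀ x : U, (fun a => (u a).1 x) ∈ V) (w : ι → CInf V)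
    (hw : ∀ x : V, (fun a => (w a).1 x) ∈ W) (z : ι → CInf U)
    (hz : ∀ x : U, (fun a => (z a).1 x) ∈ W) (e : ∀ a, CInf.pull u hu (w a) = z a)
    (x : SFun κ W) : SFun.pull u hu (SFun.pull w hw x) = SFun.pull z hz x := by
  obtain rfl : (fun a => CInf.pull u hu (w a)) = z := funext e
  induction x using TensorProduct.induction_on with
  | zero => simp
  | tmul f w' => rfl
  | add a b h1 h2 => simp only [map_add, h1, h2]

theorem SFun.body_tmul {U : Opens (ι → ℝ)} (f : CInf U) (w : Grass κ) :
    SFun.body (f ⊗ₜ[ℝ] w : SFun κ U) = ExteriorAlgebra.algebraMapInv w • f := by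
  simp [SFun.body]

theorem SFun.body_ofCInf {U : Opens (ι → ℝ)} (f : CInf U) :
    SFun.body (SFun.ofCInf f : SFun κ U) = f := by
  simp [SFun.ofCInf, SFun.body_tmul]

theorem SFun.body_pull {U : Opens (ι' → ℝ)} {V : Opens (ι → ℝ)} (u : ι → CInf U)
    (h : ∀ x : U, (fun a => (u a).1 x) ∈ V) (x : SFun κ V) :
    SFun.body (SFun.pull u h x) = CInf.pull u h (SFun.body x) := by
  induction x using TensorProduct.induction_on with
  | zero => simp
  | tmul f w => rw [SFun.pull_tmul, SFun.body_tmul, SFun.body_tmul, map_smul]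
  | add a b h1 h2 => simp only [map_add, h1, h2]

/-- A morphism from the superdomain over `U` to `ℝ^{ι|κ}`, given by the pull-backs of the
coordinates: even superfunctions and odd superfunctions (the latter recorded through the algebra
homomorphism from the exterior algebra that they generate). -/
@[ext]
structure SMap (κ : Type) [DecidableEq κ] (U : Opens (ι → ℝ)) where
  even : ι → SFun κ U
  even_mem : ∀ a, even a ∈ SFun.homog κ U 0
  odd : Grass κ →ₐ[ℝ] SFun κ U
  odd_mem : ∀ B : κ, odd (xi B) ∈ SFun.homog κ U 1

namespace SMap

variable {U : Opens (ι → ℝ)}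

/-- The inclusion of `U`, given by the coordinates themselves. -/
def incl (U : Opens (ι → ℝ)) : SMap κ U where
  even a := SFun.ofCInf (CInf.coord U a)
  even_mem _ := SFun.ofCInf_mem_homog _
  odd := SFun.ofGrass
  odd_mem _ := SFun.tmul_mem_homog _ _ (CliffordAlgebra.ι_mem_evenOdd_one _ _)

/-- The pull-back of the coordinate `x^K`. -/
def coord (c : SMap κ U) : ι ⊕ κ → SFun κ U
  | Sum.inl a => c.even a
  | Sum.inr B => c.odd (xi B)

/-- The super Jacobian matrix: `∂_{x^I} = ∑ K, jac I K • ∂_{x'^K}`. -/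
def jac (c : SMap κ U) (I K : ι ⊕ κ) : SFun κ U := SFun.d I (c.coord K)

/-- The body of the morphism maps `U` into `V`. -/
def MapsTo (c : SMap κ U) (V : Opens (ι → ℝ)) : Prop :=
  ∀ x : U, (fun a => (SFun.body (c.even a)).1 x) ∈ V

/-- Restriction of a morphism to a smaller open set. -/
def restrict (c : SMap κ U) {W : Opens (ι → ℝ)} (h : W ≤ U) : SMap κ W where
  even a := SFun.res h (c.even a)
  even_mem a := SFun.pull_mem_homog _ _ (c.even_mem a)
  odd := (SFun.res h).comp c.odd
  odd_mem B := SFun.pull_mem_homog _ _ (c.odd_mem B)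

/-- The nilpotent part of the pull-back of the even coordinate `x^a`. -/
def nil (c : SMap κ U) (a : ι) : SFun κ U := c.even a - SFun.ofCInf (SFun.body (c.even a))

/-- The term `∑ ν^{a₁} ⋯ ν^{a_k} (∂_{a₁} ⋯ ∂_{a_k} F) ∘ body` of the Taylor expansion of a smooth
function `F` around the body of the morphism, `ν` being its nilpotent part. -/
def taylorTerm (c : SMap κ U) {V : Opens (ι → ℝ)} (h : c.MapsTo V) :
    ℕ → (CInf V →ₗ[ℝ] SFun κ U)
  | 0 => SFun.ofCInf.toLinearMap ∘ₗ (CInf.pull (fun a => SFun.body (c.even a)) h).toLinearMap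
  | k + 1 => ∑ a, LinearMap.mulLeft ℝ (c.nil a) ∘ₗ taylorTerm c h k ∘ₗ CInf.pderiv V a

/-- Pull-back of a smooth function of the even coordinates: the Taylor expansion around the body
(finite, because products of more than `|κ|` nilpotent parts vanish). -/
def taylor (c : SMap κ U) {V : Opens (ι → ℝ)} (h : c.MapsTo V) : CInf V →ₗ[ℝ] SFun κ U :=
  ∑ k ∈ Finset.range (Fintype.card κ + 1), ((k.factorial : ℝ)⁻¹) • c.taylorTerm h k

/-- Pull-back of superfunctions along a morphism (substitution of the coordinates). -/
def subst (c : SMap κ U) {V : Opens (ι → ℝ)} (h : c.MapsTo V) : SFun κ V →ₗ[ℝ] SFun κ U :=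
  LinearMap.mul' ℝ (SFun κ U) ∘ₗ TensorProduct.map (c.taylor h) c.odd.toLinearMap

end SMap

/-! ### Vector fields, connections and curvature on a superdomain -/

/-- Vector fields `X = ∑ X^I ∂_{x^I}` on the superdomain over `U`. -/
abbrev Vect (κ : Type) (U : Opens (ι → ℝ)) : Type := ι ⊕ κ → SFun κ U

namespace Vect

variable {U : Opens (ι → ℝ)}

/-- The vector field `X` is homogeneous of degree `p`. -/
def IsHomog (p : ZMod 2) (X : Vect κ U) : Prop := ∀ I, X I ∈ SFun.homog κ U (p + deg I)

/-- The coordinate vector field `∂_{x^I}`. -/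
def frame (I : ι ⊕ κ) : Vect κ U := Pi.single I 1

/-- The action `X(f)` of a vector field on a superfunction. -/
def act (X : Vect κ U) (f : SFun κ U) : SFun κ U := ∑ I, X I * SFun.d I f

/-- Right multiplication `X · f`, that is `(-1)^{|X||f|} f X` for homogeneous `X` and `f`. -/
def rmul (X : Vect κ U) (f : SFun κ U) : Vect κ U := fun I => X I * SFun.twist (deg I) f

/-- The bracket `[X, Y] = X Y - (-1)^{|X||Y|} Y X` of vector fields of degrees `a` and `b`. -/
def bracket (a b : ZMod 2) (X Y : Vect κ U) : Vect κ U :=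
  fun K => X.act (Y K) - sgn a b • Y.act (X K)

/-- The pairing `⟨X, Y⟩_g` with components `g I J = ⟨∂_{x^I}, ∂_{x^J}⟩_g` of an even metric. -/
def pair (g : ι ⊕ κ → ι ⊕ κ → SFun κ U) (X Y : Vect κ U) : SFun κ U :=
  ∑ I, ∑ J, X I * SFun.twist (deg I) (Y J) * g I J

end Vect

/-- Affine connections on the superdomain over `U`. -/
structure AffineConnection (κ : Type) [Fintype κ] (U : Opens (ι → ℝ)) where
  cov : Vect κ U → Vect κ U → Vect κ U
  cov_homog : ∀ a b X Y, X.IsHomog a → Y.IsHomog b → (cov X Y).IsHomog (a + b)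
  cov_add_left : ∀ X Y Z, cov (X + Y) Z = cov X Z + cov Y Z
  cov_add_right : ∀ X Y Z, cov X (Y + Z) = cov X Y + cov X Z
  cov_smul_left : ∀ (f : SFun κ U) X Y, cov (f • X) Y = f • cov X Y
  leibniz : ∀ (a r : ZMod 2) (X Y : Vect κ U) (f : SFun κ U), X.IsHomog a →
    f ∈ SFun.homog κ U r → cov X (f • Y) = X.act f • Y + sgn a r • (f • cov X Y)

section Connection

variable {U : Opens (ι → ℝ)}

/-- `D` is the Levi-Civita connection of the metric `g`: torsion free and metric compatible. -/
def AffineConnection.IsLeviCivita (D : AffineConnection κ U)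
    (g : ι ⊕ κ → ι ⊕ κ → SFun κ U) : Prop :=
  (∀ a b X Y, X.IsHomog a → Y.IsHomog b →
    D.cov X Y - sgn a b • D.cov Y X - Vect.bracket a b X Y = 0) ∧
  (∀ a b X Y Z, X.IsHomog a → Y.IsHomog b →
    X.act (Vect.pair g Y Z) =
      Vect.pair g (D.cov X Y) Z + sgn a b • Vect.pair g Y (D.cov X Z))

/-- The curvature `R(X, Y)Z` for `X`, `Y` homogeneous of degrees `a`, `b`. -/
def curvature (cov : Vect κ U → Vect κ U → Vect κ U) (a b : ZMod 2) (X Y Z : Vect κ U) :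
    Vect κ U :=
  cov X (cov Y Z) - sgn a b • cov Y (cov X Z) - cov (Vect.bracket a b X Y) Z

/-- The Ricci tensor `Ric(X, Y)` for `X`, `Y` homogeneous of degrees `a`, `b`: the supertrace of
the curvature, symmetrized. -/
def ricci (cov : Vect κ U → Vect κ U → Vect κ U) (a b : ZMod 2) (X Y : Vect κ U) : SFun κ U :=
  ∑ I, (sgn (deg I) (deg I + a + b) * (1 / 2)) •
    (curvature cov (deg I) a (Vect.frame I) X Y I +
      sgn a b • curvature cov (deg I) b (Vect.frame I) Y X I)

/-- The semi-symmetric non-metric connection `∇_X Y + X · g(Y, P)`. -/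
def semiSymm (cov : Vect κ U → Vect κ U → Vect κ U) (g : ι ⊕ κ → ι ⊕ κ → SFun κ U)
    (P : Vect κ U) (X Y : Vect κ U) : Vect κ U :=
  cov X Y + X.rmul (Vect.pair g Y P)

end Connection

end Superdomain

/-! ### Supermanifolds -/

section Manifold

variable {ι : Type} [Fintype ι] [DecidableEq ι] {κ : Type} [Fintype κ] [DecidableEq κ]

/-- The part of the target of the chart `φ` that is also covered by the chart `ψ`. -/
def overlap {X : Type u} [TopologicalSpace X] (φ ψ : OpenPartialHomeomorph X (ι → ℝ)) :
    Opens (ι → ℝ) :=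
  ⟨(φ.symm.trans ψ).source, (φ.symm.trans ψ).open_source⟩

/-- A supermanifold of dimension `|ι| | |κ|`: a second countable Hausdorff space with an atlas of
superdomains, glued along isomorphisms of superdomains over the coordinate changes of the
underlying space. -/
structure Supermanifold (ι κ : Type) [Fintype ι] [DecidableEq ι] [Fintype κ] [DecidableEq κ] where
  carrier : Type u
  [top : TopologicalSpace carrier]
  [t2 : T2Space carrier]
  [sc : SecondCountableTopology carrier]
  Index : Type v
  chart : Index → OpenPartialHomeomorph carrier (ι → ℝ)
  cover : ∀ x, ∃ i, x ∈ (chart i).source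
  trans : ∀ i j, SMap κ (overlap (chart i) (chart j))
  trans_body : ∀ i j (x : overlap (chart i) (chart j)) a,
    (SFun.body ((trans i j).even a)).1 x = chart j ((chart i).symm x.1) a
  trans_self : ∀ i, trans i i = SMap.incl _
  cocycle : ∀ i j k (W : Opens (ι → ℝ)) (hij : W ≤ overlap (chart i) (chart j))
    (hik : W ≤ overlap (chart i) (chart k))
    (hjk : ((trans i j).restrict hij).MapsTo (overlap (chart j) (chart k))) K,
    ((trans i j).restrict hij).subst hjk ((trans j k).coord K) =
      SFun.res hik ((trans i k).coord K)

attribute [instance] Supermanifold.top Supermanifold.t2 Supermanifold.sc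

namespace Supermanifold

/-- The open set of `ℝ^ι` on which the `i`-th superdomain lives. -/
def dom (M : Supermanifold.{u, v} ι κ) (i : M.Index) : Opens (ι → ℝ) :=
  ⟨(M.chart i).target, (M.chart i).open_target⟩

/-- The domain of the coordinate change from chart `i` to chart `j`. -/
abbrev ovl (M : Supermanifold.{u, v} ι κ) (i j : M.Index) : Opens (ι → ℝ) :=
  overlap (M.chart i) (M.chart j)

theorem mem_overlap {X : Type u} [TopologicalSpace X] (φ ψ : OpenPartialHomeomorph X (ι → ℝ))
    (x : ι → ℝ) : x ∈ overlap φ ψ ↔ x ∈ φ.target ∧ φ.symm x ∈ ψ.source := by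
  show x ∈ (φ.symm.trans ψ).source ↔ _
  simp

theorem ovl_le (M : Supermanifold.{u, v} ι κ) (i j : M.Index) : M.ovl i j ≤ M.dom i :=
  fun x hx => ((mem_overlap _ _ x).1 hx).1

theorem trans_mapsTo (M : Supermanifold.{u, v} ι κ) (i j : M.Index) :
    (M.trans i j).MapsTo (M.dom j) := by
  intro x
  have : (fun a => (SFun.body ((M.trans i j).even a)).1 x) =
      M.chart j ((M.chart i).symm x.1) := funext fun a => M.trans_body i j x a
  rw [this]
  exact (M.chart j).map_source ((mem_overlap _ _ x.1).1 x.2).2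

end Supermanifold

/-- Vector fields on a supermanifold, given by their components in the charts. -/
structure VectorField (M : Supermanifold.{u, v} ι κ) where
  comp : ∀ i, Vect κ (M.dom i)
  comp_trans : ∀ i j K, (M.trans i j).subst (M.trans_mapsTo i j) (comp j K) =
    ∑ I, SFun.res (M.ovl_le i j) (comp i I) * (M.trans i j).jac I K

/-- Even Riemannian metrics on a supermanifold (of arbitrary signature), given by their components
`comp i I J = ⟨∂_{x^I}, ∂_{x^J}⟩_g` in the charts: homogeneous of degree zero, supersymmetric,
non-degenerate, and compatible with the coordinate changes. -/
structure EvenMetric (M : Supermanifold.{u, v} ι κ) where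
  comp : ∀ i, ι ⊕ κ → ι ⊕ κ → SFun κ (M.dom i)
  comp_homog : ∀ i I J, comp i I J ∈ SFun.homog κ (M.dom i) (deg I + deg J)
  comp_symm : ∀ i I J, comp i I J = sgn (deg I) (deg J) • comp i J I
  nondeg : ∀ i, IsUnit (Matrix.of (comp i))
  comp_trans : ∀ i j I J, SFun.res (M.ovl_le i j) (comp i I J) =
    ∑ K, ∑ L, sgn (deg K) (deg J + deg L) • ((M.trans i j).jac I K * (M.trans i j).jac J L *
      (M.trans i j).subst (M.trans_mapsTo i j) (comp j K L))

namespace EvenMetric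

variable {M : Supermanifold.{u, v} ι κ}

/-- The Levi-Civita connection of a metric, given in the charts. On each chart it is the only
torsion free and metric compatible affine connection, so that no compatibility with the coordinate
changes has to be imposed. -/
structure LeviCivita (g : EvenMetric M) where
  conn : ∀ i, AffineConnection κ (M.dom i)
  isLeviCivita : ∀ i, (conn i).IsLeviCivita (g.comp i)

/-- `(M, g, cov)` is Einstein with Einstein constant `lam`: `Ric(X, Y) = lam g(X, Y)` for all
(homogeneous) vector fields, `Ric` being the Ricci tensor of the connection `cov`. -/
def IsEinsteinFor (g : EvenMetric M) (cov : ∀ i, Vect κ (M.dom i) → Vect κ (M.dom i) →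
    Vect κ (M.dom i)) (lam : ℝ) : Prop :=
  ∀ i a b (X Y : Vect κ (M.dom i)), X.IsHomog a → Y.IsHomog b →
    ricci (cov i) a b X Y = lam • Vect.pair (g.comp i) X Y

/-- `(M, g, ∇^L)` is Einstein with Einstein constant `lam`. -/
def IsEinstein (g : EvenMetric M) (lam : ℝ) : Prop :=
  ∃ D : g.LeviCivita, g.IsEinsteinFor (fun i => (D.conn i).cov) lam

/-- `(M, g, ∇̂)` is Einstein with Einstein constant `lam`, where `∇̂` is the semi-symmetric
non-metric connection `∇̂_X Y = ∇^L_X Y + X · g(Y, P)`. -/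
def IsEinsteinSemiSymm (g : EvenMetric M) (P : VectorField M) (lam : ℝ) : Prop :=
  ∃ D : g.LeviCivita,
    g.IsEinsteinFor (fun i => semiSymm (D.conn i).cov (g.comp i) (P.comp i)) lam

end EvenMetric

end Manifold

/-! ### The product with the real line and the warped product -/

section Product

variable {ι : Type} [Fintype ι] [DecidableEq ι] {κ : Type} [Fintype κ] [DecidableEq κ]

/-- `ℝ × ℝ^ι = ℝ^{Option ι}`; the coordinate `t` of the first factor has index `none`. -/
def consHomeo (ι : Type) : ℝ × (ι → ℝ) ≃ₜ (Option ι → ℝ) where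
  toFun p o := o.elim p.1 p.2
  invFun z := (z none, fun a => z (some a))
  left_inv _ := rfl
  right_inv z := funext fun o => by cases o <;> rfl
  continuous_toFun := by
    refine continuous_pi fun o => ?_
    cases o with
    | none => exact continuous_fst
    | some a => exact (continuous_apply a).comp continuous_snd
  continuous_invFun := by fun_prop

/-- The chart `id × φ` of `ℝ × X`. -/
def lineChart {X : Type u} [TopologicalSpace X] (φ : OpenPartialHomeomorph X (ι → ℝ)) :
    OpenPartialHomeomorph (ℝ × X) (Option ι → ℝ) :=
  ((OpenPartialHomeomorph.refl ℝ).prod φ).transHomeomorph (consHomeo ι)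

theorem mem_lineChart_target {X : Type u} [TopologicalSpace X]
    (φ : OpenPartialHomeomorph X (ι → ℝ)) (z : Option ι → ℝ) :
    z ∈ (lineChart φ).target ↔ (fun a => z (some a)) ∈ φ.target := by
  show ((consHomeo ι).symm z) ∈ (Set.univ : Set ℝ) ×ˢ φ.target ↔ _
  simp only [Set.mem_prod, Set.mem_univ, true_and]
  rfl

theorem mem_overlap_lineChart {X : Type u} [TopologicalSpace X]
    (φ ψ : OpenPartialHomeomorph X (ι → ℝ)) (z : Option ι → ℝ) :
    z ∈ overlap (lineChart φ) (lineChart ψ) ↔ (fun a => z (some a)) ∈ overlap φ ψ := by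
  rw [Supermanifold.mem_overlap, Supermanifold.mem_overlap, mem_lineChart_target]
  refine and_congr Iff.rfl ?_
  show ((z none, φ.symm fun a => z (some a)) : ℝ × X) ∈ (Set.univ : Set ℝ) ×ˢ ψ.source ↔ _
  simp only [Set.mem_prod, Set.mem_univ, true_and]

/-- The function `H(t)` on an open subset of `ℝ × ℝ^ι`. -/
def timeFn (W : Opens (Option ι → ℝ)) (H : ℝ → ℝ) (hH : ContDiff ℝ ∞ H) : CInf W :=
  CInf.mk (fun z => H (z none)) (hH.comp (contDiff_apply ℝ ℝ none)).contDiffOn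

/-- Pull-back of functions along the projection `ℝ × ℝ^ι → ℝ^ι`. -/
def CInf.pr {W : Opens (Option ι → ℝ)} {V : Opens (ι → ℝ)}
    (h : ∀ z : W, (fun a => z.1 (some a)) ∈ V) : CInf V →ₐ[ℝ] CInf W :=
  CInf.pull (fun a => CInf.coord W (some a)) h

/-- Pull-back of superfunctions along the projection `ℝ × ℝ^ι → ℝ^ι`. -/
def SFun.pr {W : Opens (Option ι → ℝ)} {V : Opens (ι → ℝ)}
    (h : ∀ z : W, (fun a => z.1 (some a)) ∈ V) : SFun κ V →ₐ[ℝ] SFun κ W :=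
  SFun.pull (fun a => CInf.coord W (some a)) h

theorem SFun.pr_tmul {W : Opens (Option ι → ℝ)} {V : Opens (ι → ℝ)}
    (h : ∀ z : W, (fun a => z.1 (some a)) ∈ V) (f : CInf V) (w : Grass κ) :
    SFun.pr h (f ⊗ₜ[ℝ] w) = CInf.pr h f ⊗ₜ[ℝ] w := rfl

theorem SFun.body_pr {W : Opens (Option ι → ℝ)} {V : Opens (ι → ℝ)}
    (h : ∀ z : W, (fun a => z.1 (some a)) ∈ V) (x : SFun κ V) :
    SFun.body (SFun.pr h x) = CInf.pr h (SFun.body x) := SFun.body_pull _ _ x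

/-- The morphism `id × c` of superdomains. -/
def SMap.line {U : Opens (ι → ℝ)} (c : SMap κ U) (W : Opens (Option ι → ℝ))
    (h : ∀ z : W, (fun a => z.1 (some a)) ∈ U) : SMap κ W where
  even o := o.elim (SFun.ofCInf (CInf.coord W none)) fun a => SFun.pr h (c.even a)
  even_mem o := by
    cases o with
    | none => exact SFun.ofCInf_mem_homog _
    | some a => exact SFun.pull_mem_homog _ _ (c.even_mem a)
  odd := (SFun.pr h).comp c.odd
  odd_mem B := SFun.pull_mem_homog _ _ (c.odd_mem B)

section Lemmas

variable {W W' : Opens (Option ι → ℝ)} {U V : Opens (ι → ℝ)}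

theorem CInf.fderiv_pr (h : ∀ z : W, (fun a => z.1 (some a)) ∈ V) (F : CInf V) (z : W)
    (y : Option ι → ℝ) : fderiv ℝ (ext0 (CInf.pr h F).1) z y =
      fderiv ℝ (ext0 F.1) (fun a => z.1 (some a)) fun a => y (some a) := by
  rw [CInf.fderiv_eq (CInf.pr h F).1 (fun z => ext0 F.1 (fun a => z (some a)))
    (fun x => (ext0_apply F.1 ⟨fun a => x.1 (some a), h x⟩).symm) z]
  have h1 : HasFDerivAt (fun z : Option ι → ℝ => fun a : ι => z (some a))
      (ContinuousLinearMap.pi fun a => ContinuousLinearMap.proj (some a)) z.1 :=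
    ContinuousLinearMap.hasFDerivAt
      (ContinuousLinearMap.pi fun a : ι => ContinuousLinearMap.proj (R := ℝ)
        (φ := fun _ : Option ι => ℝ) (some a))
  have h2 := (CInf.differentiableAt F ⟨fun a => z.1 (some a), h z⟩).hasFDerivAt.comp z.1 h1
  have h3 := h2.fderiv
  simp only [Function.comp_def] at h3
  rw [h3]
  rfl

theorem CInf.pderiv_none_pr (h : ∀ z : W, (fun a => z.1 (some a)) ∈ V) (F : CInf V) :
    CInf.pderiv W none (CInf.pr h F) = 0 := by
  apply Subtype.ext
  funext z
  rw [CInf.pderiv_apply, CInf.fderiv_pr]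
  have h4 : (fun a : ι => (Pi.single none 1 : Option ι → ℝ) (some a)) = 0 := by
    ext a; simp
  rw [h4, map_zero]
  rfl

theorem CInf.pderiv_some_pr (h : ∀ z : W, (fun a => z.1 (some a)) ∈ V) (F : CInf V) (b : ι) :
    CInf.pderiv W (some b) (CInf.pr h F) = CInf.pr h (CInf.pderiv V b F) := by
  apply Subtype.ext
  funext z
  rw [CInf.pderiv_apply, CInf.fderiv_pr]
  have h4 : (fun a : ι => (Pi.single (some b) 1 : Option ι → ℝ) (some a)) = Pi.single b 1 := by
    ext a; simp [Pi.single_apply]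
  rw [h4]
  rfl

theorem CInf.pderiv_some_timeFn (H : ℝ → ℝ) (hH : ContDiff ℝ ∞ H) (b : ι) :
    CInf.pderiv W (some b) (timeFn W H hH) = 0 := by
  apply Subtype.ext
  funext z
  rw [CInf.pderiv_apply, CInf.fderiv_eq (timeFn W H hH).1 (fun z => H (z none)) (fun _ => rfl) z]
  have h1 : HasFDerivAt (fun z : Option ι → ℝ => z none)
      (ContinuousLinearMap.proj (R := ℝ) (φ := fun _ : Option ι => ℝ) none) z.1 :=
    hasFDerivAt_apply none z.1
  have h2 := ((hH.differentiable (by simp)) (z.1 none)).hasFDerivAt.comp z.1 h1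
  have h3 := h2.fderiv
  simp only [Function.comp_def] at h3
  rw [h3]
  show (fderiv ℝ H _) ((Pi.single (some b) 1 : Option ι → ℝ) none) = 0
  rw [Pi.single_eq_of_ne (by simp), map_zero]

theorem SFun.d_pr_none (h : ∀ z : W, (fun a => z.1 (some a)) ∈ V) (F : SFun κ V) :
    SFun.d (Sum.inl none) (SFun.pr h F) = 0 := by
  induction F using TensorProduct.induction_on with
  | zero => simp
  | tmul f w =>
    show CInf.pderiv W none (CInf.pr h f) ⊗ₜ[ℝ] w = 0
    rw [CInf.pderiv_none_pr, TensorProduct.zero_tmul]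
  | add a b h1 h2 => rw [map_add, map_add, h1, h2, add_zero]

/-- The index in `Option ι ⊕ κ` of a coordinate of the second factor. -/
def up : ι ⊕ κ → Option ι ⊕ κ := Sum.map some _root_.id

theorem deg_up (I : ι ⊕ κ) : deg (up I) = deg I := by cases I <;> rfl

theorem SFun.d_pr_up (h : ∀ z : W, (fun a => z.1 (some a)) ∈ V) (I : ι ⊕ κ) (F : SFun κ V) :
    SFun.d (up I) (SFun.pr h F) = SFun.pr h (SFun.d I F) := by
  induction F using TensorProduct.induction_on with
  | zero => simp
  | tmul f w =>
    cases I with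
    | inl a =>
      show CInf.pderiv W (some a) (CInf.pr h f) ⊗ₜ[ℝ] w =
        CInf.pr h (CInf.pderiv V a f) ⊗ₜ[ℝ] w
      rw [CInf.pderiv_some_pr]
    | inr B => rfl
  | add a b h1 h2 => simp only [map_add, h1, h2]

theorem SMap.line_mapsTo {c : SMap κ U} (hW : ∀ z : W, (fun a => z.1 (some a)) ∈ U)
    (hc : c.MapsTo V) (hV : ∀ z : Option ι → ℝ, (fun a => z (some a)) ∈ V → z ∈ W') :
    (c.line W hW).MapsTo W' := by
  intro z
  apply hV
  have := hc ⟨_, hW z⟩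
  convert this using 2 with a
  show (SFun.body (SFun.pr hW (c.even a))).1 z = _
  rw [SFun.body_pr]
  rfl

theorem SMap.taylorTerm_line {c : SMap κ U} (hW : ∀ z : W, (fun a => z.1 (some a)) ∈ U)
    (hc : c.MapsTo V) (hV : ∀ z : W', (fun a => z.1 (some a)) ∈ V)
    (hl : (c.line W hW).MapsTo W') (H : ℝ → ℝ) (hH : ContDiff ℝ ∞ H) (k : ℕ) (F : CInf V) :
    (c.line W hW).taylorTerm hl k
        (timeFn W' H hH * CInf.pr hV F) =
      SFun.ofCInf (timeFn W H hH) * SFun.pr hW (c.taylorTerm hc k F) := by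
  induction k generalizing F with
  | zero =>
    show SFun.ofCInf (CInf.pull _ hl _) = SFun.ofCInf _ * SFun.pr hW (SFun.ofCInf _)
    have e : ∀ f : CInf U, SFun.pr hW (SFun.ofCInf f : SFun κ U) =
        SFun.ofCInf (CInf.pr hW f) := fun f => rfl
    rw [e, ← map_mul]
    congr 1
    apply Subtype.ext
    funext z
    have e0 : (SFun.body ((c.line W hW).even none)).1 z = z.1 none := by
      show (SFun.body (SFun.ofCInf (CInf.coord W none) : SFun κ W)).1 z = _
      rw [SFun.body_ofCInf]
      rfl
    have e1 : ∀ a, (SFun.body ((c.line W hW).even (some a))).1 z =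
        (SFun.body (c.even a)).1 ⟨fun a => z.1 (some a), hW z⟩ := by
      intro a
      show (SFun.body (SFun.pr hW (c.even a))).1 z = _
      rw [SFun.body_pr]
      rfl
    show H ((SFun.body ((c.line W hW).even none)).1 z) *
        F.1 ⟨fun a => (SFun.body ((c.line W hW).even (some a))).1 z, _⟩ =
      H (z.1 none) * F.1 ⟨fun a => (SFun.body (c.even a)).1 ⟨fun a => z.1 (some a), hW z⟩, _⟩
    rw [e0]
    exact congrArg (fun y => H (z.1 none) * F.1 y) (Subtype.ext (funext e1))
  | succ k ih =>
    simp only [SMap.taylorTerm, LinearMap.sum_apply, LinearMap.comp_apply,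
      LinearMap.mulLeft_apply, map_sum, map_mul, Finset.mul_sum]
    rw [Fintype.sum_option]
    have e0 : (c.line W hW).nil none = 0 := by
      show SFun.ofCInf _ - SFun.ofCInf (SFun.body (SFun.ofCInf _)) = 0
      rw [SFun.body_ofCInf, sub_self]
    rw [e0, zero_mul, zero_add]
    refine Finset.sum_congr rfl fun a _ => ?_
    have e1 : (c.line W hW).nil (some a) = SFun.pr hW (c.nil a) := by
      show SFun.pr hW (c.even a) - SFun.ofCInf (SFun.body (SFun.pr hW (c.even a))) = _
      rw [SMap.nil, map_sub]
      congr 1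
      rw [SFun.body_pr]
      rfl
    rw [CInf.pderiv_mul, CInf.pderiv_some_timeFn, zero_mul, add_zero, CInf.pderiv_some_pr,
      ih, e1, ← mul_assoc, ← mul_assoc, SFun.ofCInf_comm]

theorem SMap.subst_line {c : SMap κ U} (hW : ∀ z : W, (fun a => z.1 (some a)) ∈ U)
    (hc : c.MapsTo V) (hV : ∀ z : W', (fun a => z.1 (some a)) ∈ V)
    (hl : (c.line W hW).MapsTo W') (H : ℝ → ℝ) (hH : ContDiff ℝ ∞ H) (F : SFun κ V) :
    (c.line W hW).subst hl (SFun.ofCInf (timeFn W' H hH) * SFun.pr hV F) =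
      SFun.ofCInf (timeFn W H hH) * SFun.pr hW (c.subst hc F) := by
  induction F using TensorProduct.induction_on with
  | zero => simp
  | tmul f w =>
    have e : SFun.ofCInf (timeFn W' H hH) * SFun.pr hV (f ⊗ₜ[ℝ] w) =
        (timeFn W' H hH * CInf.pr hV f) ⊗ₜ[ℝ] w := by
      rw [SFun.pr_tmul]
      simp [SFun.ofCInf, Algebra.TensorProduct.tmul_mul_tmul]
    rw [e]
    simp only [SMap.subst, LinearMap.comp_apply, TensorProduct.map_tmul, LinearMap.mul'_apply,
      map_mul, AlgHom.toLinearMap_apply]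
    rw [← mul_assoc]
    congr 1
    simp only [SMap.taylor, LinearMap.sum_apply, LinearMap.smul_apply, map_sum, map_smul,
      Finset.mul_sum, SMap.taylorTerm_line hW hc hV hl, mul_smul_comm]
  | add a b h1 h2 => simp only [map_add, mul_add, h1, h2]

theorem SMap.subst_line_pr {c : SMap κ U} (hW : ∀ z : W, (fun a => z.1 (some a)) ∈ U)
    (hc : c.MapsTo V) (hV : ∀ z : W', (fun a => z.1 (some a)) ∈ V)
    (hl : (c.line W hW).MapsTo W') (F : SFun κ V) :
    (c.line W hW).subst hl (SFun.pr hV F) = SFun.pr hW (c.subst hc F) := by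
  have h := SMap.subst_line hW hc hV hl (fun _ => 1) contDiff_const F
  have e : ∀ W : Opens (Option ι → ℝ),
      (SFun.ofCInf (timeFn W (fun _ => 1) contDiff_const) : SFun κ W) = 1 := fun W => rfl
  rwa [e, e, one_mul, one_mul] at h

theorem index_cases (I : Option ι ⊕ κ) : I = Sum.inl none ∨ ∃ I' : ι ⊕ κ, I = up I' := by
  rcases I with (_ | a) | B
  · exact Or.inl rfl
  · exact Or.inr ⟨Sum.inl a, rfl⟩
  · exact Or.inr ⟨Sum.inr B, rfl⟩

theorem sum_index {A : Type} [AddCommMonoid A] (f : Option ι ⊕ κ → A) :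
    ∑ I, f I = f (Sum.inl none) + ∑ I : ι ⊕ κ, f (up I) := by
  rw [Fintype.sum_sum_type, Fintype.sum_option, Fintype.sum_sum_type, add_assoc]
  rfl

theorem SMap.line_coord_up (c : SMap κ U) (hW : ∀ z : W, (fun a => z.1 (some a)) ∈ U)
    (K : ι ⊕ κ) : (c.line W hW).coord (up K) = SFun.pr hW (c.coord K) := by
  cases K <;> rfl

theorem SMap.line_jac_up_up (c : SMap κ U) (hW : ∀ z : W, (fun a => z.1 (some a)) ∈ U)
    (I K : ι ⊕ κ) : (c.line W hW).jac (up I) (up K) = SFun.pr hW (c.jac I K) := by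
  rw [SMap.jac, SMap.line_coord_up, SFun.d_pr_up]
  rfl

theorem SMap.line_jac_none_up (c : SMap κ U) (hW : ∀ z : W, (fun a => z.1 (some a)) ∈ U)
    (K : ι ⊕ κ) : (c.line W hW).jac (Sum.inl none) (up K) = 0 := by
  rw [SMap.jac, SMap.line_coord_up, SFun.d_pr_none]

theorem CInf.pderiv_coord (a b : ι) (V : Opens (ι → ℝ)) :
    CInf.pderiv V a (CInf.coord V b) = if a = b then 1 else 0 := by
  apply Subtype.ext
  funext z
  rw [CInf.pderiv_apply, CInf.fderiv_eq (CInf.coord V b).1 (fun z => z b) (fun _ => rfl) z,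
    (hasFDerivAt_apply b z.1).fderiv]
  show (Pi.single a (1 : ℝ) : ι → ℝ) b = _
  split_ifs with h
  · subst h; simp
  · rw [Pi.single_eq_of_ne (Ne.symm h)]; rfl

theorem SMap.line_jac_none_none (c : SMap κ U) (hW : ∀ z : W, (fun a => z.1 (some a)) ∈ U) :
    (c.line W hW).jac (Sum.inl none) (Sum.inl none) = 1 := by
  show CInf.pderiv W none (CInf.coord W none) ⊗ₜ[ℝ] (1 : Grass κ) = 1
  rw [CInf.pderiv_coord, if_pos rfl]
  rfl

theorem SMap.line_jac_up_none (c : SMap κ U) (hW : ∀ z : W, (fun a => z.1 (some a)) ∈ U)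
    (I : ι ⊕ κ) : (c.line W hW).jac (up I) (Sum.inl none) = 0 := by
  cases I with
  | inl a =>
    show CInf.pderiv W (some a) (CInf.coord W none) ⊗ₜ[ℝ] (1 : Grass κ) = 0
    rw [CInf.pderiv_coord, if_neg (by simp), TensorProduct.zero_tmul]
  | inr B =>
    show CInf.coord W none ⊗ₜ[ℝ] (CliffordAlgebra.contractLeft (LinearMap.proj B) (1 : Grass κ)) = 0
    rw [CliffordAlgebra.contractLeft_one, TensorProduct.tmul_zero]

theorem SMap.subst_one {c : SMap κ U} (hc : c.MapsTo V) : c.subst hc 1 = 1 := by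
  have h : ∀ k, c.taylorTerm hc (k + 1) 1 = 0 := by
    intro k
    simp only [SMap.taylorTerm, LinearMap.sum_apply, LinearMap.comp_apply,
      LinearMap.mulLeft_apply]
    refine Finset.sum_eq_zero fun a _ => ?_
    have : CInf.pderiv V a 1 = 0 := by
      have := CInf.pderiv_mul a (1 : CInf V) 1
      rw [mul_one, mul_one, one_mul] at this
      exact left_eq_add.1 this
    rw [this, map_zero, mul_zero]
  have h0 : c.taylorTerm hc 0 1 = 1 := by
    show SFun.ofCInf (CInf.pull _ hc 1) = 1
    rw [map_one, map_one]
  show LinearMap.mul' ℝ (SFun κ U) (c.taylor hc 1 ⊗ₜ[ℝ] c.odd 1) = 1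
  rw [LinearMap.mul'_apply, map_one c.odd, mul_one, SMap.taylor, LinearMap.sum_apply,
    Finset.sum_range_succ']
  simp [h, h0]

end Lemmas

/-- The product `ℝ^{1|0} × M` of the real line with a supermanifold: the space `ℝ × |M|`, with the
charts `id × φ` and the coordinate changes `id × τ`. -/
def Supermanifold.line (M : Supermanifold.{u, v} ι κ) : Supermanifold.{u, v} (Option ι) κ where
  carrier := ℝ × M.carrier
  Index := M.Index
  chart i := lineChart (M.chart i)
  cover := fun ⟨t, x⟩ => by
    obtain ⟨i, hi⟩ := M.cover x
    exact ⟨i, Set.mk_mem_prod (Set.mem_univ t) hi⟩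
  trans i j := (M.trans i j).line _ fun z => (mem_overlap_lineChart _ _ z.1).1 z.2
  trans_body i j z o := by
    cases o with
    | none =>
      show (SFun.body (SFun.ofCInf (CInf.coord _ none) : SFun κ _)).1 z = z.1 none
      rw [SFun.body_ofCInf]
      rfl
    | some a =>
      show (SFun.body (SFun.pr _ ((M.trans i j).even a))).1 z = _
      rw [SFun.body_pr]
      exact M.trans_body i j ⟨fun a => z.1 (some a), (mem_overlap_lineChart _ _ z.1).1 z.2⟩ a
  trans_self i := by
    rw [M.trans_self]
    ext1
    · funext o
      cases o <;> rfl
    · exact AlgHom.ext fun w => rfl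
  cocycle i j k W hij hik hjk K := by
    have hW : ∀ z : W, (fun a => z.1 (some a)) ∈
        overlap (M.chart i) (M.chart j) ⊓ overlap (M.chart i) (M.chart k) := fun z =>
      ⟨(mem_overlap_lineChart _ _ z.1).1 (hij z.2), (mem_overlap_lineChart _ _ z.1).1 (hik z.2)⟩
    have hc : ((M.trans i j).restrict
        (inf_le_left : overlap (M.chart i) (M.chart j) ⊓ overlap (M.chart i) (M.chart k) ≤ _)).MapsTo
        (overlap (M.chart j) (M.chart k)) := by
      intro x
      have e : (fun a => (SFun.body (((M.trans i j).restrict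
          (inf_le_left : overlap (M.chart i) (M.chart j) ⊓ overlap (M.chart i) (M.chart k) ≤ _)).even
            a)).1 x) = M.chart j ((M.chart i).symm x.1) := by
        funext a
        rw [← M.trans_body i j ⟨x.1, x.2.1⟩ a]
        show (SFun.body (SFun.pull _ _ _)).1 x = _
        rw [SFun.body_pull]
        rfl
      rw [e]
      have h1 := (Supermanifold.mem_overlap _ _ x.1).1 x.2.1
      have h2 := (Supermanifold.mem_overlap _ _ x.1).1 x.2.2
      refine (Supermanifold.mem_overlap _ _ _).2 ⟨(M.chart j).map_source h1.2, ?_⟩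
      rw [(M.chart j).left_inv h1.2]
      exact h2.2
    have hr : ∀ (j' : M.Index) (h1 : W ≤ overlap (lineChart (M.chart i)) (lineChart (M.chart j')))
        (h2 : ∀ z : overlap (lineChart (M.chart i)) (lineChart (M.chart j')),
          (fun a => z.1 (some a)) ∈ overlap (M.chart i) (M.chart j'))
        (h3 : overlap (M.chart i) (M.chart j) ⊓ overlap (M.chart i) (M.chart k) ≤
          overlap (M.chart i) (M.chart j')) (x : SFun κ (overlap (M.chart i) (M.chart j'))),
        SFun.res h1 (SFun.pr h2 x) = SFun.pr hW (SFun.res h3 x) := by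
      intro j' h1 h2 h3 x
      have h4 : ∀ z : W, (fun a => (CInf.coord W (some a)).1 z) ∈
          overlap (M.chart i) (M.chart j') := fun z => h3 (hW z)
      exact (SFun.pull_pull _ _ _ _ (fun a => CInf.coord W (some a)) h4 (fun _ => rfl) x).trans
        (SFun.pull_pull _ _ _ _ (fun a => CInf.coord W (some a)) h4 (fun _ => rfl) x).symm
    have hl : ((M.trans i j).line (overlap (lineChart (M.chart i)) (lineChart (M.chart j)))
          fun z => (mem_overlap_lineChart _ _ z.1).1 z.2).restrict hij =
        ((M.trans i j).restrict inf_le_left).line W hW := by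
      ext1
      · funext o
        cases o with
        | none => rfl
        | some a => exact hr j hij _ inf_le_left _
      · exact AlgHom.ext fun w => hr j hij _ inf_le_left _
    have key : ∀ (c' : SMap κ W), c' = ((M.trans i j).restrict inf_le_left).line W hW →
        ∀ (hjk : c'.MapsTo (overlap (lineChart (M.chart j)) (lineChart (M.chart k)))),
        c'.subst hjk (((M.trans j k).line _
          fun z => (mem_overlap_lineChart _ _ z.1).1 z.2).coord K) =
        SFun.res hik (((M.trans i k).line _
          fun z => (mem_overlap_lineChart _ _ z.1).1 z.2).coord K) := by
      rintro c' rfl hjk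
      rcases index_cases K with rfl | ⟨K', rfl⟩
      · have h := SMap.subst_line hW hc
          (W' := overlap (lineChart (M.chart j)) (lineChart (M.chart k)))
          (fun z => (mem_overlap_lineChart _ _ z.1).1 z.2) hjk _root_.id contDiff_id 1
        rw [SMap.subst_one, map_one, map_one, mul_one, mul_one] at h
        exact h
      · rw [SMap.line_coord_up, SMap.line_coord_up, SMap.subst_line_pr hW hc, hr k hik _ inf_le_right]
        congr 1
        exact M.cocycle i j k _ _ _ _ K'
    exact key _ hl hjk

/-- Sections over the `i`-th chart of `ℝ × M` project to sections over that of `M`. -/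
theorem Supermanifold.line_dom (M : Supermanifold.{u, v} ι κ) (i : M.Index) (z : M.line.dom i) :
    (fun a => z.1 (some a)) ∈ M.dom i := (mem_lineChart_target _ z.1).1 z.2

theorem Supermanifold.line_ovl (M : Supermanifold.{u, v} ι κ) (i j : M.Index) (z : M.line.ovl i j) :
    (fun a => z.1 (some a)) ∈ M.ovl i j := (mem_overlap_lineChart _ _ z.1).1 z.2

theorem Supermanifold.line_trans (M : Supermanifold.{u, v} ι κ) (i j : M.Index) :
    M.line.trans i j = (M.trans i j).line (M.line.ovl i j) (M.line_ovl i j) := rfl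

/-- The vector field `∂_t` on `ℝ^{1|0} × M`. -/
def dt (M : Supermanifold.{u, v} ι κ) : VectorField M.line where
  comp i := Vect.frame (U := M.line.dom i) (Sum.inl none)
  comp_trans i j K := by
    rw [Finset.sum_eq_single (Sum.inl none)]
    · rcases index_cases K with rfl | ⟨K', rfl⟩
      · simp only [Vect.frame, Pi.single_eq_same, SMap.subst_one, map_one, one_mul]
        exact (SMap.line_jac_none_none _ _).symm
      · have h1 : (Vect.frame (Sum.inl none) : Vect κ (M.line.dom j)) (up K') = 0 := by
          cases K' <;> simp [Vect.frame, up]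
        rw [h1, map_zero]
        refine Eq.trans ?_ (congrArg _ (SMap.line_jac_none_up _ _ _).symm)
        rw [mul_zero]
    · intro I _ hI
      simp only [Vect.frame, Pi.single_eq_of_ne hI, map_zero, zero_mul]
    · simp

/-- The components of `-dt ⊗ dt + h(t)² g`. -/
def warpComp {W : Opens (Option ι → ℝ)} {V : Opens (ι → ℝ)}
    (hW : ∀ z : W, (fun a => z.1 (some a)) ∈ V) (h : ℝ → ℝ) (hs : ContDiff ℝ ∞ h)
    (g : ι ⊕ κ → ι ⊕ κ → SFun κ V) : Option ι ⊕ κ → Option ι ⊕ κ → SFun κ W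
  | Sum.inl none, Sum.inl none => -1
  | Sum.inl none, Sum.inl (some _) => 0
  | Sum.inl none, Sum.inr _ => 0
  | Sum.inl (some _), Sum.inl none => 0
  | Sum.inr _, Sum.inl none => 0
  | Sum.inl (some a), Sum.inl (some b) => warp (Sum.inl a) (Sum.inl b)
  | Sum.inl (some a), Sum.inr B => warp (Sum.inl a) (Sum.inr B)
  | Sum.inr A, Sum.inl (some b) => warp (Sum.inr A) (Sum.inl b)
  | Sum.inr A, Sum.inr B => warp (Sum.inr A) (Sum.inr B)
where
  warp (I J : ι ⊕ κ) : SFun κ W :=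
    SFun.ofCInf (timeFn W (fun t => h t ^ 2) (hs.pow 2)) * SFun.pr hW (g I J)

section WarpLemmas

variable {W : Opens (Option ι → ℝ)} {V : Opens (ι → ℝ)}
    (hW : ∀ z : W, (fun a => z.1 (some a)) ∈ V) (h : ℝ → ℝ) (hs : ContDiff ℝ ∞ h)
    (g : ι ⊕ κ → ι ⊕ κ → SFun κ V)

theorem warpComp_none_none : warpComp hW h hs g (Sum.inl none) (Sum.inl none) = -1 := rfl

theorem warpComp_none_up (J : ι ⊕ κ) : warpComp hW h hs g (Sum.inl none) (up J) = 0 := by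
  cases J <;> rfl

theorem warpComp_up_none (J : ι ⊕ κ) : warpComp hW h hs g (up J) (Sum.inl none) = 0 := by
  cases J <;> rfl

theorem warpComp_up_up (I J : ι ⊕ κ) : warpComp hW h hs g (up I) (up J) =
    SFun.ofCInf (timeFn W (fun t => h t ^ 2) (hs.pow 2)) * SFun.pr hW (g I J) := by
  cases I <;> cases J <;> rfl

theorem warpComp_mul (k : ℝ → ℝ) (ks : ContDiff ℝ ∞ k) (g' : ι ⊕ κ → ι ⊕ κ → SFun κ V)
    (hk : ∀ t, h t * k t = 1) (hg : Matrix.of g * Matrix.of g' = 1) :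
    Matrix.of (warpComp hW h hs g) * Matrix.of (warpComp hW k ks g') = 1 := by
  have e : timeFn W (fun t => h t ^ 2) (hs.pow 2) * timeFn W (fun t => k t ^ 2) (ks.pow 2) = 1 := by
    apply Subtype.ext
    funext z
    show h (z.1 none) ^ 2 * k (z.1 none) ^ 2 = 1
    rw [← mul_pow, hk, one_pow]
  ext I J
  rw [Matrix.mul_apply, sum_index]
  simp only [Matrix.of_apply]
  rcases index_cases I with rfl | ⟨I, rfl⟩ <;> rcases index_cases J with rfl | ⟨J, rfl⟩
  · simp only [warpComp_none_none, warpComp_none_up, zero_mul, Finset.sum_const_zero]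
    simp
  · simp only [warpComp_none_up, zero_mul, mul_zero, Finset.sum_const_zero, add_zero]
    rw [Matrix.one_apply_ne]
    cases J <;> simp [up]
  · simp only [warpComp_up_none, zero_mul, mul_zero, Finset.sum_const_zero, add_zero]
    rw [Matrix.one_apply_ne]
    cases I <;> simp [up]
  · simp only [warpComp_up_none, warpComp_up_up, zero_mul, zero_add]
    have hIJ : ∑ K, g I K * g' K J = (1 : Matrix (ι ⊕ κ) (ι ⊕ κ) (SFun κ V)) I J := by
      rw [← hg, Matrix.mul_apply]
      rfl
    have : ∀ K, SFun.ofCInf (timeFn W (fun t => h t ^ 2) (hs.pow 2)) * SFun.pr hW (g I K) *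
        (SFun.ofCInf (timeFn W (fun t => k t ^ 2) (ks.pow 2)) * SFun.pr hW (g' K J)) =
        SFun.pr hW (g I K * g' K J) := by
      intro K
      rw [mul_assoc, ← mul_assoc (SFun.pr hW (g I K)), ← SFun.ofCInf_comm, mul_assoc,
        ← mul_assoc, ← map_mul, e, map_one, one_mul, map_mul]
    simp only [this]
    rw [← map_sum, hIJ]
    have hinj : Function.Injective (up : ι ⊕ κ → Option ι ⊕ κ) :=
      Function.Injective.sumMap (Option.some_injective _) Function.injective_id
    by_cases hc : I = J
    · subst hc
      simp
    · rw [Matrix.one_apply_ne hc, Matrix.one_apply_ne (fun h' => hc (hinj h')), map_zero]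

end WarpLemmas

theorem sgn_zero_left (a : ZMod 2) : sgn 0 a = 1 := by simp [sgn]

theorem sgn_zero_right (a : ZMod 2) : sgn a 0 = 1 := by simp [sgn]

/-- The warped product metric `-dt ⊗ dt + h(t)² g` on `ℝ^{1|0} × M`. -/
def EvenMetric.warp {M : Supermanifold.{u, v} ι κ} (g : EvenMetric M) (h : ℝ → ℝ)
    (hs : ContDiff ℝ ∞ h) (h0 : ∀ t, h t ≠ 0) : EvenMetric M.line where
  comp i := warpComp (M.line_dom i) h hs (g.comp i)
  comp_homog i I J := by
    rcases index_cases I with rfl | ⟨I, rfl⟩ <;> rcases index_cases J with rfl | ⟨J, rfl⟩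
    · rw [warpComp_none_none]
      refine Submodule.neg_mem _ ?_
      have := SFun.ofCInf_mem_homog (κ := κ) (1 : CInf (M.line.dom i))
      rwa [map_one] at this
    · rw [warpComp_none_up]
      exact Submodule.zero_mem _
    · rw [warpComp_up_none]
      exact Submodule.zero_mem _
    · rw [warpComp_up_up, deg_up, deg_up]
      exact SFun.ofCInf_mul_mem_homog _ (SFun.pull_mem_homog _ _ (g.comp_homog i I J))
  comp_symm i I J := by
    rcases index_cases I with rfl | ⟨I, rfl⟩ <;> rcases index_cases J with rfl | ⟨J, rfl⟩
    · show _ = sgn 0 0 • _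
      rw [sgn_zero_left, one_smul]
    · rw [warpComp_none_up, warpComp_up_none, smul_zero]
    · rw [warpComp_none_up, warpComp_up_none, smul_zero]
    · rw [warpComp_up_up, warpComp_up_up, deg_up, deg_up, g.comp_symm i I J, map_smul,
        mul_smul_comm]
  nondeg i := by
    obtain ⟨⟨A, B, hAB, hBA⟩, rfl : A = _⟩ := g.nondeg i
    exact ⟨⟨_, Matrix.of (warpComp (M.line_dom i) (fun t => (h t)⁻¹) (hs.inv h0) B),
      warpComp_mul _ h hs _ _ (hs.inv h0) _ (fun t => mul_inv_cancel₀ (h0 t)) hAB,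
      warpComp_mul _ _ (hs.inv h0) _ h hs _ (fun t => inv_mul_cancel₀ (h0 t)) hBA⟩, rfl⟩
  comp_trans i j I J := by
    have key : ∀ hm : ((M.trans i j).line (M.line.ovl i j) (M.line_ovl i j)).MapsTo (M.line.dom j),
        SFun.res (M.line.ovl_le i j) (warpComp (M.line_dom i) h hs (g.comp i) I J) =
        ∑ K, ∑ L, sgn (deg K) (deg J + deg L) •
          (((M.trans i j).line (M.line.ovl i j) (M.line_ovl i j)).jac I K *
            ((M.trans i j).line (M.line.ovl i j) (M.line_ovl i j)).jac J L *
            ((M.trans i j).line (M.line.ovl i j) (M.line_ovl i j)).subst hm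
              (warpComp (M.line_dom j) h hs (g.comp j) K L)) := by
      intro hm
      simp only [sum_index]
      rcases index_cases I with rfl | ⟨I, rfl⟩ <;> rcases index_cases J with rfl | ⟨J, rfl⟩
      · simp only [SMap.line_jac_none_none, SMap.line_jac_none_up, warpComp_none_none,
          warpComp_none_up, map_zero, mul_zero, zero_mul, smul_zero, Finset.sum_const_zero,
          add_zero, map_neg, map_one, SMap.subst_one, mul_one]
        show _ = sgn 0 _ • _
        rw [sgn_zero_left, one_smul, one_mul]
      · simp only [SMap.line_jac_none_none, SMap.line_jac_none_up, SMap.line_jac_up_none,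
          warpComp_none_up, map_zero, mul_zero, zero_mul, smul_zero, Finset.sum_const_zero,
          add_zero]
      · simp only [SMap.line_jac_none_none, SMap.line_jac_none_up, SMap.line_jac_up_none,
          warpComp_up_none, map_zero, mul_zero, zero_mul, smul_zero, Finset.sum_const_zero,
          add_zero]
      · simp only [SMap.line_jac_up_none, SMap.line_jac_up_up, warpComp_up_up, mul_zero, zero_mul,
          smul_zero, Finset.sum_const_zero, zero_add, deg_up,
          SMap.subst_line (M.line_ovl i j) (M.trans_mapsTo i j) (M.line_dom j) hm]
        have hr : SFun.res (M.line.ovl_le i j) (SFun.pr (M.line_dom i) (g.comp i I J)) =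
            SFun.pr (M.line_ovl i j) (SFun.res (M.ovl_le i j) (g.comp i I J)) := by
          have h4 : ∀ z : M.line.ovl i j, (fun a => (CInf.coord (M.line.ovl i j) (some a)).1 z) ∈
              M.dom i := fun z => M.ovl_le i j (M.line_ovl i j z)
          exact (SFun.pull_pull _ _ _ _ (fun a => CInf.coord _ (some a)) h4 (fun _ => rfl) _).trans
            (SFun.pull_pull _ _ _ _ (fun a => CInf.coord _ (some a)) h4 (fun _ => rfl) _).symm
        rw [map_mul, hr, g.comp_trans i j I J]
        simp only [map_sum, map_smul, map_mul, Finset.mul_sum, mul_smul_comm]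
        refine Finset.sum_congr rfl fun K _ => Finset.sum_congr rfl fun L _ => ?_
        congr 1
        rw [← mul_assoc (_ * _) (SFun.ofCInf _), ← SFun.ofCInf_comm]
        simp only [mul_assoc]
        rfl
    exact key _

end Product

end SuperGeom

end

/-!
Koszul's braid argument makes a Levi-Civita connection unique, so both sides of the equivalence can
be computed with an explicit connection in each chart. On the product with the line every
connection involved has Christoffel symbols `∇_{∂_t} ∂_t = α ∂_t`, `∇_{∂_t} ∂_I = β ∂_I`,
`∇_{∂_I} ∂_t = γ ∂_I`, `∇_{∂_I} ∂_J = ∇^{M₂}_{∂_I} ∂_J + δ g_{IJ} ∂_t` with functions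
`α, β, γ, δ` of time: the Levi-Civita connection of the warped product has `α = 0`,
`β = γ = h' / h`, `δ = h h'`, and passing to the semi-symmetric connection subtracts `1` from `α`
and from `γ`. One curvature computation for this family turns the Einstein equation into a scalar
equation in the time direction and an equation on the fibres `t = const`. With `m = q - n` the
first is `m (h - h'') = λ₀ h`, the second says that the fibre is Einstein with constant `-F(t)`,
`F = h h'' + (m - 1) h'² - m h h' + λ₀ h²`, so that `F` is a constant `λ_N`.

Writing `λ₀ = m (1 - k)`, the first equation is `h'' = k h`. Differentiating `F = λ_N` gives
`2 h h' - h'² - k h² = 0`, and differentiating once more `(1 - k) h' = 0`. Hence either `k = 1`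
and `h' = h`, or `h' = 0` and `k = 0`.
-/

noncomputable section

namespace SuperGeom

section Sign

theorem zmod_two_eq_zero_or_one (a : ZMod 2) : a = 0 ∨ a = 1 := by
  decide +revert

theorem sgn_one_one : sgn 1 1 = -1 := by
  simp [sgn, ZMod.val_one]

theorem sgn_comm (a b : ZMod 2) : sgn a b = sgn b a := by
  rw [sgn, sgn, mul_comm]

theorem sgn_add_right (a b c : ZMod 2) : sgn a (b + c) = sgn a b * sgn a c := by
  rcases zmod_two_eq_zero_or_one a with rfl | rfl <;>
    rcases zmod_two_eq_zero_or_one b with rfl | rfl <;>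
    rcases zmod_two_eq_zero_or_one c with rfl | rfl <;>
    simp [sgn_zero_left, sgn_zero_right, sgn_one_one, CharTwo.add_self_eq_zero]

theorem sgn_add_left (a b c : ZMod 2) : sgn (a + b) c = sgn a c * sgn b c := by
  rw [sgn_comm, sgn_add_right, sgn_comm c a, sgn_comm c b]

theorem sgn_mul_self (a b : ZMod 2) : sgn a b * sgn a b = 1 := by
  rw [← sgn_add_right, CharTwo.add_self_eq_zero, sgn_zero_right]

end Sign

section Clifford

open CliffordAlgebra

variable {R M : Type*} [CommRing R] [AddCommGroup M] [Module R M] {Q : QuadraticForm R M}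

theorem contractLeft_mul (d : Module.Dual R M) (x y : CliffordAlgebra Q) :
    contractLeft d (x * y) = contractLeft d x * y + involute x * contractLeft d y := by
  induction x using left_induction with
  | algebraMap r =>
    rw [contractLeft_algebraMap_mul, contractLeft_algebraMap, AlgHom.commutes, zero_mul, zero_add]
  | add a b ha hb => simp only [add_mul, map_add, ha, hb]; abel
  | ι_mul x m hx =>
    rw [mul_assoc, contractLeft_ι_mul, hx, contractLeft_ι_mul, map_mul, involute_ι]
    simp only [mul_add, sub_mul, neg_mul, smul_mul_assoc, mul_assoc]
    abel

theorem involute_contractLeft (d : Module.Dual R M) (x : CliffordAlgebra Q) :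
    involute (contractLeft d x) = -contractLeft d (involute x) := by
  induction x using left_induction with
  | algebraMap r => rw [AlgHom.commutes, contractLeft_algebraMap, map_zero, neg_zero]
  | add a b ha hb => simp only [map_add, ha, hb, neg_add]
  | ι_mul x m hx =>
    simp only [contractLeft_ι_mul, map_mul, involute_ι, neg_mul, map_neg, map_sub, map_smul, hx,
      mul_neg]
    abel

theorem exists_even_add_odd (x : CliffordAlgebra Q) :
    ∃ a ∈ evenOdd Q 0, ∃ b ∈ evenOdd Q 1, a + b = x := by
  rw [← Submodule.mem_sup, (evenOdd_isCompl Q).sup_eq_top]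
  exact Submodule.mem_top

end Clifford

section Exterior

open CliffordAlgebra

variable {V : Type*} [AddCommGroup V] [Module ℝ V]

theorem involute_of_mem_evenOdd {Q : QuadraticForm ℝ V} {p : ZMod 2} {w : CliffordAlgebra Q}
    (hw : w ∈ evenOdd Q p) : involute w = sgn 1 p • w := by
  rcases zmod_two_eq_zero_or_one p with rfl | rfl
  · rw [sgn_zero_right, one_smul, involute_eq_of_mem_even hw]
  · rw [sgn_one_one, neg_one_smul, involute_eq_of_mem_odd hw]

theorem mul_comm_of_mem_evenOdd {p r : ZMod 2} {w v : ExteriorAlgebra ℝ V}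
    (hw : w ∈ evenOdd (0 : QuadraticForm ℝ V) p) (hv : v ∈ evenOdd (0 : QuadraticForm ℝ V) r) :
    w * v = sgn p r • (v * w) := by
  have h := map_mul_map_of_isOrtho_of_mem_evenOdd (.id 0) (.id 0)
    (fun x y => by simp [QuadraticMap.isOrtho_def]) w v hw hv
  simp only [map_id, AlgHom.id_apply] at h
  rw [h]
  rcases zmod_two_eq_zero_or_one p with rfl | rfl <;>
    rcases zmod_two_eq_zero_or_one r with rfl | rfl <;>
    simp [sgn_zero_left, sgn_zero_right, sgn_one_one]

end Exterior

section Superfunction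

variable {ι : Type} [Fintype ι] [DecidableEq ι] {U : Opens (ι → ℝ)}

namespace CInf

theorem pderiv_pderiv_apply (a b : ι) (f : CInf U) (x : U) :
    (pderiv U a (pderiv U b f)).1 x =
      fderiv ℝ (fderiv ℝ (ext0 f.1)) x (Pi.single a 1) (Pi.single b 1) := by
  have hf : DifferentiableAt ℝ (fderiv ℝ (ext0 f.1)) x :=
    (((contDiffOn f).fderiv_of_isOpen U.isOpen (m := ∞) (by simp)).differentiableOn
      (by simp)).differentiableAt (U.isOpen.mem_nhds x.2)
  rw [pderiv_apply, fderiv_eq _ (fun x => fderiv ℝ (ext0 f.1) x (Pi.single b 1))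
    (pderiv_apply b f), fderiv_clm_apply hf (differentiableAt_const _)]
  simp

theorem pderiv_comm (a b : ι) (f : CInf U) :
    pderiv U a (pderiv U b f) = pderiv U b (pderiv U a f) := by
  apply Subtype.ext
  funext x
  have hf : ContDiffAt ℝ ∞ (ext0 f.1) x := (contDiffOn f).contDiffAt (U.isOpen.mem_nhds x.2)
  rw [pderiv_pderiv_apply, pderiv_pderiv_apply]
  exact hf.isSymmSndFDerivAt (by simpa using ENat.LEInfty.out) _ _

end CInf

namespace SFun

variable {κ : Type}

theorem twist_zero (x : SFun κ U) : twist 0 x = x := by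
  rw [twist, if_pos rfl, LinearMap.id_apply]

theorem twist_one_eq_map (x : SFun κ U) :
    twist 1 x = Algebra.TensorProduct.map (.id ℝ (CInf U)) CliffordAlgebra.involute x := by
  rw [twist, if_neg one_ne_zero]
  rfl

theorem twist_one_tmul (f : CInf U) (w : Grass κ) :
    twist 1 (f ⊗ₜ[ℝ] w : SFun κ U) = f ⊗ₜ[ℝ] CliffordAlgebra.involute w := by
  rw [twist_one_eq_map]
  rfl

theorem twist_ofCInf (p : ZMod 2) (f : CInf U) : twist p (ofCInf f : SFun κ U) = ofCInf f := by
  rcases zmod_two_eq_zero_or_one p with rfl | rfl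
  · rw [twist_zero]
  · exact (twist_one_tmul f 1).trans (by rw [map_one]; rfl)

theorem twist_one (p : ZMod 2) : twist p (1 : SFun κ U) = 1 := twist_ofCInf p 1

theorem twist_mul (p : ZMod 2) (x y : SFun κ U) : twist p (x * y) = twist p x * twist p y := by
  rcases zmod_two_eq_zero_or_one p with rfl | rfl
  · simp only [twist_zero]
  · simp only [twist_one_eq_map, map_mul]

theorem d_inl_tmul (a : ι) (f : CInf U) (w : Grass κ) :
    d (Sum.inl a) (f ⊗ₜ[ℝ] w : SFun κ U) = CInf.pderiv U a f ⊗ₜ[ℝ] w := rfl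

theorem d_inr_tmul (B : κ) (f : CInf U) (w : Grass κ) :
    d (Sum.inr B) (f ⊗ₜ[ℝ] w : SFun κ U) =
      f ⊗ₜ[ℝ] CliffordAlgebra.contractLeft (LinearMap.proj B) w := rfl

theorem d_tmul_mul_tmul (I : ι ⊕ κ) (f g : CInf U) (w v : Grass κ) :
    d I ((f ⊗ₜ w : SFun κ U) * g ⊗ₜ v) =
      d I (f ⊗ₜ w) * g ⊗ₜ v + twist (deg I) (f ⊗ₜ w) * d I (g ⊗ₜ v) := by
  cases I with
  | inl a =>
    simp only [deg, Sum.elim_inl, twist_zero, d_inl_tmul, Algebra.TensorProduct.tmul_mul_tmul,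
      CInf.pderiv_mul, TensorProduct.add_tmul, add_comm]
  | inr B =>
    simp only [deg, Sum.elim_inr, twist_one_tmul, d_inr_tmul, Algebra.TensorProduct.tmul_mul_tmul,
      ← TensorProduct.tmul_add]
    exact congrArg (_ ⊗ₜ[ℝ] ·) (contractLeft_mul _ w v)

theorem d_mul (I : ι ⊕ κ) (x y : SFun κ U) :
    d I (x * y) = d I x * y + twist (deg I) x * d I y := by
  induction x using TensorProduct.induction_on with
  | zero => simp
  | add a b ha hb => simp only [add_mul, map_add, ha, hb]; abel
  | tmul f w =>
    induction y using TensorProduct.induction_on with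
    | zero => simp
    | add a b ha hb => simp only [mul_add, map_add, ha, hb]; abel
    | tmul g v => exact d_tmul_mul_tmul I f g w v

theorem d_one (I : ι ⊕ κ) : d I (1 : SFun κ U) = 0 := by
  have h := d_mul I (1 : SFun κ U) 1
  rwa [mul_one, mul_one, twist_one, one_mul, left_eq_add] at h

theorem twist_one_d (I : ι ⊕ κ) (x : SFun κ U) :
    twist 1 (d I x) = sgn 1 (deg I) • d I (twist 1 x) := by
  induction x using TensorProduct.induction_on with
  | zero => simp
  | add a b ha hb => simp only [map_add, ha, hb, smul_add]
  | tmul f w =>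
    cases I with
    | inl a =>
      simp only [deg, Sum.elim_inl, sgn_zero_right, one_smul, d_inl_tmul, twist_one_tmul]
    | inr B =>
      simp only [deg, Sum.elim_inr, sgn_one_one, neg_one_smul, d_inr_tmul, twist_one_tmul,
        involute_contractLeft, TensorProduct.tmul_neg]

theorem twist_d (p : ZMod 2) (I : ι ⊕ κ) (x : SFun κ U) :
    twist p (d I x) = sgn p (deg I) • d I (twist p x) := by
  rcases zmod_two_eq_zero_or_one p with rfl | rfl
  · rw [twist_zero, twist_zero, sgn_zero_left, one_smul]
  · exact twist_one_d I x

theorem d_comm (I J : ι ⊕ κ) (x : SFun κ U) :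
    d I (d J x) = sgn (deg I) (deg J) • d J (d I x) := by
  induction x using TensorProduct.induction_on with
  | zero => simp
  | add a b ha hb => simp only [map_add, ha, hb, smul_add]
  | tmul f w =>
    cases I <;> cases J <;>
      simp only [deg, Sum.elim_inl, Sum.elim_inr, sgn_zero_left, sgn_zero_right, sgn_one_one,
        one_smul, neg_one_smul, d_inl_tmul, d_inr_tmul, ← TensorProduct.tmul_neg]
    · rw [CInf.pderiv_comm]
    · exact congrArg (_ ⊗ₜ[ℝ] ·) (CliffordAlgebra.contractLeft_comm _ _ w)

variable [Fintype κ] [DecidableEq κ]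

theorem twist_of_mem {p r : ZMod 2} {x : SFun κ U} (hx : x ∈ homog κ U r) :
    twist p x = sgn p r • x := by
  rcases zmod_two_eq_zero_or_one p with rfl | rfl
  · rw [twist_zero, sgn_zero_left, one_smul]
  · refine homog_induction (P := fun x => twist 1 x = sgn 1 r • x) ?_ ?_ ?_ hx
    · rw [map_zero, smul_zero]
    · intro f w hw
      rw [twist_one_tmul, involute_of_mem_evenOdd hw, TensorProduct.tmul_smul]
    · intro x y hx hy
      rw [map_add, hx, hy, smul_add]

theorem exists_even_add_odd (x : SFun κ U) : ∃ a ∈ homog κ U 0, ∃ b ∈ homog κ U 1, a + b = x := by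
  rw [← Submodule.mem_sup]
  induction x using TensorProduct.induction_on with
  | zero => exact zero_mem _
  | add x y hx hy => exact add_mem hx hy
  | tmul f w =>
    obtain ⟨a, ha, b, hb, rfl⟩ := SuperGeom.exists_even_add_odd w
    rw [TensorProduct.tmul_add]
    exact Submodule.add_mem_sup (tmul_mem_homog f a ha) (tmul_mem_homog f b hb)

@[elab_as_elim]
theorem induction_homog {P : SFun κ U → Prop}
    (homog : ∀ r, ∀ x ∈ homog κ U r, P x) (add : ∀ x y, P x → P y → P (x + y))
    (x : SFun κ U) : P x := by
  obtain ⟨a, ha, b, hb, rfl⟩ := exists_even_add_odd x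
  exact add _ _ (homog _ _ ha) (homog _ _ hb)

theorem mem_homog_iff {r : ZMod 2} {x : SFun κ U} :
    x ∈ homog κ U r ↔ twist 1 x = sgn 1 r • x := by
  refine ⟨twist_of_mem, fun h => ?_⟩
  obtain ⟨a, ha, b, hb, rfl⟩ := exists_even_add_odd x
  rw [map_add, twist_of_mem ha, twist_of_mem hb, sgn_zero_right, sgn_one_one, one_smul,
    neg_one_smul] at h
  have : IsAddTorsionFree (SFun κ U) := .of_module_rat _
  rcases zmod_two_eq_zero_or_one r with rfl | rfl
  · rw [sgn_zero_right, one_smul, add_right_inj, neg_eq_self] at h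
    rwa [h, add_zero]
  · rw [sgn_one_one, neg_one_smul, neg_add, add_left_inj, self_eq_neg] at h
    rwa [h, zero_add]

theorem mul_mem_homog {p r : ZMod 2} {x y : SFun κ U} (hx : x ∈ homog κ U p)
    (hy : y ∈ homog κ U r) : x * y ∈ homog κ U (p + r) := by
  rw [mem_homog_iff, twist_mul, twist_of_mem hx, twist_of_mem hy, smul_mul_smul_comm,
    sgn_add_right]

theorem twist_mem_homog {p r : ZMod 2} {x : SFun κ U} (hx : x ∈ homog κ U r) :
    twist p x ∈ homog κ U r := by
  rw [twist_of_mem hx]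
  exact Submodule.smul_mem _ _ hx

theorem mul_comm_of_mem {p r : ZMod 2} {x y : SFun κ U} (hx : x ∈ homog κ U p)
    (hy : y ∈ homog κ U r) : x * y = sgn p r • (y * x) := by
  refine homog_induction (P := fun x => x * y = sgn p r • (y * x)) ?_ ?_ ?_ hx
  · rw [zero_mul, mul_zero, smul_zero]
  · intro f w hw
    refine homog_induction
      (P := fun y => (f ⊗ₜ[ℝ] w : SFun κ U) * y = sgn p r • (y * f ⊗ₜ[ℝ] w)) ?_ ?_ ?_ hy
    · rw [zero_mul, mul_zero, smul_zero]
    · intro g v hv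
      rw [Algebra.TensorProduct.tmul_mul_tmul, Algebra.TensorProduct.tmul_mul_tmul,
        mul_comm_of_mem_evenOdd hw hv, TensorProduct.tmul_smul, mul_comm f g]
    · intro a b ha hb
      rw [mul_add, ha, hb, add_mul, smul_add]
  · intro a b ha hb
    rw [add_mul, ha, hb, mul_add, smul_add]

theorem mul_comm_twist {p : ZMod 2} {x : SFun κ U} (hx : x ∈ homog κ U p) (y : SFun κ U) :
    x * y = twist p y * x := by
  induction y using induction_homog with
  | homog r y hy => rw [mul_comm_of_mem hx hy, twist_of_mem hy, smul_mul_assoc]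
  | add a b ha hb => rw [mul_add, map_add, add_mul, ha, hb]

theorem mul_twist_comm {a b p r : ZMod 2} {x y : SFun κ U} (hx : x ∈ homog κ U (a + p))
    (hy : y ∈ homog κ U (b + r)) :
    x * twist p y = (sgn a b * sgn p r) • (y * twist r x) := by
  rw [twist_of_mem hy, twist_of_mem hx, mul_smul_comm, mul_smul_comm,
    mul_comm_of_mem hx hy, smul_smul, smul_smul]
  congr 1
  simp only [sgn_add_left, sgn_add_right, sgn_comm r a, sgn_comm r p]
  linear_combination (sgn a r * sgn a b * sgn p r ^ 2) * sgn_mul_self p b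

theorem twist_twist (p r : ZMod 2) (x : SFun κ U) : twist p (twist r x) = twist (p + r) x := by
  induction x using induction_homog with
  | homog s y hy =>
    rw [twist_of_mem hy, map_smul, twist_of_mem hy, twist_of_mem hy, smul_smul, sgn_add_left,
      mul_comm]
  | add a b ha hb => simp only [map_add, ha, hb]

theorem d_mem_homog (I : ι ⊕ κ) {r : ZMod 2} {x : SFun κ U} (hx : x ∈ homog κ U r) :
    d I x ∈ homog κ U (deg I + r) := by
  rw [mem_homog_iff, twist_one_d, twist_of_mem hx, map_smul, smul_smul, sgn_add_right]

end SFun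

end Superfunction

section VectorField

variable {ι : Type} [Fintype ι] [DecidableEq ι] {κ : Type} {U : Opens (ι → ℝ)}

namespace Vect

theorem IsHomog.add {a : ZMod 2} {X Y : Vect κ U} (hX : X.IsHomog a) (hY : Y.IsHomog a) :
    (X + Y).IsHomog a := fun I => add_mem (hX I) (hY I)

theorem IsHomog.real_smul {a : ZMod 2} {X : Vect κ U} (c : ℝ) (hX : X.IsHomog a) :
    (c • X).IsHomog a := fun I => Submodule.smul_mem _ c (hX I)

theorem isHomog_sum {a : ZMod 2} {α : Type*} (s : Finset α) (X : α → Vect κ U)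
    (h : ∀ i ∈ s, (X i).IsHomog a) : (∑ i ∈ s, X i).IsHomog a := fun I => by
  rw [Finset.sum_apply]
  exact Submodule.sum_mem _ fun i hi => h i hi I

section Frame

variable [DecidableEq κ]

theorem frame_apply (I J : ι ⊕ κ) : (frame I : Vect κ U) J = if J = I then 1 else 0 :=
  Pi.single_apply I 1 J

theorem frame_same (I : ι ⊕ κ) : (frame I : Vect κ U) I = 1 := Pi.single_eq_same I 1

theorem frame_ne {I J : ι ⊕ κ} (h : J ≠ I) : (frame I : Vect κ U) J = 0 := Pi.single_eq_of_ne h 1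

end Frame

section Linearity

variable [Fintype κ]

theorem act_add_left (X Y : Vect κ U) (f : SFun κ U) : (X + Y).act f = X.act f + Y.act f := by
  simp only [act, Pi.add_apply, add_mul, Finset.sum_add_distrib]

theorem act_smul_left (g : SFun κ U) (X : Vect κ U) (f : SFun κ U) :
    (g • X).act f = g * X.act f := by
  simp only [act, Pi.smul_apply, smul_eq_mul, mul_assoc, Finset.mul_sum]

theorem act_add_right (X : Vect κ U) (f g : SFun κ U) : X.act (f + g) = X.act f + X.act g := by
  simp only [act, map_add, mul_add, Finset.sum_add_distrib]

theorem zero_act (f : SFun κ U) : (0 : Vect κ U).act f = 0 := by simp [act]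

variable (g : ι ⊕ κ → ι ⊕ κ → SFun κ U)

theorem pair_add_left (X Y Z : Vect κ U) : pair g (X + Y) Z = pair g X Z + pair g Y Z := by
  simp only [pair, Pi.add_apply, add_mul, Finset.sum_add_distrib]

theorem pair_add_right (X Y Z : Vect κ U) : pair g X (Y + Z) = pair g X Y + pair g X Z := by
  simp only [pair, Pi.add_apply, map_add, add_mul, mul_add, Finset.sum_add_distrib]

theorem pair_smul_left (f : SFun κ U) (X Y : Vect κ U) : pair g (f • X) Y = f * pair g X Y := by
  simp only [pair, Pi.smul_apply, smul_eq_mul, mul_assoc, Finset.mul_sum]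

theorem pair_real_smul_left (c : ℝ) (X Y : Vect κ U) : pair g (c • X) Y = c • pair g X Y := by
  simp only [pair, Pi.smul_apply, smul_mul_assoc, Finset.smul_sum]

theorem pair_real_smul_right (c : ℝ) (X Y : Vect κ U) : pair g X (c • Y) = c • pair g X Y := by
  simp only [pair, Pi.smul_apply, map_smul, mul_smul_comm, smul_mul_assoc, Finset.smul_sum]

theorem pair_add (g' : ι ⊕ κ → ι ⊕ κ → SFun κ U) (X Y : Vect κ U) :
    pair (fun I J => g I J + g' I J) X Y = pair g X Y + pair g' X Y := by
  simp only [pair, mul_add, Finset.sum_add_distrib]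

theorem pair_real_smul (c : ℝ) (X Y : Vect κ U) :
    pair (fun I J => c • g I J) X Y = c • pair g X Y := by
  simp only [pair, mul_smul_comm, Finset.smul_sum]

theorem pair_sum {α : Type*} (s : Finset α) (f : α → ι ⊕ κ → ι ⊕ κ → SFun κ U) (X Y : Vect κ U) :
    pair (fun I J => ∑ i ∈ s, f i I J) X Y = ∑ i ∈ s, pair (f i) X Y := by
  simp only [pair, Finset.mul_sum]
  exact Finset.sum_comm_cycle

theorem pair_zero_left (X : Vect κ U) : pair g 0 X = 0 := by simp [pair]

theorem pair_zero_right (X : Vect κ U) : pair g X 0 = 0 := by simp [pair]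

end Linearity

variable [Fintype κ] [DecidableEq κ]

theorem IsHomog.smul {a r : ZMod 2} {X : Vect κ U} {f : SFun κ U} (hf : f ∈ SFun.homog κ U r)
    (hX : X.IsHomog a) : (f • X).IsHomog (r + a) := fun I => by
  rw [add_assoc]
  exact SFun.mul_mem_homog hf (hX I)

theorem isHomog_frame (I : ι ⊕ κ) : (frame I : Vect κ U).IsHomog (deg I) := fun J => by
  rw [frame_apply]
  split_ifs with h
  · rw [h, CharTwo.add_self_eq_zero]
    exact SFun.ofCInf_mem_homog 1
  · exact zero_mem _

theorem eq_sum_frame (X : Vect κ U) : X = ∑ I, X I • frame I := by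
  funext K
  simp [frame_apply]

theorem induction {P : Vect κ U → Prop} (zero : P 0) (add : ∀ X Y, P X → P Y → P (X + Y))
    (smul_frame : ∀ I r, ∀ f ∈ SFun.homog κ U r, P (f • frame I)) (X : Vect κ U) : P X := by
  rw [eq_sum_frame X]
  refine Finset.sum_induction _ P add zero fun I _ => ?_
  induction X I using SFun.induction_homog with
  | homog r f hf => exact smul_frame I r f hf
  | add f g hf hg => rw [add_smul]; exact add _ _ hf hg

theorem homog_induction {a : ZMod 2} {P : Vect κ U → Prop} (zero : P 0)
    (add : ∀ X Y, P X → P Y → P (X + Y))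
    (smul_frame : ∀ I, ∀ f ∈ SFun.homog κ U (a + deg I), P (f • frame I))
    {X : Vect κ U} (hX : X.IsHomog a) : P X := by
  rw [eq_sum_frame X]
  exact Finset.sum_induction _ P add zero fun I _ => smul_frame I _ (hX I)

theorem act_frame (I : ι ⊕ κ) (f : SFun κ U) : (frame I : Vect κ U).act f = SFun.d I f := by
  simp [act, frame_apply]

theorem act_frame_apply (X : Vect κ U) (I K : ι ⊕ κ) : X.act ((frame I : Vect κ U) K) = 0 := by
  rw [frame_apply]
  split_ifs <;> simp [act, SFun.d_one]

theorem act_mem_homog {a r : ZMod 2} {X : Vect κ U} {f : SFun κ U} (hX : X.IsHomog a)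
    (hf : f ∈ SFun.homog κ U r) : X.act f ∈ SFun.homog κ U (a + r) := by
  refine Submodule.sum_mem _ fun I _ => ?_
  have h := SFun.mul_mem_homog (hX I) (SFun.d_mem_homog I hf)
  rwa [add_assoc, ← add_assoc (deg I), CharTwo.add_self_eq_zero, zero_add] at h

theorem IsHomog.mul_twist {a : ZMod 2} {X : Vect κ U} (hX : X.IsHomog a) (I : ι ⊕ κ)
    (f : SFun κ U) : X I * SFun.twist (deg I) f = SFun.twist a f * X I := by
  rw [SFun.mul_comm_twist (hX I), SFun.twist_twist, add_assoc, CharTwo.add_self_eq_zero, add_zero]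

theorem act_mul {a : ZMod 2} {X : Vect κ U} (hX : X.IsHomog a) (f g : SFun κ U) :
    X.act (f * g) = X.act f * g + SFun.twist a f * X.act g := by
  simp only [act, Finset.sum_mul, Finset.mul_sum, ← Finset.sum_add_distrib]
  refine Finset.sum_congr rfl fun I _ => ?_
  rw [SFun.d_mul, mul_add, ← mul_assoc, ← mul_assoc, hX.mul_twist, mul_assoc, mul_assoc]

section Pair

variable (g : ι ⊕ κ → ι ⊕ κ → SFun κ U)

theorem pair_smul_right {a : ZMod 2} {X : Vect κ U} (hX : X.IsHomog a) (f : SFun κ U)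
    (Y : Vect κ U) : pair g X (f • Y) = SFun.twist a f * pair g X Y := by
  simp only [pair, Pi.smul_apply, smul_eq_mul, Finset.mul_sum]
  refine Finset.sum_congr rfl fun I _ => Finset.sum_congr rfl fun J _ => ?_
  rw [SFun.twist_mul, ← mul_assoc, hX.mul_twist]
  simp only [mul_assoc]

theorem pair_frame_right (X : Vect κ U) (K : ι ⊕ κ) : pair g X (frame K) = ∑ I, X I * g I K := by
  simp [pair, frame_apply, apply_ite, SFun.twist_one]

theorem pair_frame_left (X : Vect κ U) (K : ι ⊕ κ) :
    pair g (frame K) X = ∑ J, SFun.twist (deg K) (X J) * g K J := by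
  simp [pair, frame_apply, ite_mul]

theorem pair_frame_frame (I J : ι ⊕ κ) : pair g (frame I) (frame J) = g I J := by
  simp [pair_frame_right, frame_apply]

theorem pair_swap {a b : ZMod 2} {X Y : Vect κ U} (hX : X.IsHomog a) (hY : Y.IsHomog b) :
    pair g X Y = sgn a b • pair (fun J I => sgn (deg I) (deg J) • g I J) Y X := by
  rw [pair, pair, Finset.sum_comm]
  simp only [Finset.smul_sum]
  refine Finset.sum_congr rfl fun J _ => Finset.sum_congr rfl fun I _ => ?_
  rw [SFun.mul_twist_comm (hX I) (hY J), mul_smul_comm, smul_mul_assoc, smul_smul]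

variable {g}

theorem pair_symm {a b : ZMod 2} (hg : ∀ I J, g I J = sgn (deg I) (deg J) • g J I)
    {X Y : Vect κ U} (hX : X.IsHomog a) (hY : Y.IsHomog b) :
    pair g X Y = sgn a b • pair g Y X := by
  rw [pair_swap g hX hY]
  congr 2
  funext J I
  rw [hg J I, sgn_comm]

theorem eq_zero_of_pair_frame (hg : IsUnit (Matrix.of g)) {X : Vect κ U}
    (h : ∀ K, pair g X (frame K) = 0) : X = 0 := by
  obtain ⟨A, hA⟩ := hg
  have hX : Matrix.vecMul X A.1 = 0 := by
    funext K
    rw [hA, Pi.zero_apply, ← h K, pair_frame_right]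
    rfl
  rw [← Matrix.vecMul_one X, ← A.mul_inv, ← Matrix.vecMul_vecMul, hX, Matrix.zero_vecMul]

end Pair

end Vect

end VectorField

section Christoffel

open Vect

variable {ι : Type} [Fintype ι] [DecidableEq ι] {κ : Type} [Fintype κ]
  {U : Opens (ι → ℝ)}

/-- The covariant derivative whose Christoffel symbols are `∇_{∂_I} ∂_J = Γ I J`. -/
def christoffel (Γ : ι ⊕ κ → ι ⊕ κ → Vect κ U) (X Y : Vect κ U) : Vect κ U :=
  (fun K => X.act (Y K)) + ∑ I, ∑ J, (X I * SFun.twist (deg I) (Y J)) • Γ I J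

namespace AffineConnection

variable (D : AffineConnection κ U)

theorem cov_zero_left (Y : Vect κ U) : D.cov 0 Y = 0 := by
  simpa using D.cov_smul_left 0 0 Y

theorem cov_zero_right (X : Vect κ U) : D.cov X 0 = 0 := by
  simpa using D.cov_add_right X 0 0

theorem cov_sum_left {α : Type*} (s : Finset α) (X : α → Vect κ U) (Y : Vect κ U) :
    D.cov (∑ i ∈ s, X i) Y = ∑ i ∈ s, D.cov (X i) Y :=
  map_sum (AddMonoidHom.mk' (D.cov · Y) fun X Z => D.cov_add_left X Z Y) X s

theorem cov_sum_right {α : Type*} (s : Finset α) (X : Vect κ U) (Y : α → Vect κ U) :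
    D.cov X (∑ i ∈ s, Y i) = ∑ i ∈ s, D.cov X (Y i) :=
  map_sum (AddMonoidHom.mk' (D.cov X) (D.cov_add_right X)) Y s

end AffineConnection

variable [DecidableEq κ]

theorem christoffel_frame (Γ : ι ⊕ κ → ι ⊕ κ → Vect κ U) (I : ι ⊕ κ) (Y : Vect κ U) :
    christoffel Γ (frame I) Y =
      (fun K => SFun.d I (Y K)) + ∑ J, SFun.twist (deg I) (Y J) • Γ I J := by
  simp [christoffel, act_frame, frame_apply, ite_mul, ite_smul]

theorem christoffel_frame_frame (Γ : ι ⊕ κ → ι ⊕ κ → Vect κ U) (I J : ι ⊕ κ) :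
    christoffel Γ (frame I) (frame J) = Γ I J := by
  have h : (fun K => SFun.d I ((frame J : Vect κ U) K)) = 0 :=
    funext fun K => (act_frame I _).symm.trans (act_frame_apply _ J K)
  rw [christoffel_frame, h, zero_add]
  simp [frame_apply, apply_ite, SFun.twist_one, ite_smul]

theorem isHomog_christoffel {Γ : ι ⊕ κ → ι ⊕ κ → Vect κ U}
    (hΓ : ∀ I J, (Γ I J).IsHomog (deg I + deg J)) {a b : ZMod 2} {X Y : Vect κ U}
    (hX : X.IsHomog a) (hY : Y.IsHomog b) : (christoffel Γ X Y).IsHomog (a + b) := by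
  refine IsHomog.add (fun K => ?_) (isHomog_sum _ _ fun I _ => isHomog_sum _ _ fun J _ => ?_)
  · rw [add_assoc]
    exact act_mem_homog hX (hY K)
  · have h := IsHomog.smul (SFun.mul_mem_homog (hX I)
      (SFun.twist_mem_homog (p := deg I) (hY J))) (hΓ I J)
    rwa [add_add_add_comm a, add_assoc, CharTwo.add_self_eq_zero, add_zero] at h

theorem christoffel_smul_right (Γ : ι ⊕ κ → ι ⊕ κ → Vect κ U) {a : ZMod 2} {X : Vect κ U}
    (hX : X.IsHomog a) (f : SFun κ U) (Y : Vect κ U) :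
    christoffel Γ X (f • Y) = X.act f • Y + SFun.twist a f • christoffel Γ X Y := by
  have hXf (I J : ι ⊕ κ) : X I * (SFun.twist (deg I) f * SFun.twist (deg I) (Y J)) =
      SFun.twist a f * (X I * SFun.twist (deg I) (Y J)) := by
    rw [← mul_assoc, hX.mul_twist, mul_assoc]
  simp only [christoffel, Pi.smul_apply, smul_eq_mul, act_mul hX, SFun.twist_mul, hXf, smul_add,
    Finset.smul_sum, smul_smul, ← add_assoc]
  rfl

namespace AffineConnection

/-- The affine connection with `∇_{∂_I} ∂_J = Γ I J`. -/
def ofChristoffel (Γ : ι ⊕ κ → ι ⊕ κ → Vect κ U)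
    (hΓ : ∀ I J, (Γ I J).IsHomog (deg I + deg J)) : AffineConnection κ U where
  cov := christoffel Γ
  cov_homog _ _ _ _ := isHomog_christoffel hΓ
  cov_add_left X Y Z := by
    simp only [christoffel, Pi.add_apply, add_mul, add_smul, Finset.sum_add_distrib, act_add_left]
    exact add_add_add_comm _ _ _ _
  cov_add_right X Y Z := by
    simp only [christoffel, Pi.add_apply, map_add, mul_add, add_smul, Finset.sum_add_distrib,
      act_add_right]
    exact add_add_add_comm _ _ _ _
  cov_smul_left f X Y := by
    simp only [christoffel, Pi.smul_apply, smul_eq_mul, act_smul_left, smul_add, Finset.smul_sum,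
      mul_assoc, smul_smul]
    rfl
  leibniz a r X Y f hX hf := by
    rw [christoffel_smul_right Γ hX, SFun.twist_of_mem hf, smul_assoc]

variable (D : AffineConnection κ U)

theorem cov_smul_right {a : ZMod 2} {X : Vect κ U} (hX : X.IsHomog a) (f : SFun κ U)
    (Y : Vect κ U) : D.cov X (f • Y) = X.act f • Y + SFun.twist a f • D.cov X Y := by
  induction f using SFun.induction_homog with
  | homog r f hf => rw [D.leibniz a r X Y f hX hf, SFun.twist_of_mem hf, smul_assoc]
  | add f g hf hg =>
    rw [add_smul, D.cov_add_right, hf, hg, act_add_right, map_add, add_smul, add_smul]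
    abel

theorem cov_frame_smul (I : ι ⊕ κ) (f : SFun κ U) (Y : Vect κ U) :
    D.cov (frame I) (f • Y) = SFun.d I f • Y + SFun.twist (deg I) f • D.cov (frame I) Y := by
  rw [D.cov_smul_right (isHomog_frame I), act_frame]

theorem cov_frame (I : ι ⊕ κ) (Y : Vect κ U) :
    D.cov (frame I) Y = (fun K => SFun.d I (Y K)) +
      ∑ J, SFun.twist (deg I) (Y J) • D.cov (frame I) (frame J) := by
  conv_lhs => rw [eq_sum_frame Y, cov_sum_right]
  simp only [cov_frame_smul, Finset.sum_add_distrib]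
  rw [← eq_sum_frame fun K => SFun.d I (Y K)]

theorem cov_eq_christoffel : D.cov = christoffel fun I J => D.cov (frame I) (frame J) := by
  funext X Y
  conv_lhs => rw [eq_sum_frame X, cov_sum_left]
  simp only [D.cov_smul_left, D.cov_frame _ Y, smul_add, Finset.smul_sum, smul_smul,
    Finset.sum_add_distrib, christoffel]
  congr 1
  funext K
  simp only [Finset.sum_apply, Pi.smul_apply, smul_eq_mul, act]

end AffineConnection

end Christoffel

section LeviCivita

open Vect

variable {ι : Type} [Fintype ι] [DecidableEq ι] {κ : Type} [Fintype κ] [DecidableEq κ]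
  {U : Opens (ι → ℝ)} {g : ι ⊕ κ → ι ⊕ κ → SFun κ U}

theorem bracket_frame_left (a : ZMod 2) (I : ι ⊕ κ) (X : Vect κ U) :
    bracket (deg I) a (frame I) X = fun K => SFun.d I (X K) := by
  funext K
  rw [bracket, act_frame, act_frame_apply, smul_zero, sub_zero]

theorem bracket_frame_frame (a : ZMod 2) (I J : ι ⊕ κ) :
    bracket (deg I) a (frame I : Vect κ U) (frame J) = 0 := by
  rw [bracket_frame_left]
  funext K
  rw [← act_frame, act_frame_apply]
  rfl

/-- The graded form of the braid argument. -/
theorem eq_zero_of_supersymm_of_superskew {α A : Type*} [AddCommGroup A] [Module ℝ A]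
    (p : α → ZMod 2) {T : α → α → α → A} (hsymm : ∀ I J K, T I J K = sgn (p I) (p J) • T J I K)
    (hskew : ∀ I J K, T I J K = -sgn (p J) (p K) • T I K J) (I J K : α) : T I J K = 0 := by
  have hneg : T I J K = (-1 : ℝ) • T I J K := by
    conv_lhs =>
      rw [hsymm I J K, hskew J I K, hsymm J K I, hskew K J I, hsymm K I J, hskew I K J]
    simp only [smul_smul]
    congr 1
    rw [sgn_comm (p K) (p J), sgn_comm (p K) (p I), sgn_comm (p J) (p I)]
    linear_combination (-(sgn (p I) (p J)) ^ 2 * (sgn (p I) (p K)) ^ 2) *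
      sgn_mul_self (p J) (p K) - (sgn (p I) (p J)) ^ 2 * sgn_mul_self (p I) (p K) -
      sgn_mul_self (p I) (p J)
  have htwo : (2 : ℝ) • T I J K = 0 := by
    rw [two_smul]
    nth_rw 1 [hneg]
    rw [neg_one_smul, neg_add_cancel]
  exact (smul_eq_zero.1 htwo).resolve_left two_ne_zero

namespace AffineConnection

variable {D D' : AffineConnection κ U}

theorem torsion_of_frames
    (h : ∀ I J, D.cov (frame I) (frame J) = sgn (deg I) (deg J) • D.cov (frame J) (frame I))
    {a b : ZMod 2} {X Y : Vect κ U} (hX : X.IsHomog a) (hY : Y.IsHomog b) :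
    D.cov X Y - sgn a b • D.cov Y X - bracket a b X Y = 0 := by
  have hsum : ∑ I, ∑ J, (X I * SFun.twist (deg I) (Y J)) • D.cov (frame I) (frame J) =
      sgn a b • ∑ J, ∑ I, (Y J * SFun.twist (deg J) (X I)) • D.cov (frame J) (frame I) := by
    rw [Finset.sum_comm]
    simp only [Finset.smul_sum]
    refine Finset.sum_congr rfl fun J _ => Finset.sum_congr rfl fun I _ => ?_
    rw [SFun.mul_twist_comm (hX I) (hY J), h I J, smul_assoc, smul_comm (Y J * _), smul_smul,
      mul_assoc, sgn_mul_self, mul_one]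
  have hbracket : bracket a b X Y = (fun K => X.act (Y K)) - sgn a b • fun K => Y.act (X K) := rfl
  rw [D.cov_eq_christoffel, christoffel, christoffel, hsum, smul_add, hbracket]
  abel

theorem d_pair_frame_left
    (h : ∀ I J K, SFun.d I (g J K) = pair g (D.cov (frame I) (frame J)) (frame K) +
      sgn (deg I) (deg J) • pair g (frame J) (D.cov (frame I) (frame K)))
    (I J : ι ⊕ κ) (Z : Vect κ U) :
    SFun.d I (pair g (frame J) Z) = pair g (D.cov (frame I) (frame J)) Z +
      sgn (deg I) (deg J) • pair g (frame J) (D.cov (frame I) Z) := by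
  induction Z using Vect.induction with
  | zero => simp only [pair_zero_right, D.cov_zero_right, map_zero, smul_zero, add_zero]
  | add X Y hX hY =>
    simp only [pair_add_right, D.cov_add_right, map_add, smul_add, hX, hY]
    abel
  | smul_frame K _ f _ =>
    have hIJ := D.cov_homog _ _ _ _ (isHomog_frame I) (isHomog_frame J)
    simp only [pair_smul_right g (isHomog_frame J), pair_smul_right g hIJ, pair_frame_frame,
      SFun.d_mul, h I J K, D.cov_frame_smul, pair_add_right, SFun.twist_twist,
      SFun.twist_d (deg J) I, mul_add, smul_add, smul_mul_assoc, smul_smul, mul_smul_comm,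
      sgn_comm (deg J) (deg I), sgn_mul_self, one_smul, add_comm (deg J) (deg I)]
    abel

theorem d_pair
    (h : ∀ I J K, SFun.d I (g J K) = pair g (D.cov (frame I) (frame J)) (frame K) +
      sgn (deg I) (deg J) • pair g (frame J) (D.cov (frame I) (frame K)))
    (I : ι ⊕ κ) {b : ZMod 2} {Y : Vect κ U} (hY : Y.IsHomog b) (Z : Vect κ U) :
    SFun.d I (pair g Y Z) = pair g (D.cov (frame I) Y) Z +
      sgn (deg I) b • pair g Y (D.cov (frame I) Z) := by
  refine Vect.homog_induction (P := fun Y => SFun.d I (pair g Y Z) =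
    pair g (D.cov (frame I) Y) Z + sgn (deg I) b • pair g Y (D.cov (frame I) Z)) ?_ ?_ ?_ hY
  · simp only [pair_zero_left, D.cov_zero_right, map_zero, smul_zero, add_zero]
  · intro X Y hX hY
    simp only [pair_add_left, D.cov_add_right, map_add, smul_add, hX, hY]
    abel
  · intro J f hf
    rw [pair_smul_left, SFun.d_mul, d_pair_frame_left h, D.cov_frame_smul, pair_add_left,
      pair_smul_left, pair_smul_left, pair_smul_left, SFun.twist_of_mem hf, mul_add,
      mul_smul_comm, smul_mul_assoc, smul_mul_assoc, smul_smul, sgn_add_right, ← mul_assoc,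
      mul_comm (sgn _ (deg J)), mul_assoc, sgn_mul_self, mul_one]
    abel

theorem act_pair
    (h : ∀ I J K, SFun.d I (g J K) = pair g (D.cov (frame I) (frame J)) (frame K) +
      sgn (deg I) (deg J) • pair g (frame J) (D.cov (frame I) (frame K)))
    {a b : ZMod 2} {X Y : Vect κ U} (hX : X.IsHomog a) (hY : Y.IsHomog b) (Z : Vect κ U) :
    X.act (pair g Y Z) = pair g (D.cov X Y) Z + sgn a b • pair g Y (D.cov X Z) := by
  refine Vect.homog_induction (P := fun X => X.act (pair g Y Z) =
      pair g (D.cov X Y) Z + sgn a b • pair g Y (D.cov X Z)) ?_ ?_ ?_ hX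
  · simp only [zero_act, pair_zero_left, pair_zero_right, D.cov_zero_left, smul_zero, add_zero]
  · intro X X' hX hX'
    simp only [act_add_left, pair_add_left, pair_add_right, D.cov_add_left, smul_add, hX, hX']
    abel
  · intro I f hf
    rw [act_smul_left, act_frame, d_pair h I hY, D.cov_smul_left, D.cov_smul_left,
      pair_smul_left, pair_smul_right g hY, SFun.twist_of_mem hf, mul_add, smul_mul_assoc,
      smul_smul, mul_smul_comm, sgn_add_right, sgn_comm b a, ← mul_assoc, sgn_mul_self, one_mul,
      sgn_comm b]

theorem isLeviCivita_iff_frames : D.IsLeviCivita g ↔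
    (∀ I J, D.cov (frame I) (frame J) = sgn (deg I) (deg J) • D.cov (frame J) (frame I)) ∧
    ∀ I J K, SFun.d I (g J K) = pair g (D.cov (frame I) (frame J)) (frame K) +
      sgn (deg I) (deg J) • pair g (frame J) (D.cov (frame I) (frame K)) := by
  refine ⟨fun h => ⟨fun I J => ?_, fun I J K => ?_⟩, fun h =>
    ⟨fun _ _ _ _ => torsion_of_frames h.1, fun _ _ _ _ Z hX hY => act_pair h.2 hX hY Z⟩⟩
  · have hIJ := h.1 _ _ _ _ (isHomog_frame I) (isHomog_frame J)
    rwa [bracket_frame_frame, sub_zero, sub_eq_zero] at hIJ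
  · have hIJK := h.2 _ _ _ _ (frame K) (isHomog_frame I) (isHomog_frame J)
    rwa [act_frame, pair_frame_frame] at hIJK

theorem IsLeviCivita.cov_frame_unique (hs : ∀ I J, g I J = sgn (deg I) (deg J) • g J I)
    (hn : IsUnit (Matrix.of g)) (h : D.IsLeviCivita g) (h' : D'.IsLeviCivita g) (I J : ι ⊕ κ) :
    D.cov (frame I) (frame J) = D'.cov (frame I) (frame J) := by
  rw [isLeviCivita_iff_frames] at h h'
  let S (I J : ι ⊕ κ) : Vect κ U :=
    D.cov (frame I) (frame J) + (-1 : ℝ) • D'.cov (frame I) (frame J)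
  have hS_homog (I J : ι ⊕ κ) : (S I J).IsHomog (deg I + deg J) :=
    (D.cov_homog _ _ _ _ (isHomog_frame I) (isHomog_frame J)).add
      ((D'.cov_homog _ _ _ _ (isHomog_frame I) (isHomog_frame J)).real_smul _)
  have hsymm (I J K : ι ⊕ κ) : pair g (S I J) (frame K) =
      sgn (deg I) (deg J) • pair g (S J I) (frame K) := by
    rw [← pair_real_smul_left, smul_add, smul_comm _ (-1 : ℝ), ← h.1 I J, ← h'.1 I J]
  have hskew (I J K : ι ⊕ κ) : pair g (S I J) (frame K) =
      -sgn (deg J) (deg K) • pair g (S I K) (frame J) := by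
    have hsum : pair g (S I J) (frame K) + sgn (deg I) (deg J) • pair g (frame J) (S I K) = 0 := by
      rw [pair_add_left, pair_add_right, pair_real_smul_left, pair_real_smul_right, smul_add,
        smul_comm _ (-1 : ℝ), neg_one_smul, neg_one_smul,
        ← sub_eq_zero.2 ((h.2 I J K).symm.trans (h'.2 I J K))]
      abel
    rw [pair_symm hs (isHomog_frame J) (hS_homog I K), smul_smul, sgn_add_right,
      sgn_comm (deg J) (deg I), ← mul_assoc, sgn_mul_self, one_mul] at hsum
    rw [neg_smul]
    exact eq_neg_of_add_eq_zero_left hsum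
  have hzero : S I J = 0 :=
    eq_zero_of_pair_frame hn (eq_zero_of_supersymm_of_superskew deg hsymm hskew I J)
  rwa [add_eq_zero_iff_eq_neg, neg_one_smul, neg_neg] at hzero

theorem IsLeviCivita.cov_unique (hs : ∀ I J, g I J = sgn (deg I) (deg J) • g J I)
    (hn : IsUnit (Matrix.of g)) (h : D.IsLeviCivita g) (h' : D'.IsLeviCivita g) :
    D.cov = D'.cov := by
  rw [D.cov_eq_christoffel, D'.cov_eq_christoffel]
  congr 1
  funext I J
  exact h.cov_frame_unique hs hn h' I J

end AffineConnection

end LeviCivita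

section Curvature

open Vect

variable {ι : Type} [Fintype ι] [DecidableEq ι] {κ : Type} [Fintype κ] [DecidableEq κ]
  {U : Opens (ι → ℝ)}

namespace AffineConnection

variable (D : AffineConnection κ U)

theorem curvature_frame (a : ZMod 2) (I : ι ⊕ κ) (X Y : Vect κ U) :
    curvature D.cov (deg I) a (frame I) X Y = D.cov (frame I) (D.cov X Y) -
      sgn (deg I) a • D.cov X (D.cov (frame I) Y) - D.cov (fun K => SFun.d I (X K)) Y := by
  rw [curvature, bracket_frame_left]

theorem curvature_frame_frame (I J : ι ⊕ κ) (Y : Vect κ U) :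
    curvature D.cov (deg I) (deg J) (frame I) (frame J) Y =
      D.cov (frame I) (D.cov (frame J) Y) -
        sgn (deg I) (deg J) • D.cov (frame J) (D.cov (frame I) Y) := by
  rw [curvature, bracket_frame_frame, D.cov_zero_left, sub_zero]

theorem curvature_frame_zero (a : ZMod 2) (I : ι ⊕ κ) (Y : Vect κ U) :
    curvature D.cov (deg I) a (frame I) 0 Y = 0 := by
  have hd : (fun K => SFun.d I ((0 : Vect κ U) K)) = 0 := funext fun _ => map_zero _
  rw [D.curvature_frame, hd]
  simp only [D.cov_zero_left, D.cov_zero_right, smul_zero, sub_zero]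

theorem curvature_frame_add (a : ZMod 2) (I : ι ⊕ κ) (X X' Y : Vect κ U) :
    curvature D.cov (deg I) a (frame I) (X + X') Y =
      curvature D.cov (deg I) a (frame I) X Y + curvature D.cov (deg I) a (frame I) X' Y := by
  have hd : (fun K => SFun.d I ((X + X') K)) =
      (fun K => SFun.d I (X K)) + fun K => SFun.d I (X' K) := funext fun _ => map_add _ _ _
  simp only [D.curvature_frame, hd, D.cov_add_left, D.cov_add_right, smul_add]
  abel

theorem curvature_frame_smul_frame {a : ZMod 2} (I J : ι ⊕ κ) {f : SFun κ U}
    (hf : f ∈ SFun.homog κ U (a + deg J)) (Y : Vect κ U) :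
    curvature D.cov (deg I) a (frame I) (f • frame J) Y =
      SFun.twist (deg I) f • curvature D.cov (deg I) (deg J) (frame I) (frame J) Y := by
  have hd : (fun K => SFun.d I ((f • frame J : Vect κ U) K)) =
      (SFun.d I f • frame J : Vect κ U) := by
    funext K
    rw [Pi.smul_apply, Pi.smul_apply, smul_eq_mul, SFun.d_mul, ← act_frame I (frame J K),
      act_frame_apply, mul_zero, add_zero, smul_eq_mul]
  have hsgn : sgn (deg I) (a + deg J) * sgn (deg I) (deg J) = sgn (deg I) a := by
    rw [sgn_add_right, mul_assoc, sgn_mul_self, mul_one]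
  rw [D.curvature_frame, D.curvature_frame_frame, hd]
  simp only [D.cov_smul_left, D.cov_frame_smul, SFun.twist_of_mem hf, smul_sub, smul_assoc,
    smul_comm f (sgn (deg I) (deg J)), smul_smul, hsgn]
  abel

theorem curvature_frame_eq_sum {a : ZMod 2} (I : ι ⊕ κ) {X : Vect κ U} (hX : X.IsHomog a)
    (Y : Vect κ U) : curvature D.cov (deg I) a (frame I) X Y =
      ∑ J, SFun.twist (deg I) (X J) •
        curvature D.cov (deg I) (deg J) (frame I) (frame J) Y := by
  conv_lhs => rw [eq_sum_frame X]
  have hsum := map_sum (⟨⟨fun X => curvature D.cov (deg I) a (frame I) X Y,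
    D.curvature_frame_zero a I Y⟩, fun X X' => D.curvature_frame_add a I X X' Y⟩ :
      Vect κ U →+ Vect κ U) (fun J => X J • frame J) Finset.univ
  exact hsum.trans <| Finset.sum_congr rfl fun J _ => D.curvature_frame_smul_frame I J (hX J) Y

theorem curvature_frame_frame_add (I J : ι ⊕ κ) (Y Y' : Vect κ U) :
    curvature D.cov (deg I) (deg J) (frame I) (frame J) (Y + Y') =
      curvature D.cov (deg I) (deg J) (frame I) (frame J) Y +
        curvature D.cov (deg I) (deg J) (frame I) (frame J) Y' := by
  simp only [D.curvature_frame_frame, D.cov_add_right, smul_add]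
  abel

theorem curvature_frame_frame_smul (I J : ι ⊕ κ) (f : SFun κ U) (Y : Vect κ U) :
    curvature D.cov (deg I) (deg J) (frame I) (frame J) (f • Y) =
      SFun.twist (deg I + deg J) f • curvature D.cov (deg I) (deg J) (frame I) (frame J) Y := by
  simp only [D.curvature_frame_frame, D.cov_frame_smul, D.cov_add_right]
  rw [SFun.d_comm I J f, SFun.twist_d (deg I) J, SFun.twist_d (deg J) I, SFun.twist_twist,
    SFun.twist_twist, add_comm (deg J) (deg I), sgn_comm (deg J) (deg I)]
  simp only [smul_add, smul_sub, smul_assoc, smul_smul, sgn_mul_self, one_smul]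
  rw [smul_comm (SFun.twist (deg I + deg J) f) (sgn (deg I) (deg J))]
  abel

theorem curvature_frame_frame_eq_sum (I J : ι ⊕ κ) (Y : Vect κ U) :
    curvature D.cov (deg I) (deg J) (frame I) (frame J) Y =
      ∑ K, SFun.twist (deg I + deg J) (Y K) •
        curvature D.cov (deg I) (deg J) (frame I) (frame J) (frame K) := by
  conv_lhs => rw [eq_sum_frame Y]
  exact (map_sum (AddMonoidHom.mk' _ (D.curvature_frame_frame_add I J)) _ _).trans <|
    Finset.sum_congr rfl fun K _ => D.curvature_frame_frame_smul I J _ _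

theorem curvature_frame_apply {a b : ZMod 2} {X Y : Vect κ U} (hX : X.IsHomog a)
    (hY : Y.IsHomog b) (I L : ι ⊕ κ) :
    curvature D.cov (deg I) a (frame I) X Y L = sgn (deg I) (a + b) •
      pair (fun J K => sgn (deg I) (deg J + deg K) •
        curvature D.cov (deg I) (deg J) (frame I) (frame J) (frame K) L) X Y := by
  rw [D.curvature_frame_eq_sum I hX, Finset.sum_apply, pair, Finset.smul_sum]
  refine Finset.sum_congr rfl fun J _ => ?_
  rw [D.curvature_frame_frame_eq_sum, Pi.smul_apply, Finset.sum_apply, smul_eq_mul, Finset.mul_sum,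
    Finset.smul_sum]
  refine Finset.sum_congr rfl fun K _ => ?_
  have hXY := SFun.mul_mem_homog (hX J) (SFun.twist_mem_homog (p := deg J) (hY K))
  rw [Pi.smul_apply, smul_eq_mul, ← SFun.twist_twist, ← mul_assoc, ← SFun.twist_mul,
    SFun.twist_of_mem hXY, smul_mul_assoc, mul_smul_comm, smul_smul, ← sgn_add_right,
    add_add_add_comm]

theorem ricci_eq_pair {a b : ZMod 2} {X Y : Vect κ U} (hX : X.IsHomog a) (hY : Y.IsHomog b) :
    ricci D.cov a b X Y =
      pair (fun J K => ricci D.cov (deg J) (deg K) (frame J) (frame K)) X Y := by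
  simp only [ricci, pair_sum]
  refine Finset.sum_congr rfl fun I _ => ?_
  have hsgn : sgn (deg I) (deg I + a + b) * sgn (deg I) (a + b) = sgn (deg I) (deg I) := by
    rw [add_assoc, sgn_add_right, mul_assoc, sgn_mul_self, mul_one]
  rw [D.curvature_frame_apply hX hY, D.curvature_frame_apply hY hX, pair_swap _ hY hX, add_comm b a,
    smul_comm (sgn (deg I) (a + b)), smul_smul (sgn a b), sgn_comm b a, sgn_mul_self, one_smul,
    ← smul_add, ← pair_add, smul_smul, mul_right_comm, hsgn, ← pair_real_smul]
  congr 1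
  funext J K
  rw [add_assoc, sgn_add_right (deg I) (deg I), sgn_comm (deg K), add_comm (deg K)]
  simp only [smul_add, smul_smul]
  ring_nf

theorem ricci_eq_of_frames {g : ι ⊕ κ → ι ⊕ κ → SFun κ U} {c : ℝ}
    (h : ∀ I J, ricci D.cov (deg I) (deg J) (frame I) (frame J) = c • g I J)
    {a b : ZMod 2} {X Y : Vect κ U} (hX : X.IsHomog a) (hY : Y.IsHomog b) :
    ricci D.cov a b X Y = c • pair g X Y := by
  simp only [D.ricci_eq_pair hX hY, h, pair_real_smul]

end AffineConnection

end Curvature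

section Line

/-- The algebra of smooth functions on the line. -/
def smoothFunctions : Subalgebra ℝ (ℝ → ℝ) where
  carrier := {H | ContDiff ℝ ∞ H}
  mul_mem' := ContDiff.mul (𝕜 := ℝ) (n := ∞)
  add_mem' := ContDiff.add (𝕜 := ℝ) (n := ∞)
  algebraMap_mem' r := (contDiff_const : ContDiff ℝ ∞ fun _ : ℝ => r)

/-- Smooth functions of the time coordinate. -/
abbrev SmoothFn : Type := smoothFunctions

namespace SmoothFn

theorem contDiff (H : SmoothFn) : ContDiff ℝ ∞ H.1 := H.2

/-- The derivative of a smooth function, as a smooth function. -/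
def deriv (H : SmoothFn) : SmoothFn :=
  ⟨_root_.deriv H.1, (contDiff_infty_iff_deriv.1 H.contDiff).2⟩

theorem hasDerivAt (H : SmoothFn) (t : ℝ) : HasDerivAt H.1 (H.deriv.1 t) t :=
  (H.contDiff.differentiable (by simp) t).hasDerivAt

theorem deriv_mul (H K : SmoothFn) : (H * K).deriv = H.deriv * K + H * K.deriv :=
  Subtype.ext <| funext fun t => ((H.hasDerivAt t).mul (K.hasDerivAt t)).deriv

theorem deriv_sub_one (H : SmoothFn) : (H - 1).deriv = H.deriv :=
  Subtype.ext <| funext fun t => ((H.hasDerivAt t).sub_const 1).deriv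

end SmoothFn

variable {ι κ : Type}

/-- Definition by cases on the coordinates of the product with the line. -/
def lineCases {α : Type} (a : α) (f : ι ⊕ κ → α) : Option ι ⊕ κ → α :=
  Sum.elim (fun o => o.elim a fun i => f (Sum.inl i)) fun B => f (Sum.inr B)

theorem lineCases_none {α : Type} (a : α) (f : ι ⊕ κ → α) :
    lineCases a f (Sum.inl none) = a := rfl

theorem lineCases_up {α : Type} (a : α) (f : ι ⊕ κ → α) (I : ι ⊕ κ) :
    lineCases a f (up I) = f I := by cases I <;> rfl

theorem up_injective : Function.Injective (up : ι ⊕ κ → Option ι ⊕ κ) :=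
  Function.Injective.sumMap (Option.some_injective _) Function.injective_id

theorem up_ne_none (I : ι ⊕ κ) : up I ≠ Sum.inl none := by cases I <;> simp [up]

theorem deg_none : deg (Sum.inl none : Option ι ⊕ κ) = 0 := rfl

variable [Fintype ι] [DecidableEq ι] {W : Opens (Option ι → ℝ)} {V : Opens (ι → ℝ)}

/-- Functions of the time coordinate as superfunctions on the product with the line. -/
def timeHom (κ : Type) (W : Opens (Option ι → ℝ)) : SmoothFn →ₐ[ℝ] SFun κ W :=
  SFun.ofCInf.comp
    { toFun := fun H => timeFn W H.1 H.contDiff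
      map_one' := rfl
      map_mul' := fun _ _ => rfl
      map_zero' := rfl
      map_add' := fun _ _ => rfl
      commutes' := fun _ => rfl }

theorem twist_timeHom (p : ZMod 2) (H : SmoothFn) :
    SFun.twist p (timeHom κ W H) = timeHom κ W H := SFun.twist_ofCInf p _

theorem CInf.pderiv_none_timeFn (H : SmoothFn) :
    CInf.pderiv W none (timeFn W H.1 H.contDiff) = timeFn W H.deriv.1 H.deriv.contDiff := by
  ext z
  have hproj : HasFDerivAt (fun z : Option ι → ℝ => z none)
      (ContinuousLinearMap.proj (R := ℝ) (φ := fun _ : Option ι => ℝ) none) z.1 :=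
    hasFDerivAt_apply none z.1
  have hcomp : HasFDerivAt (fun z : Option ι → ℝ => H.1 (z none)) _ z.1 :=
    (H.hasDerivAt (z.1 none)).hasFDerivAt.comp z.1 hproj
  rw [CInf.pderiv_apply, CInf.fderiv_eq (timeFn W H.1 H.contDiff).1
    (fun z => H.1 (z none)) fun _ => rfl, hcomp.fderiv]
  simp only [ContinuousLinearMap.comp_apply, ContinuousLinearMap.proj_apply, Pi.single_eq_same,
    ContinuousLinearMap.toSpanSingleton_apply, one_smul]
  rfl

theorem SFun.pull_coord (x : SFun κ V) : SFun.pull (CInf.coord V) (fun x => x.2) x = x := by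
  induction x using TensorProduct.induction_on with
  | zero => exact map_zero _
  | tmul f w => rfl
  | add x y hx hy => rw [map_add, hx, hy]

theorem d_none_timeHom (H : SmoothFn) :
    SFun.d (Sum.inl none) (timeHom κ W H) = timeHom κ W H.deriv := by
  change CInf.pderiv W none (timeFn W H.1 H.contDiff) ⊗ₜ[ℝ] (1 : Grass κ) = _
  rw [CInf.pderiv_none_timeFn]
  rfl

theorem d_up_timeHom (I : ι ⊕ κ) (H : SmoothFn) : SFun.d (up I) (timeHom κ W H) = 0 := by
  cases I with
  | inl a =>
    change CInf.pderiv W (some a) (timeFn W H.1 H.contDiff) ⊗ₜ[ℝ] (1 : Grass κ) = _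
    rw [CInf.pderiv_some_timeFn, TensorProduct.zero_tmul]
  | inr B =>
    change timeFn W H.1 H.contDiff ⊗ₜ[ℝ]
      (CliffordAlgebra.contractLeft (LinearMap.proj B) (1 : Grass κ)) = 0
    rw [CliffordAlgebra.contractLeft_one, TensorProduct.tmul_zero]

/-- Restriction of superfunctions to the slice `t = 0`. -/
def slice (h0 : ∀ x : V, (fun o : Option ι => (o.elim (0 : CInf V) (CInf.coord V)).1 x) ∈ W) :
    SFun κ W →ₐ[ℝ] SFun κ V :=
  SFun.pull (fun o => o.elim 0 (CInf.coord V)) h0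

theorem slice_timeHom
    (h0 : ∀ x : V, (fun o : Option ι => (o.elim (0 : CInf V) (CInf.coord V)).1 x) ∈ W)
    (H : SmoothFn) : slice h0 (timeHom κ W H) = H.1 0 • (1 : SFun κ V) := by
  have hpull : CInf.pull _ h0 (timeFn W H.1 H.contDiff) = H.1 0 • (1 : CInf V) :=
    Subtype.ext <| funext fun _ => (mul_one _).symm
  change CInf.pull _ h0 (timeFn W H.1 H.contDiff) ⊗ₜ[ℝ] (1 : Grass κ) = _
  rw [hpull, ← TensorProduct.smul_tmul']
  rfl

/-- The lift of a vector field along the projection of the product with the line to the second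
factor. -/
def Vect.lift (hW : ∀ z : W, (fun a => z.1 (some a)) ∈ V) (X : Vect κ V) : Vect κ W :=
  lineCases 0 fun I => SFun.pr hW (X I)

theorem Vect.lift_none (hW : ∀ z : W, (fun a => z.1 (some a)) ∈ V) (X : Vect κ V) :
    X.lift hW (Sum.inl none) = 0 := rfl

theorem Vect.lift_up (hW : ∀ z : W, (fun a => z.1 (some a)) ∈ V) (X : Vect κ V) (I : ι ⊕ κ) :
    X.lift hW (up I) = SFun.pr hW (X I) := lineCases_up _ _ I

variable [DecidableEq κ]

namespace Vect

theorem frame_up_up (hW : ∀ z : W, (fun a => z.1 (some a)) ∈ V) (I J : ι ⊕ κ) :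
    (frame (up I) : Vect κ W) (up J) = SFun.pr hW ((frame I : Vect κ V) J) := by
  by_cases h : J = I
  · rw [h, frame_same, frame_same, map_one]
  · rw [frame_ne h, frame_ne fun h' => h (up_injective h'), map_zero]

theorem frame_up_none (I : ι ⊕ κ) : (frame (up I) : Vect κ W) (Sum.inl none) = 0 :=
  frame_ne (Ne.symm (up_ne_none I))

theorem frame_none_up (I : ι ⊕ κ) : (frame (Sum.inl none) : Vect κ W) (up I) = 0 :=
  frame_ne (up_ne_none I)

end Vect

variable [Fintype κ]

theorem timeHom_comm (H : SmoothFn) (x : SFun κ W) : x * timeHom κ W H = timeHom κ W H * x :=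
  (SFun.ofCInf_comm _ x).symm

theorem timeHom_mem_homog (H : SmoothFn) : timeHom κ W H ∈ SFun.homog κ W 0 :=
  SFun.ofCInf_mem_homog _

namespace SFun

theorem twist_pull {ι' : Type} [Fintype ι'] [DecidableEq ι'] {U : Opens (ι' → ℝ)}
    (u : ι → CInf U) (h : ∀ x : U, (fun a => (u a).1 x) ∈ V) (p : ZMod 2) (x : SFun κ V) :
    twist p (pull u h x) = pull u h (twist p x) := by
  induction x using induction_homog with
  | homog r x hx => rw [twist_of_mem hx, twist_of_mem (pull_mem_homog u h hx), map_smul]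
  | add x y hx hy => simp only [map_add, hx, hy]

variable (hW : ∀ z : W, (fun a => z.1 (some a)) ∈ V)

theorem twist_pr (p : ZMod 2) (x : SFun κ V) : twist p (pr hW x) = pr hW (twist p x) :=
  twist_pull _ _ p x

theorem pr_mem_homog {p : ZMod 2} {x : SFun κ V} (hx : x ∈ homog κ V p) :
    pr hW x ∈ homog κ W p := pull_mem_homog _ _ hx

theorem d_none_timeHom_mul_pr (H : SmoothFn) (x : SFun κ V) :
    d (Sum.inl none) (timeHom κ W H * pr hW x) = timeHom κ W H.deriv * pr hW x := by
  rw [d_mul, d_none_timeHom, d_pr_none, mul_zero, add_zero]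

theorem d_up_timeHom_mul_pr (I : ι ⊕ κ) (H : SmoothFn) (x : SFun κ V) :
    d (up I) (timeHom κ W H * pr hW x) = timeHom κ W H * pr hW (d I x) := by
  rw [d_mul, d_up_timeHom, d_pr_up, zero_mul, zero_add, twist_timeHom]

end SFun

section Slice

variable (h0 : ∀ x : V, (fun o : Option ι => (o.elim (0 : CInf V) (CInf.coord V)).1 x) ∈ W)

theorem slice_pr (hW : ∀ z : W, (fun a => z.1 (some a)) ∈ V) (x : SFun κ V) :
    slice h0 (SFun.pr hW x) = x :=
  (SFun.pull_pull _ h0 _ hW (CInf.coord V) (fun x => x.2) (fun _ => rfl) x).trans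
    (SFun.pull_coord x)

theorem slice_timeHom_mul_pr (hW : ∀ z : W, (fun a => z.1 (some a)) ∈ V) (H : SmoothFn)
    (x : SFun κ V) : slice h0 (timeHom κ W H * SFun.pr hW x) = H.1 0 • x := by
  rw [map_mul, slice_timeHom, slice_pr, smul_mul_assoc, one_mul]

theorem twist_slice (p : ZMod 2) (x : SFun κ W) :
    SFun.twist p (slice h0 x) = slice h0 (SFun.twist p x) := SFun.twist_pull _ h0 p x

end Slice

namespace Vect

theorem ext_line {X Y : Vect κ W} (h0 : X (Sum.inl none) = Y (Sum.inl none))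
    (h : ∀ I, X (up I) = Y (up I)) : X = Y := by
  funext I
  rcases index_cases I with rfl | ⟨I, rfl⟩
  exacts [h0, h I]

variable (hW : ∀ z : W, (fun a => z.1 (some a)) ∈ V)

theorem lift_real_smul (c : ℝ) (X : Vect κ V) : lift hW (c • X) = c • lift hW X := by
  refine ext_line ?_ fun I => ?_
  · rw [Pi.smul_apply, lift_none, lift_none, smul_zero]
  · rw [Pi.smul_apply, lift_up, lift_up, Pi.smul_apply, map_smul]

theorem IsHomog.lift {a : ZMod 2} {X : Vect κ V} (hX : X.IsHomog a) :
    (lift hW X).IsHomog a := fun I => by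
  rcases index_cases I with rfl | ⟨I, rfl⟩
  · exact Submodule.zero_mem _
  · rw [lift_up, deg_up]
    exact SFun.pr_mem_homog hW (hX I)

end Vect

end Line

section WarpedMetric

open Vect

variable {ι : Type} [Fintype ι] [DecidableEq ι] {κ : Type} [Fintype κ] [DecidableEq κ]
  {W : Opens (Option ι → ℝ)} {V : Opens (ι → ℝ)} (hW : ∀ z : W, (fun a => z.1 (some a)) ∈ V)
  (H : SmoothFn) (g : ι ⊕ κ → ι ⊕ κ → SFun κ V)

theorem warpComp_up_up_timeHom (I J : ι ⊕ κ) :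
    warpComp hW H.1 H.contDiff g (up I) (up J) = timeHom κ W (H ^ 2) * SFun.pr hW (g I J) :=
  warpComp_up_up hW H.1 H.contDiff g I J

theorem pair_warp_none_right (X : Vect κ W) :
    pair (warpComp hW H.1 H.contDiff g) X (frame (Sum.inl none)) = -X (Sum.inl none) := by
  simp only [pair_frame_right, sum_index, warpComp_none_none, warpComp_up_none, mul_zero,
    Finset.sum_const_zero, add_zero, mul_neg, mul_one]

theorem pair_warp_none_left (X : Vect κ W) :
    pair (warpComp hW H.1 H.contDiff g) (frame (Sum.inl none)) X = -X (Sum.inl none) := by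
  simp only [pair_frame_left, sum_index, warpComp_none_none, warpComp_none_up, mul_zero,
    Finset.sum_const_zero, add_zero, mul_neg, mul_one, deg_none, SFun.twist_zero]

theorem pair_warp_up_right (X : Vect κ W) (K : ι ⊕ κ) :
    pair (warpComp hW H.1 H.contDiff g) X (frame (up K)) =
      timeHom κ W (H ^ 2) * ∑ I, X (up I) * SFun.pr hW (g I K) := by
  simp only [pair_frame_right, sum_index, warpComp_none_up, warpComp_up_up_timeHom, mul_zero,
    zero_add, Finset.mul_sum, ← mul_assoc, timeHom_comm]

theorem pair_warp_up_left (X : Vect κ W) (K : ι ⊕ κ) :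
    pair (warpComp hW H.1 H.contDiff g) (frame (up K)) X =
      timeHom κ W (H ^ 2) * ∑ J, SFun.twist (deg K) (X (up J)) * SFun.pr hW (g K J) := by
  simp only [pair_frame_left, sum_index, warpComp_up_none, warpComp_up_up_timeHom, mul_zero,
    zero_add, Finset.mul_sum, ← mul_assoc, timeHom_comm, deg_up]

theorem pair_warp_lift_right (X : Vect κ V) (K : ι ⊕ κ) :
    pair (warpComp hW H.1 H.contDiff g) (lift hW X) (frame (up K)) =
      timeHom κ W (H ^ 2) * SFun.pr hW (pair g X (frame K)) := by
  rw [pair_warp_up_right, pair_frame_right]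
  simp only [lift_up, map_sum, map_mul]

theorem pair_warp_lift_left (X : Vect κ V) (K : ι ⊕ κ) :
    pair (warpComp hW H.1 H.contDiff g) (frame (up K)) (lift hW X) =
      timeHom κ W (H ^ 2) * SFun.pr hW (pair g (frame K) X) := by
  rw [pair_warp_up_left, pair_frame_left]
  simp only [lift_up, SFun.twist_pr, map_sum, map_mul]

end WarpedMetric

section SliceConnection

open Vect

variable {ι : Type} [Fintype ι] [DecidableEq ι] {κ : Type} [Fintype κ] [DecidableEq κ]
  {W : Opens (Option ι → ℝ)} {V : Opens (ι → ℝ)}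
  (h0 : ∀ x : V, (fun o : Option ι => (o.elim (0 : CInf V) (CInf.coord V)).1 x) ∈ W)

/-- The connection induced on the slice `t = 0` by a connection on the product with the line:
covariant derivatives are projected along `∂_t` and restricted. -/
def sliceConnection (D : AffineConnection κ W) : AffineConnection κ V :=
  AffineConnection.ofChristoffel
    (fun I J K => slice h0 (D.cov (frame (up I)) (frame (up J)) (up K))) fun I J K => by
      have h := D.cov_homog _ _ _ _ (isHomog_frame (up I)) (isHomog_frame (up J)) (up K)
      rw [deg_up, deg_up, deg_up] at h
      exact SFun.pull_mem_homog _ _ h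

theorem sliceConnection_frame (D : AffineConnection κ W) (I J : ι ⊕ κ) :
    (sliceConnection h0 D).cov (frame I) (frame J) =
      fun K => slice h0 (D.cov (frame (up I)) (frame (up J)) (up K)) :=
  christoffel_frame_frame _ I J

variable (hW : ∀ z : W, (fun a => z.1 (some a)) ∈ V) (H : SmoothFn)
  (g : ι ⊕ κ → ι ⊕ κ → SFun κ V)

theorem slice_pair_warp_right (X : Vect κ W) (K : ι ⊕ κ) :
    slice h0 (pair (warpComp hW H.1 H.contDiff g) X (frame (up K))) =
      (H ^ 2).1 0 • pair g (fun I => slice h0 (X (up I))) (frame K) := by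
  rw [pair_warp_up_right, pair_frame_right]
  simp only [map_mul, map_sum, slice_timeHom, slice_pr, smul_mul_assoc, one_mul]

theorem slice_pair_warp_left (X : Vect κ W) (K : ι ⊕ κ) :
    slice h0 (pair (warpComp hW H.1 H.contDiff g) (frame (up K)) X) =
      (H ^ 2).1 0 • pair g (frame K) (fun I => slice h0 (X (up I))) := by
  rw [pair_warp_up_left, pair_frame_left]
  simp only [map_mul, map_sum, slice_timeHom, slice_pr, twist_slice, smul_mul_assoc, one_mul]

variable {H g}

theorem isLeviCivita_sliceConnection (hH : H.1 0 ≠ 0) {D : AffineConnection κ W}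
    (hD : D.IsLeviCivita (warpComp hW H.1 H.contDiff g)) :
    (sliceConnection h0 D).IsLeviCivita g := by
  obtain ⟨hsymm, hmetric⟩ := AffineConnection.isLeviCivita_iff_frames.1 hD
  refine AffineConnection.isLeviCivita_iff_frames.2 ⟨fun I J => ?_, fun I J K => ?_⟩
  · simp only [sliceConnection_frame]
    funext K
    rw [hsymm (up I) (up J), deg_up, deg_up, Pi.smul_apply, map_smul, Pi.smul_apply]
  · have h := congrArg (slice h0) (hmetric (up I) (up J) (up K))
    rw [warpComp_up_up_timeHom, SFun.d_up_timeHom_mul_pr, slice_timeHom_mul_pr, map_add, map_smul,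
      slice_pair_warp_right, slice_pair_warp_left, smul_comm (sgn _ _), ← smul_add, deg_up,
      deg_up] at h
    simp only [sliceConnection_frame]
    exact smul_right_injective _ (pow_ne_zero 2 hH : (H ^ 2).1 0 ≠ 0) h

end SliceConnection

section LineConnection

open Vect

variable {ι : Type} [Fintype ι] [DecidableEq ι] {κ : Type} [Fintype κ] [DecidableEq κ]
  {W : Opens (Option ι → ℝ)} {V : Opens (ι → ℝ)} (hW : ∀ z : W, (fun a => z.1 (some a)) ∈ V)
  (α β γ δ : SmoothFn) (g : ι ⊕ κ → ι ⊕ κ → SFun κ V) (D : AffineConnection κ V)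

/-- Christoffel symbols on the product with the line, invariant under the isometries of the second
factor: `∇_t ∂_t = α ∂_t`, `∇_t ∂_J = β ∂_J`, `∇_I ∂_t = γ ∂_I` and
`∇_I ∂_J = D_I ∂_J + δ g_IJ ∂_t`. Both connections in question are of this form. -/
def lineChristoffel : Option ι ⊕ κ → Option ι ⊕ κ → Vect κ W :=
  lineCases
    (lineCases (timeHom κ W α • frame (Sum.inl none)) fun J => timeHom κ W β • frame (up J))
    fun I => lineCases (timeHom κ W γ • frame (up I)) fun J =>
      lift hW (D.cov (frame I) (frame J)) +
        (timeHom κ W δ * SFun.pr hW (g I J)) • frame (Sum.inl none)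

theorem lineChristoffel_none_none :
    lineChristoffel hW α β γ δ g D (Sum.inl none) (Sum.inl none) =
      timeHom κ W α • frame (Sum.inl none) := rfl

theorem lineChristoffel_none_up (J : ι ⊕ κ) :
    lineChristoffel hW α β γ δ g D (Sum.inl none) (up J) = timeHom κ W β • frame (up J) := by
  rw [lineChristoffel, lineCases_none, lineCases_up]

theorem lineChristoffel_up_none (I : ι ⊕ κ) :
    lineChristoffel hW α β γ δ g D (up I) (Sum.inl none) = timeHom κ W γ • frame (up I) := by
  rw [lineChristoffel, lineCases_up, lineCases_none]

theorem lineChristoffel_up_up (I J : ι ⊕ κ) :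
    lineChristoffel hW α β γ δ g D (up I) (up J) = lift hW (D.cov (frame I) (frame J)) +
      (timeHom κ W δ * SFun.pr hW (g I J)) • frame (Sum.inl none) := by
  rw [lineChristoffel, lineCases_up, lineCases_up]

variable {g}

theorem isHomog_lineChristoffel (hg : ∀ I J, g I J ∈ SFun.homog κ V (deg I + deg J))
    (I J : Option ι ⊕ κ) :
    (lineChristoffel hW α β γ δ g D I J).IsHomog (deg I + deg J) := by
  have ht (K : SmoothFn) (I : Option ι ⊕ κ) :
      (timeHom κ W K • frame I : Vect κ W).IsHomog (deg I) := by
    simpa only [zero_add] using IsHomog.smul (timeHom_mem_homog K) (isHomog_frame I)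
  rcases index_cases I with rfl | ⟨I, rfl⟩ <;> rcases index_cases J with rfl | ⟨J, rfl⟩
  · exact ht α (Sum.inl none)
  · rw [lineChristoffel_none_up, deg_none, zero_add]
    exact ht β (up J)
  · rw [lineChristoffel_up_none, deg_none, add_zero]
    exact ht γ (up I)
  · rw [lineChristoffel_up_up, deg_up, deg_up]
    refine ((D.cov_homog _ _ _ _ (isHomog_frame I) (isHomog_frame J)).lift hW).add ?_
    have h := IsHomog.smul (SFun.mul_mem_homog (timeHom_mem_homog (κ := κ) (W := W) δ)
      (SFun.pr_mem_homog hW (hg I J))) (isHomog_frame (U := W) (Sum.inl none : Option ι ⊕ κ))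
    rwa [deg_none, zero_add, add_zero] at h

/-- The affine connection on the product with the line with Christoffel symbols
`lineChristoffel`. -/
def lineConnection (hg : ∀ I J, g I J ∈ SFun.homog κ V (deg I + deg J)) : AffineConnection κ W :=
  AffineConnection.ofChristoffel (lineChristoffel hW α β γ δ g D)
    (isHomog_lineChristoffel hW α β γ δ D hg)

variable (hg : ∀ I J, g I J ∈ SFun.homog κ V (deg I + deg J))

theorem lineConnection_frame (I J : Option ι ⊕ κ) :
    (lineConnection hW α β γ δ D hg).cov (frame I) (frame J) =
      lineChristoffel hW α β γ δ g D I J := christoffel_frame_frame _ I J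

variable {D}

theorem lineChristoffel_up_up_symm (hs : ∀ I J, g I J = sgn (deg I) (deg J) • g J I)
    (hD : D.IsLeviCivita g) (I J : ι ⊕ κ) :
    lineChristoffel hW α β γ δ g D (up I) (up J) =
      sgn (deg I) (deg J) • lineChristoffel hW α β γ δ g D (up J) (up I) := by
  rw [lineChristoffel_up_up, lineChristoffel_up_up, smul_add, ← lift_real_smul,
    ← (AffineConnection.isLeviCivita_iff_frames.1 hD).1 I J, hs I J, map_smul, mul_smul_comm,
    smul_assoc]

variable (H ψ : SmoothFn)

theorem d_warpComp_up_up_up (hD : D.IsLeviCivita g) (I J K : ι ⊕ κ) :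
    SFun.d (up I) (warpComp hW H.1 H.contDiff g (up J) (up K)) =
      pair (warpComp hW H.1 H.contDiff g) (lineChristoffel hW α β γ δ g D (up I) (up J))
          (frame (up K)) +
        sgn (deg (up I)) (deg (up J)) • pair (warpComp hW H.1 H.contDiff g) (frame (up J))
          (lineChristoffel hW α β γ δ g D (up I) (up K)) := by
  rw [warpComp_up_up_timeHom, SFun.d_up_timeHom_mul_pr, lineChristoffel_up_up,
    lineChristoffel_up_up, pair_add_left, pair_add_right, pair_smul_left,
    pair_smul_right _ (isHomog_frame _), pair_frame_frame, pair_frame_frame, warpComp_none_up,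
    warpComp_up_none, mul_zero, mul_zero, add_zero, add_zero, pair_warp_lift_right,
    pair_warp_lift_left, (AffineConnection.isLeviCivita_iff_frames.1 hD).2 I J K, map_add,
    map_smul, mul_add, mul_smul_comm, deg_up, deg_up]

theorem d_warpComp_eq_pair_lineConnection (hψ : ψ * H = H.deriv)
    (hs : ∀ I J, g I J = sgn (deg I) (deg J) • g J I) (hD : D.IsLeviCivita g)
    (I J K : Option ι ⊕ κ) :
    SFun.d I (warpComp hW H.1 H.contDiff g J K) =
      pair (warpComp hW H.1 H.contDiff g)
          ((lineConnection hW 0 ψ ψ (H * H.deriv) D hg).cov (frame I) (frame J)) (frame K) +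
        sgn (deg I) (deg J) • pair (warpComp hW H.1 H.contDiff g) (frame J)
          ((lineConnection hW 0 ψ ψ (H * H.deriv) D hg).cov (frame I) (frame K)) := by
  have hψ_sq : H * H.deriv = ψ * H ^ 2 := by rw [← hψ]; ring
  simp only [lineConnection_frame]
  rcases index_cases I with rfl | ⟨I, rfl⟩ <;> rcases index_cases J with rfl | ⟨J, rfl⟩ <;>
    rcases index_cases K with rfl | ⟨K, rfl⟩
  · simp only [warpComp_none_none, map_neg, SFun.d_one, lineChristoffel_none_none, map_zero,
      zero_smul, pair_zero_left, pair_zero_right, smul_zero, add_zero, neg_zero]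
  · simp only [warpComp_none_up, map_zero, lineChristoffel_none_none, zero_smul, pair_zero_left,
      lineChristoffel_none_up, pair_warp_none_left, Pi.smul_apply, frame_up_none, smul_zero,
      neg_zero, add_zero]
  · simp only [warpComp_up_none, map_zero, lineChristoffel_none_none, zero_smul, pair_zero_right,
      lineChristoffel_none_up, pair_warp_none_right, Pi.smul_apply, frame_up_none, smul_zero,
      neg_zero, add_zero]
  · have hderiv : (H ^ 2).deriv = ψ * H ^ 2 + ψ * H ^ 2 := by
      rw [pow_two, SmoothFn.deriv_mul, ← hψ]; ring
    rw [lineChristoffel_none_up, lineChristoffel_none_up, pair_smul_left,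
      pair_smul_right _ (isHomog_frame _), pair_frame_frame, warpComp_up_up_timeHom,
      SFun.d_none_timeHom_mul_pr, twist_timeHom, deg_none, sgn_zero_left, one_smul, hderiv,
      map_add, add_mul, map_mul, mul_assoc]
  · simp only [warpComp_none_none, map_neg, SFun.d_one, lineChristoffel_up_none,
      pair_warp_none_left, pair_warp_none_right, Pi.smul_apply, frame_up_none, smul_zero, neg_zero,
      add_zero]
  · rw [warpComp_none_up, map_zero, lineChristoffel_up_none, lineChristoffel_up_up,
      pair_warp_none_left, pair_smul_left, pair_frame_frame, warpComp_up_up_timeHom,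
      Pi.add_apply, lift_none, Pi.smul_apply, frame_same, smul_eq_mul, mul_one, zero_add,
      deg_none, sgn_zero_right, one_smul, hψ_sq, map_mul, ← mul_assoc, add_neg_cancel]
  · rw [warpComp_up_none, map_zero, lineChristoffel_up_none, lineChristoffel_up_up,
      pair_warp_none_right, pair_smul_right _ (isHomog_frame _), pair_frame_frame,
      warpComp_up_up_timeHom, Pi.add_apply, lift_none, Pi.smul_apply, frame_same, smul_eq_mul,
      mul_one, zero_add, twist_timeHom, deg_up, deg_up, ← mul_smul_comm, ← mul_smul_comm,
      ← map_smul, ← hs I J, hψ_sq, map_mul, ← mul_assoc, neg_add_cancel]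
  · exact d_warpComp_up_up_up hW 0 ψ ψ (H * H.deriv) H hD I J K

theorem isLeviCivita_lineConnection (hψ : ψ * H = H.deriv)
    (hs : ∀ I J, g I J = sgn (deg I) (deg J) • g J I) (hD : D.IsLeviCivita g) :
    (lineConnection hW 0 ψ ψ (H * H.deriv) D hg).IsLeviCivita
      (warpComp hW H.1 H.contDiff g) := by
  refine AffineConnection.isLeviCivita_iff_frames.2
    ⟨fun I J => ?_, d_warpComp_eq_pair_lineConnection hW hg H ψ hψ hs hD⟩
  simp only [lineConnection_frame]
  rcases index_cases I with rfl | ⟨I, rfl⟩ <;> rcases index_cases J with rfl | ⟨J, rfl⟩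
  · rw [deg_none, sgn_zero_left, one_smul]
  · rw [deg_none, sgn_zero_left, one_smul, lineChristoffel_none_up, lineChristoffel_up_none]
  · rw [deg_none, sgn_zero_right, one_smul, lineChristoffel_none_up, lineChristoffel_up_none]
  · rw [deg_up, deg_up]
    exact lineChristoffel_up_up_symm hW 0 ψ ψ _ hs hD I J

end LineConnection

section RicciTrace

open Vect

variable {ι : Type} [Fintype ι] {κ : Type} [Fintype κ]

theorem sum_sgn_deg :
    ∑ K : ι ⊕ κ, sgn (deg K) (deg K) = (Fintype.card ι : ℝ) - Fintype.card κ := by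
  have heven (a : ι) : sgn (deg (Sum.inl a : ι ⊕ κ)) (deg (Sum.inl a : ι ⊕ κ)) = 1 :=
    sgn_zero_left 0
  have hodd (B : κ) : sgn (deg (Sum.inr B : ι ⊕ κ)) (deg (Sum.inr B : ι ⊕ κ)) = -1 :=
    sgn_one_one
  simp only [Fintype.sum_sum_type, heven, hodd, Finset.sum_const, Finset.card_univ, nsmul_eq_mul,
    mul_one, mul_neg, sub_eq_add_neg]

variable [DecidableEq ι] [DecidableEq κ] {U : Opens (ι → ℝ)}

/-- The supertrace `K ↦ R(∂_K, ∂_I) ∂_J` of the curvature; the Ricci tensor on coordinate fields is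
its supersymmetric part. -/
def ricciTrace (cov : Vect κ U → Vect κ U → Vect κ U) (I J : ι ⊕ κ) : SFun κ U :=
  ∑ K, sgn (deg K) (deg K + deg I + deg J) •
    curvature cov (deg K) (deg I) (frame K) (frame I) (frame J) K

theorem ricci_frame_frame (cov : Vect κ U → Vect κ U → Vect κ U) (I J : ι ⊕ κ) :
    ricci cov (deg I) (deg J) (frame I) (frame J) =
      (1 / 2 : ℝ) • (ricciTrace cov I J + sgn (deg I) (deg J) • ricciTrace cov J I) := by
  simp only [ricci, ricciTrace, Finset.smul_sum, ← Finset.sum_add_distrib]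
  refine Finset.sum_congr rfl fun K _ => ?_
  rw [add_right_comm (deg K) (deg J) (deg I), mul_comm, mul_smul, smul_comm (sgn (deg I) (deg J)),
    smul_add]

theorem AffineConnection.curvature_frame_self (D : AffineConnection κ U) {I : ι ⊕ κ}
    (hI : deg I = 0) (Y : Vect κ U) :
    curvature D.cov (deg I) (deg I) (frame I) (frame I) Y = 0 := by
  rw [D.curvature_frame_frame, hI, sgn_zero_left, one_smul, sub_self]

theorem AffineConnection.curvature_frame_swap (D : AffineConnection κ U) (I J : ι ⊕ κ)
    (Y : Vect κ U) : curvature D.cov (deg I) (deg J) (frame I) (frame J) Y =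
      -(sgn (deg I) (deg J) • curvature D.cov (deg J) (deg I) (frame J) (frame I) Y) := by
  rw [D.curvature_frame_frame, D.curvature_frame_frame, smul_sub, smul_smul,
    sgn_comm (deg J) (deg I), sgn_mul_self, one_smul, neg_sub]

/-- The tensor `(K, I, J) ↦ g(∂_I, ∂_J) ∂_K - g(∂_K, ∂_J) ∂_I`, with the signs of the sign rule: the
curvature of a space of constant curvature one. -/
def constCurvature (g : ι ⊕ κ → ι ⊕ κ → SFun κ U) (K I J : ι ⊕ κ) : Vect κ U :=
  sgn (deg K) (deg I + deg J) • g I J • frame K -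
    (sgn (deg K) (deg I) * sgn (deg I) (deg K + deg J)) • g K J • frame I

theorem supertrace_constCurvature (g : ι ⊕ κ → ι ⊕ κ → SFun κ U) (I J : ι ⊕ κ) :
    ∑ K, sgn (deg K) (deg K + deg I + deg J) • constCurvature g K I J K =
      ((Fintype.card ι : ℝ) - Fintype.card κ - 1) • g I J := by
  have hterm (K : ι ⊕ κ) : sgn (deg K) (deg K + deg I + deg J) • constCurvature g K I J K =
      sgn (deg K) (deg K) • g I J - if K = I then g I J else 0 := by
    have hfst : sgn (deg K) (deg K + deg I + deg J) * sgn (deg K) (deg I + deg J) =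
        sgn (deg K) (deg K) := by
      rw [add_assoc, sgn_add_right, mul_assoc, sgn_mul_self, mul_one]
    simp only [constCurvature, Pi.sub_apply, Pi.smul_apply, smul_eq_mul, frame_same, mul_one,
      smul_sub, smul_smul, hfst]
    congr 1
    rcases eq_or_ne K I with rfl | hK
    · rw [if_pos rfl, frame_same, mul_one, add_assoc, sgn_add_right, mul_mul_mul_comm,
        sgn_mul_self, sgn_mul_self, mul_one, one_smul]
    · rw [if_neg hK, frame_ne hK, mul_zero, smul_zero]
  simp only [hterm, Finset.sum_sub_distrib, ← Finset.sum_smul, sum_sgn_deg, Finset.sum_ite_eq',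
    Finset.mem_univ, if_true, sub_smul _ (1 : ℝ), one_smul]

end RicciTrace

section LineConnectionRicci

open Vect AffineConnection

variable {ι : Type} [Fintype ι] [DecidableEq ι] {κ : Type} [Fintype κ] [DecidableEq κ]
  {W : Opens (Option ι → ℝ)} {V : Opens (ι → ℝ)} (hW : ∀ z : W, (fun a => z.1 (some a)) ∈ V)
  (α β γ δ : SmoothFn) {g : ι ⊕ κ → ι ⊕ κ → SFun κ V} (D : AffineConnection κ V)
  (hg : ∀ I J, g I J ∈ SFun.homog κ V (deg I + deg J))

theorem lineChristoffel_sub_one (I J : Option ι ⊕ κ) :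
    lineChristoffel hW (α - 1) β (γ - 1) δ g D I J =
      lineChristoffel hW α β γ δ g D I J - if J = Sum.inl none then frame I else 0 := by
  rcases index_cases I with rfl | ⟨I, rfl⟩ <;> rcases index_cases J with rfl | ⟨J, rfl⟩
  · rw [if_pos rfl, lineChristoffel_none_none, lineChristoffel_none_none, map_sub, map_one,
      sub_smul, one_smul]
  · rw [if_neg (up_ne_none J), sub_zero, lineChristoffel_none_up, lineChristoffel_none_up]
  · rw [if_pos rfl, lineChristoffel_up_none, lineChristoffel_up_none, map_sub, map_one, sub_smul,
      one_smul]
  · rw [if_neg (up_ne_none J), sub_zero, lineChristoffel_up_up, lineChristoffel_up_up]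

theorem semiSymm_lineConnection (H : SmoothFn) :
    semiSymm (lineConnection hW α β γ δ D hg).cov (warpComp hW H.1 H.contDiff g)
        (frame (Sum.inl none)) =
      (lineConnection hW (α - 1) β (γ - 1) δ D hg).cov := by
  funext X Y
  have hrmul : X.rmul (-Y (Sum.inl none)) = -∑ I, ∑ J, (X I * SFun.twist (deg I) (Y J)) •
      if J = Sum.inl none then (frame I : Vect κ W) else 0 := by
    rw [eq_sum_frame (X.rmul _), ← Finset.sum_neg_distrib]
    simp only [smul_ite, smul_zero, Finset.sum_ite_eq', Finset.mem_univ, if_true, rmul, map_neg,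
      mul_neg, neg_smul]
  change christoffel _ X Y + X.rmul _ = christoffel _ X Y
  simp only [pair_warp_none_right, hrmul, christoffel, lineChristoffel_sub_one, smul_sub,
    Finset.sum_sub_distrib]
  abel

theorem lineConnection_none_lift (X : Vect κ V) :
    (lineConnection hW α β γ δ D hg).cov (frame (Sum.inl none)) (lift hW X) =
      timeHom κ W β • lift hW X := by
  rw [cov_frame]
  refine ext_line ?_ fun L => ?_
  · simp only [Pi.add_apply, Finset.sum_apply, Pi.smul_apply, sum_index, lift_none, map_zero,
      zero_smul, zero_add, lineConnection_frame, lineChristoffel_none_up, frame_up_none, smul_zero,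
      Finset.sum_const_zero]
  · simp only [Pi.add_apply, Finset.sum_apply, Pi.smul_apply, sum_index, lift_none, lift_up,
      SFun.d_pr_none, zero_smul, zero_add, deg_none, SFun.twist_zero, lineConnection_frame,
      lineChristoffel_none_up, frame_up_up hW, smul_eq_mul]
    simp [frame_apply, timeHom_comm]

theorem lineConnection_up_lift_up (K L : ι ⊕ κ) (X : Vect κ V) :
    (lineConnection hW α β γ δ D hg).cov (frame (up K)) (lift hW X) (up L) =
      SFun.pr hW (D.cov (frame K) X L) := by
  rw [cov_frame, cov_frame]
  simp only [Pi.add_apply, Finset.sum_apply, Pi.smul_apply, sum_index, lift_none, lift_up,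
    SFun.d_pr_up, map_zero, zero_smul, zero_add, deg_up, SFun.twist_pr, map_add, map_sum,
    smul_eq_mul, lineConnection_frame, lineChristoffel_up_up, frame_none_up, mul_zero, add_zero,
    map_mul]

theorem curvature_lineConnection_up_none_none (K : ι ⊕ κ) :
    curvature (lineConnection hW α β γ δ D hg).cov (deg K) 0 (frame (up K))
        (frame (Sum.inl none)) (frame (Sum.inl none)) =
      timeHom κ W (α * γ - γ.deriv - γ * β) • frame (up K) := by
  have h := (lineConnection hW α β γ δ D hg).curvature_frame_frame (up K) (Sum.inl none)
    (frame (Sum.inl none))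
  rw [deg_none, deg_up] at h
  rw [h, sgn_zero_right, one_smul, lineConnection_frame, lineConnection_frame,
    lineChristoffel_none_none, lineChristoffel_up_none, cov_frame_smul, cov_frame_smul,
    lineConnection_frame, lineConnection_frame, lineChristoffel_none_up, lineChristoffel_up_none,
    d_up_timeHom, zero_smul, zero_add, twist_timeHom, twist_timeHom, d_none_timeHom, smul_smul,
    smul_smul, ← map_mul, ← map_mul, ← add_smul, ← sub_smul, ← map_add, ← map_sub, sub_sub]

theorem curvature_lineConnection_up_none_up (K J L : ι ⊕ κ) :
    curvature (lineConnection hW α β γ δ D hg).cov (deg K) 0 (frame (up K))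
      (frame (Sum.inl none)) (frame (up J)) (up L) = 0 := by
  have h := (lineConnection hW α β γ δ D hg).curvature_frame_frame (up K) (Sum.inl none)
    (frame (up J))
  rw [deg_none, deg_up] at h
  rw [h, sgn_zero_right, one_smul, lineConnection_frame, lineConnection_frame,
    lineChristoffel_none_up, lineChristoffel_up_up, cov_frame_smul, cov_add_right,
    lineConnection_none_lift, cov_frame_smul, lineConnection_frame, lineConnection_frame,
    lineChristoffel_up_up, lineChristoffel_none_none, twist_timeHom, d_up_timeHom]
  simp only [Pi.sub_apply, Pi.add_apply, Pi.smul_apply, smul_eq_mul, frame_none_up, mul_zero,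
    add_zero, zero_mul, zero_add, sub_self]

theorem curvature_lineConnection_none_up_up (I J : ι ⊕ κ) :
    curvature (lineConnection hW α β γ δ D hg).cov 0 (deg I) (frame (Sum.inl none))
        (frame (up I)) (frame (up J)) (Sum.inl none) =
      timeHom κ W (δ.deriv + (α - β) * δ) * SFun.pr hW (g I J) := by
  have h := (lineConnection hW α β γ δ D hg).curvature_frame_frame (Sum.inl none) (up I)
    (frame (up J))
  rw [deg_none, deg_up] at h
  rw [h, sgn_zero_left, one_smul, lineConnection_frame, lineConnection_frame,
    lineChristoffel_none_up, lineChristoffel_up_up, cov_frame_smul, cov_add_right,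
    lineConnection_none_lift, cov_frame_smul, lineConnection_frame, lineConnection_frame,
    lineChristoffel_up_up, lineChristoffel_none_none, twist_timeHom, d_up_timeHom, deg_none,
    SFun.twist_zero, SFun.d_none_timeHom_mul_pr]
  simp only [Pi.sub_apply, Pi.add_apply, Pi.smul_apply, smul_eq_mul, frame_same, lift_none,
    mul_zero, mul_one, zero_mul, zero_add]
  rw [timeHom_comm α, ← mul_assoc, ← mul_assoc, ← map_mul, ← map_mul, ← add_mul, ← sub_mul,
    ← map_add, ← map_sub, sub_mul, add_sub_assoc]

variable {D}

theorem curvature_lineConnection_up_up_none (hs : ∀ I J, g I J = sgn (deg I) (deg J) • g J I)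
    (hD : D.IsLeviCivita g) (K J : ι ⊕ κ) :
    curvature (lineConnection hW α β γ δ D hg).cov (deg K) (deg J) (frame (up K))
      (frame (up J)) (frame (Sum.inl none)) = 0 := by
  have h := (lineConnection hW α β γ δ D hg).curvature_frame_frame (up K) (up J)
    (frame (Sum.inl none))
  rw [deg_up, deg_up] at h
  rw [h, lineConnection_frame, lineConnection_frame, lineChristoffel_up_none,
    lineChristoffel_up_none, cov_frame_smul, cov_frame_smul, lineConnection_frame,
    lineConnection_frame, twist_timeHom, twist_timeHom, d_up_timeHom, d_up_timeHom, zero_smul,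
    zero_smul, zero_add, zero_add, lineChristoffel_up_up_symm hW α β γ δ hs hD K J,
    smul_comm (timeHom κ W _) (sgn (deg K) (deg J)), sub_self]

variable (D)

theorem lineConnection_up_lineConnection_up_up (K I J L : ι ⊕ κ) :
    (lineConnection hW α β γ δ D hg).cov (frame (up K))
        ((lineConnection hW α β γ δ D hg).cov (frame (up I)) (frame (up J))) (up L) =
      SFun.pr hW (D.cov (frame K) (D.cov (frame I) (frame J)) L) +
        timeHom κ W (γ * δ) *
          SFun.pr hW (sgn (deg K) (deg I + deg J) • (g I J * (frame K : Vect κ V) L)) := by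
  rw [lineConnection_frame, lineChristoffel_up_up, cov_add_right, cov_frame_smul,
    lineConnection_frame, lineChristoffel_up_none, Pi.add_apply, lineConnection_up_lift_up,
    SFun.twist_mul, twist_timeHom, SFun.twist_of_mem (SFun.pr_mem_homog hW (hg I J)), deg_up]
  simp only [Pi.add_apply, Pi.smul_apply, smul_eq_mul, frame_none_up, mul_zero, zero_add,
    frame_up_up hW, map_smul, map_mul, mul_smul_comm, smul_mul_assoc]
  rw [← mul_assoc _ (timeHom κ W γ), timeHom_comm γ]
  simp only [mul_assoc]

theorem curvature_lineConnection_up_up_up (K I J L : ι ⊕ κ) :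
    curvature (lineConnection hW α β γ δ D hg).cov (deg K) (deg I) (frame (up K))
        (frame (up I)) (frame (up J)) (up L) =
      SFun.pr hW (curvature D.cov (deg K) (deg I) (frame K) (frame I) (frame J) L) +
        timeHom κ W (γ * δ) * SFun.pr hW (constCurvature g K I J L) := by
  have h := (lineConnection hW α β γ δ D hg).curvature_frame_frame (up K) (up I) (frame (up J))
  rw [deg_up, deg_up] at h
  simp only [h, curvature_frame_frame, constCurvature, Pi.sub_apply, Pi.smul_apply, smul_eq_mul,
    lineConnection_up_lineConnection_up_up, map_sub, map_smul, mul_sub, smul_add, mul_smul_comm,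
    smul_smul]
  abel

theorem ricciTrace_lineConnection_none_none :
    ricciTrace (lineConnection hW α β γ δ D hg).cov (Sum.inl none) (Sum.inl none) =
      ((Fintype.card ι : ℝ) - Fintype.card κ) • timeHom κ W (α * γ - γ.deriv - γ * β) := by
  rw [ricciTrace, sum_index, curvature_frame_self _ deg_none, Pi.zero_apply, smul_zero, zero_add]
  simp only [deg_up, deg_none, add_zero, curvature_lineConnection_up_none_none, Pi.smul_apply,
    frame_same, smul_eq_mul, mul_one]
  rw [← Finset.sum_smul, sum_sgn_deg]

theorem ricciTrace_lineConnection_none_up (J : ι ⊕ κ) :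
    ricciTrace (lineConnection hW α β γ δ D hg).cov (Sum.inl none) (up J) = 0 := by
  rw [ricciTrace, sum_index, curvature_frame_self _ deg_none, Pi.zero_apply, smul_zero, zero_add]
  simp only [deg_up, deg_none, curvature_lineConnection_up_none_up, smul_zero,
    Finset.sum_const_zero]

theorem ricciTrace_lineConnection_up_up (I J : ι ⊕ κ) :
    ricciTrace (lineConnection hW α β γ δ D hg).cov (up I) (up J) =
      SFun.pr hW (ricciTrace D.cov I J) +
        timeHom κ W (δ.deriv + (α - β) * δ +
            ((Fintype.card ι : ℝ) - Fintype.card κ - 1) • (γ * δ)) *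
          SFun.pr hW (g I J) := by
  rw [ricciTrace, sum_index, map_add (timeHom κ W), add_mul, map_smul, smul_mul_assoc]
  simp only [deg_up, deg_none, sgn_zero_left, one_smul, curvature_lineConnection_none_up_up,
    curvature_lineConnection_up_up_up, smul_add, ← mul_smul_comm, ← map_smul,
    Finset.sum_add_distrib, ← map_sum, ← Finset.mul_sum, supertrace_constCurvature]
  rw [add_left_comm, ricciTrace]

variable {D}

theorem ricciTrace_lineConnection_up_none (hs : ∀ I J, g I J = sgn (deg I) (deg J) • g J I)
    (hD : D.IsLeviCivita g) (J : ι ⊕ κ) :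
    ricciTrace (lineConnection hW α β γ δ D hg).cov (up J) (Sum.inl none) = 0 := by
  rw [ricciTrace, sum_index, curvature_frame_swap]
  simp only [deg_up, deg_none, curvature_lineConnection_up_none_none,
    curvature_lineConnection_up_up_none hW α β γ δ hg hs hD, Pi.neg_apply, Pi.smul_apply,
    Pi.zero_apply, frame_up_none, smul_zero, neg_zero, Finset.sum_const_zero, add_zero]

theorem ricci_lineConnection_none_up (hs : ∀ I J, g I J = sgn (deg I) (deg J) • g J I)
    (hD : D.IsLeviCivita g) (J : ι ⊕ κ) :
    ricci (lineConnection hW α β γ δ D hg).cov (deg (Sum.inl none : Option ι ⊕ κ)) (deg (up J))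
      (frame (Sum.inl none)) (frame (up J)) = 0 := by
  rw [ricci_frame_frame, ricciTrace_lineConnection_none_up,
    ricciTrace_lineConnection_up_none hW α β γ δ hg hs hD, smul_zero, add_zero, smul_zero]

theorem ricci_lineConnection_up_none (hs : ∀ I J, g I J = sgn (deg I) (deg J) • g J I)
    (hD : D.IsLeviCivita g) (J : ι ⊕ κ) :
    ricci (lineConnection hW α β γ δ D hg).cov (deg (up J)) (deg (Sum.inl none : Option ι ⊕ κ))
      (frame (up J)) (frame (Sum.inl none)) = 0 := by
  rw [ricci_frame_frame, ricciTrace_lineConnection_none_up,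
    ricciTrace_lineConnection_up_none hW α β γ δ hg hs hD, smul_zero, add_zero, smul_zero]

variable (D)

theorem ricci_lineConnection_none_none :
    ricci (lineConnection hW α β γ δ D hg).cov (deg (Sum.inl none : Option ι ⊕ κ))
        (deg (Sum.inl none : Option ι ⊕ κ)) (frame (Sum.inl none)) (frame (Sum.inl none)) =
      ((Fintype.card ι : ℝ) - Fintype.card κ) • timeHom κ W (α * γ - γ.deriv - γ * β) := by
  rw [ricci_frame_frame, ricciTrace_lineConnection_none_none, deg_none, sgn_zero_left, one_smul,
    ← two_smul ℝ, smul_smul]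
  norm_num

theorem ricci_lineConnection_up_up (hs : ∀ I J, g I J = sgn (deg I) (deg J) • g J I)
    (I J : ι ⊕ κ) :
    ricci (lineConnection hW α β γ δ D hg).cov (deg (up I)) (deg (up J)) (frame (up I))
        (frame (up J)) =
      SFun.pr hW (ricci D.cov (deg I) (deg J) (frame I) (frame J)) +
        timeHom κ W (δ.deriv + (α - β) * δ +
            ((Fintype.card ι : ℝ) - Fintype.card κ - 1) • (γ * δ)) *
          SFun.pr hW (g I J) := by
  rw [ricci_frame_frame, ricci_frame_frame, ricciTrace_lineConnection_up_up,
    ricciTrace_lineConnection_up_up, deg_up, deg_up]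
  generalize timeHom κ W _ = F
  rw [smul_add (sgn _ _), ← mul_smul_comm, ← map_smul, ← map_smul, ← hs I J, add_add_add_comm,
    ← two_smul ℝ (F * _), smul_add, smul_smul, map_smul, map_smul, map_add, map_smul]
  norm_num

end LineConnectionRicci

section WarpingEquations

theorem eq_sqrt_or_eq_neg_sqrt_iff {c a : ℝ} (hc : c ≠ 0) : c = √a ∨ c = -√a ↔ c ^ 2 = a := by
  constructor
  · intro h
    have ha : 0 ≤ a := by
      by_contra! ha
      rw [Real.sqrt_eq_zero_of_nonpos ha.le, neg_zero, or_self] at h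
      exact hc h
    rw [← Real.sq_sqrt ha]
    exact sq_eq_sq_iff_eq_or_eq_neg.2 h
  · rintro rfl
    rw [Real.sqrt_sq_eq_abs, ← sq_eq_sq_iff_eq_or_eq_neg, sq_abs]

theorem deriv_eq_zero_of_forall_eq {f : ℝ → ℝ} {f' c t : ℝ} (hf : HasDerivAt f f' t)
    (hc : ∀ s, f s = c) : f' = 0 :=
  hf.unique (funext hc ▸ hasDerivAt_const t c)

variable {h h' h'' : ℝ → ℝ} {m k lam0 lamN : ℝ}

theorem forall_deriv_eq_zero_iff (hh : ∀ t, HasDerivAt h (h' t) t) :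
    (∀ t, h' t = 0) ↔ ∃ c, ∀ t, h t = c := by
  refine ⟨fun h0 => ⟨h 0, fun t => ?_⟩, fun ⟨c, hc⟩ t => deriv_eq_zero_of_forall_eq (hh t) hc⟩
  exact is_const_of_deriv_eq_zero (fun t => (hh t).differentiableAt)
    (fun t => (hh t).deriv.trans (h0 t)) t 0

theorem forall_deriv_eq_self_iff (hh : ∀ t, HasDerivAt h (h' t) t) :
    (∀ t, h' t = h t) ↔ ∃ c, ∀ t, h t = c * Real.exp t := by
  have hquot (t : ℝ) :
      HasDerivAt (fun s => h s / Real.exp s) ((h' t - h t) / Real.exp t) t :=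
    ((hh t).div (Real.hasDerivAt_exp t) (Real.exp_ne_zero t)).congr_deriv (by field_simp)
  simpa only [div_eq_zero_iff, Real.exp_ne_zero, or_false, sub_eq_zero,
    div_eq_iff (Real.exp_ne_zero _), zero_mul] using forall_deriv_eq_zero_iff hquot

theorem warping_first_order (hh : ∀ t, HasDerivAt h (h' t) t)
    (hh' : ∀ t, HasDerivAt h' (h'' t) t) (hm : m ≠ 0) (hk : ∀ t, h'' t = k * h t)
    (hfibre : ∀ t, (k + m * (1 - k)) * h t ^ 2 + (m - 1) * h' t ^ 2 - m * (h t * h' t) = lamN)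
    (t : ℝ) : 2 * (h t * h' t) - h' t ^ 2 - k * h t ^ 2 = 0 := by
  have hderiv := deriv_eq_zero_of_forall_eq (((((hh t).pow 2).const_mul (k + m * (1 - k))).add
    (((hh' t).pow 2).const_mul (m - 1))).sub (((hh t).mul (hh' t)).const_mul m)) hfibre
  rw [hk t] at hderiv
  norm_num at hderiv
  refine (mul_eq_zero.1 ?_).resolve_left hm
  linear_combination hderiv

theorem one_sub_mul_deriv_eq_zero (hh : ∀ t, HasDerivAt h (h' t) t)
    (hh' : ∀ t, HasDerivAt h' (h'' t) t) (h0 : ∀ t, h t ≠ 0) (hk : ∀ t, h'' t = k * h t)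
    (hfirst : ∀ t, 2 * (h t * h' t) - h' t ^ 2 - k * h t ^ 2 = 0) (t : ℝ) :
    (1 - k) * h' t = 0 := by
  have hderiv := deriv_eq_zero_of_forall_eq (((((hh t).mul (hh' t)).const_mul 2).sub
    ((hh' t).pow 2)).sub (((hh t).pow 2).const_mul k)) hfirst
  rw [hk t] at hderiv
  norm_num at hderiv
  refine (mul_eq_zero.1 ?_).resolve_left (h0 t)
  linear_combination hderiv / 4 + hfirst t / 2

theorem eq_one_or_eq_zero_of_warping (hh : ∀ t, HasDerivAt h (h' t) t)
    (hh' : ∀ t, HasDerivAt h' (h'' t) t) (h0 : ∀ t, h t ≠ 0) (hk : ∀ t, h'' t = k * h t)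
    (hfirst : ∀ t, 2 * (h t * h' t) - h' t ^ 2 - k * h t ^ 2 = 0) :
    (k = 1 ∧ ∀ t, h' t = h t) ∨ (k = 0 ∧ ∀ t, h' t = 0) := by
  rcases eq_or_ne k 1 with rfl | hk1
  · refine Or.inl ⟨rfl, fun t => sub_eq_zero.1 (pow_eq_zero_iff two_ne_zero |>.1 ?_)⟩
    linear_combination -hfirst t
  · have hconst (t : ℝ) : h' t = 0 :=
      (mul_eq_zero.1 (one_sub_mul_deriv_eq_zero hh hh' h0 hk hfirst t)).resolve_left
        (sub_ne_zero.2 hk1.symm)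
    refine Or.inr ⟨(mul_eq_zero.1 ?_).resolve_right (pow_ne_zero 2 (h0 0)), hconst⟩
    linear_combination -hfirst 0 + (2 * h 0 - h' 0) * hconst 0

theorem warping_equations_iff_deriv (hh : ∀ t, HasDerivAt h (h' t) t)
    (hh' : ∀ t, HasDerivAt h' (h'' t) t) (h0 : ∀ t, h t ≠ 0) (hm : m ≠ 0) :
    ((∀ t, m * (h t - h'' t) = lam0 * h t) ∧ ∀ t, h t * h'' t + (m - 1) * h' t ^ 2 -
        m * (h t * h' t) + lam0 * h t ^ 2 = lamN) ↔
      (lam0 = 0 ∧ lamN = 0 ∧ ∀ t, h' t = h t) ∨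
        (lam0 = m ∧ (∀ t, h t ^ 2 = lamN / m) ∧ ∀ t, h' t = 0) := by
  constructor
  · rintro ⟨htime, hfibre⟩
    obtain ⟨k, rfl⟩ : ∃ k, lam0 = m * (1 - k) := ⟨1 - lam0 / m, by field_simp; ring⟩
    have hk (t : ℝ) : h'' t = k * h t :=
      mul_left_cancel₀ hm (by linear_combination -htime t)
    have hfirst := warping_first_order hh hh' hm hk (lamN := lamN) fun t => by
      rw [← hfibre t, hk]; ring
    rcases eq_one_or_eq_zero_of_warping hh hh' h0 hk hfirst with ⟨rfl, hself⟩ | ⟨rfl, hzero⟩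
    · refine Or.inl ⟨by ring, ?_, hself⟩
      rw [← hfibre 0, hk, hself]; ring
    · refine Or.inr ⟨by ring, fun t => ?_, hzero⟩
      rw [eq_div_iff hm, ← hfibre t, hk, hzero]; ring
  · rintro (⟨rfl, rfl, hself⟩ | ⟨rfl, hsq, hzero⟩)
    · have hself' (t : ℝ) : h'' t = h t :=
        ((hh' t).unique (funext hself ▸ hh t)).trans (hself t)
      constructor <;> intro t <;> rw [hself'] <;> try rw [hself]
      all_goals ring
    · have hzero' (t : ℝ) : h'' t = 0 := deriv_eq_zero_of_forall_eq (hh' t) hzero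
      refine ⟨fun t => by rw [hzero', sub_zero], fun t => ?_⟩
      rw [hzero', hzero, hsq, mul_div_cancel₀ _ hm]; ring

theorem warping_equations_iff (hh : ∀ t, HasDerivAt h (h' t) t)
    (hh' : ∀ t, HasDerivAt h' (h'' t) t) (h0 : ∀ t, h t ≠ 0) (hm : m ≠ 0) :
    ((∀ t, m * (h t - h'' t) = lam0 * h t) ∧ ∀ t, h t * h'' t + (m - 1) * h' t ^ 2 -
        m * (h t * h' t) + lam0 * h t ^ 2 = lamN) ↔
      (lam0 = 0 ∧ lamN = 0 ∧ ∃ c, ∀ t, h t = c * Real.exp t) ∨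
        (lam0 = m ∧ ∃ c, (c = √(lamN / m) ∨ c = -√(lamN / m)) ∧ ∀ t, h t = c) := by
  rw [warping_equations_iff_deriv hh hh' h0 hm, forall_deriv_eq_self_iff hh,
    forall_deriv_eq_zero_iff hh]
  refine or_congr_right (and_congr_right fun _ => ⟨?_, ?_⟩)
  · rintro ⟨hsq, c, hc⟩
    exact ⟨c, (eq_sqrt_or_eq_neg_sqrt_iff (hc 0 ▸ h0 0)).2 (hc 0 ▸ hsq 0), hc⟩
  · rintro ⟨c, hsqrt, hc⟩
    exact ⟨fun t => hc t ▸ (eq_sqrt_or_eq_neg_sqrt_iff (hc 0 ▸ h0 0)).1 hsqrt, c, hc⟩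

end WarpingEquations

section WarpingFunction

namespace SmoothFn

theorem ext_iff {H K : SmoothFn} : H = K ↔ ∀ t, H.1 t = K.1 t :=
  Subtype.ext_iff.trans funext_iff

theorem isUnit {H : SmoothFn} (h0 : ∀ t, H.1 t ≠ 0) : IsUnit H :=
  IsUnit.of_mul_eq_one ⟨fun t => (H.1 t)⁻¹, H.contDiff.inv h0⟩
    (ext_iff.2 fun t => mul_inv_cancel₀ (h0 t))

/-- The logarithmic derivative `H' / H` of a nowhere vanishing smooth function. -/
def logDeriv (H : SmoothFn) (h0 : ∀ t, H.1 t ≠ 0) : SmoothFn :=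
  ⟨fun t => H.deriv.1 t / H.1 t, H.deriv.contDiff.div H.contDiff h0⟩

theorem logDeriv_mul (H : SmoothFn) (h0 : ∀ t, H.1 t ≠ 0) : H.logDeriv h0 * H = H.deriv :=
  ext_iff.2 fun t => div_mul_cancel₀ _ (h0 t)

/-- The function `F` of time for which the fibre part of the Einstein equation of the warped
product, with fibre of superdimension `m` and Einstein constant `-lam0`, reads
`Ric = -F g` on the fibre. -/
def fibreFn (H : SmoothFn) (m lam0 : ℝ) : SmoothFn :=
  H * H.deriv.deriv + (m - 1) • H.deriv ^ 2 - m • (H * H.deriv) + lam0 • H ^ 2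

variable {H ψ : SmoothFn}

theorem time_coeff_mul (hψ : ψ * H = H.deriv) :
    ((0 - 1) * (ψ - 1) - (ψ - 1).deriv - (ψ - 1) * ψ) * H = H - H.deriv.deriv := by
  have hψ' : H.deriv.deriv = ψ.deriv * H + ψ * H.deriv := by rw [← deriv_mul, hψ]
  rw [deriv_sub_one]
  linear_combination hψ' - ψ * hψ

theorem fibre_coeff_add (hψ : ψ * H = H.deriv) (m lam0 : ℝ) :
    (H * H.deriv).deriv + (0 - 1 - ψ) * (H * H.deriv) + (m - 1) • ((ψ - 1) * (H * H.deriv)) +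
      lam0 • H ^ 2 = H.fibreFn m lam0 := by
  have hψ' : (ψ - 1) * (H * H.deriv) = H.deriv ^ 2 - H * H.deriv := by
    linear_combination H.deriv * hψ
  rw [fibreFn, deriv_mul, hψ', smul_sub, sub_smul m 1 (H * H.deriv), one_smul]
  linear_combination -H.deriv * hψ

end SmoothFn

end WarpingFunction

section ChartEinstein

theorem eq_zero_of_forall_mul_apply_eq_zero {R n : Type*} [Ring R] [Fintype n] [DecidableEq n]
    [Nonempty n] {A : Matrix n n R} (hA : IsUnit A) {c : R} (h : ∀ i j, c * A i j = 0) :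
    c = 0 := by
  obtain ⟨B, hB⟩ := hA.exists_right_inv
  obtain ⟨i⟩ := ‹Nonempty n›
  calc
    c = c * (A * B) i i := by rw [hB, Matrix.one_apply_eq, mul_one]
    _ = 0 := by simp only [Matrix.mul_apply, Finset.mul_sum, ← mul_assoc, h, zero_mul,
      Finset.sum_const_zero]

variable {ι : Type} [Fintype ι] [DecidableEq ι] {κ : Type} [Fintype κ] [DecidableEq κ]
  {W : Opens (Option ι → ℝ)}

theorem body_timeHom (F : SmoothFn) (z : W) :
    (SFun.body (timeHom κ W F)).1 z = F.1 (z.1 none) := by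
  change (SFun.body (SFun.ofCInf (timeFn W F.1 F.contDiff) : SFun κ W)).1 z = _
  rw [SFun.body_ofCInf]
  rfl

theorem timeHom_injective (hW : ∀ t, ∃ z : W, z.1 none = t) :
    Function.Injective (timeHom κ W) := fun F G h => SmoothFn.ext_iff.2 fun t => by
  obtain ⟨z, rfl⟩ := hW t
  rw [← body_timeHom (κ := κ), h, body_timeHom]

variable {V : Opens (ι → ℝ)}
  (hW : ∀ z : W, (fun a => z.1 (some a)) ∈ V) {g : ι ⊕ κ → ι ⊕ κ → SFun κ V}

theorem timeHom_eq_of_forall_mul_pr_eq [Nonempty (ι ⊕ κ)] (hn : IsUnit (Matrix.of g))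
    {F G : SmoothFn}
    (h : ∀ I J, timeHom κ W F * SFun.pr hW (g I J) = timeHom κ W G * SFun.pr hW (g I J)) :
    timeHom κ W F = timeHom κ W G :=
  sub_eq_zero.1 <| eq_zero_of_forall_mul_apply_eq_zero
    (hn.map (SFun.pr hW).toRingHom.mapMatrix) fun I J =>
      (sub_mul _ _ _).trans (sub_eq_zero.2 (h I J))

open Vect

variable {D : AffineConnection κ V} (hg : ∀ I J, g I J ∈ SFun.homog κ V (deg I + deg J))
  {H ψ : SmoothFn}

theorem ricci_lineConnection_none_none_eq_iff (hH : IsUnit H) (hψ : ψ * H = H.deriv)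
    (lam0 : ℝ) :
    ricci (lineConnection hW (0 - 1) ψ (ψ - 1) (H * H.deriv) D hg).cov
        (deg (Sum.inl none : Option ι ⊕ κ)) (deg (Sum.inl none : Option ι ⊕ κ))
        (frame (Sum.inl none)) (frame (Sum.inl none)) =
        (-lam0) • warpComp hW H.1 H.contDiff g (Sum.inl none) (Sum.inl none) ↔
      timeHom κ W (((Fintype.card ι : ℝ) - Fintype.card κ) • (H - H.deriv.deriv)) =
        timeHom κ W (lam0 • H) := by
  rw [ricci_lineConnection_none_none, warpComp_none_none, smul_neg, neg_smul, neg_neg,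
    ← (hH.map (timeHom κ W)).mul_left_inj, smul_mul_assoc, ← map_mul,
    SmoothFn.time_coeff_mul hψ, smul_mul_assoc, one_mul, map_smul, map_smul]

theorem ricci_lineConnection_up_up_eq_iff (hs : ∀ I J, g I J = sgn (deg I) (deg J) • g J I)
    (hψ : ψ * H = H.deriv) (lam0 : ℝ) (I J : ι ⊕ κ) :
    ricci (lineConnection hW (0 - 1) ψ (ψ - 1) (H * H.deriv) D hg).cov (deg (up I))
        (deg (up J)) (frame (up I)) (frame (up J)) =
        (-lam0) • warpComp hW H.1 H.contDiff g (up I) (up J) ↔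
      SFun.pr hW (ricci D.cov (deg I) (deg J) (frame I) (frame J)) =
        -(timeHom κ W (H.fibreFn ((Fintype.card ι : ℝ) - Fintype.card κ) lam0) *
          SFun.pr hW (g I J)) := by
  rw [ricci_lineConnection_up_up hW _ _ _ _ D hg hs, warpComp_up_up_timeHom,
    ← SmoothFn.fibre_coeff_add hψ, map_add _ _ (lam0 • H ^ 2), add_mul, map_smul, smul_mul_assoc,
    neg_smul, ← add_eq_zero_iff_eq_neg, ← add_eq_zero_iff_eq_neg, add_assoc]

theorem ricci_lineConnection_eq_iff (hs : ∀ I J, g I J = sgn (deg I) (deg J) • g J I)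
    (hD : D.IsLeviCivita g) (hH : IsUnit H) (hψ : ψ * H = H.deriv) (lam0 : ℝ) :
    (∀ I J, ricci (lineConnection hW (0 - 1) ψ (ψ - 1) (H * H.deriv) D hg).cov (deg I) (deg J)
        (frame I) (frame J) = (-lam0) • warpComp hW H.1 H.contDiff g I J) ↔
      timeHom κ W (((Fintype.card ι : ℝ) - Fintype.card κ) • (H - H.deriv.deriv)) =
          timeHom κ W (lam0 • H) ∧
        ∀ I J, SFun.pr hW (ricci D.cov (deg I) (deg J) (frame I) (frame J)) =
          -(timeHom κ W (H.fibreFn ((Fintype.card ι : ℝ) - Fintype.card κ) lam0) *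
            SFun.pr hW (g I J)) := by
  simp only [← ricci_lineConnection_none_none_eq_iff hW hg (D := D) hH hψ,
    ← ricci_lineConnection_up_up_eq_iff hW hg (D := D) hs hψ]
  refine ⟨fun h => ⟨h _ _, fun I J => h _ _⟩, fun ⟨htime, hfibre⟩ I J => ?_⟩
  rcases index_cases I with rfl | ⟨I, rfl⟩ <;> rcases index_cases J with rfl | ⟨J, rfl⟩
  · exact htime
  · rw [ricci_lineConnection_none_up hW _ _ _ _ hg hs hD, warpComp_none_up, smul_zero]
  · rw [ricci_lineConnection_up_none hW _ _ _ _ hg hs hD, warpComp_up_none, smul_zero]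
  · exact hfibre I J

end ChartEinstein

section WarpedEinstein

variable {ι : Type} [Fintype ι] [DecidableEq ι] {κ : Type} [Fintype κ] [DecidableEq κ]
  {M : Supermanifold.{u, v} ι κ}

open Vect

theorem Supermanifold.slice_mem (M : Supermanifold.{u, v} ι κ) (i : M.Index) (x : M.dom i) :
    (fun o : Option ι => (o.elim (0 : CInf (M.dom i)) (CInf.coord (M.dom i))).1 x) ∈
      M.line.dom i :=
  (mem_lineChart_target (M.chart i) _).2 x.2

theorem Supermanifold.exists_timeHom_injective (M : Supermanifold.{u, v} ι κ)
    [Nonempty M.carrier] : ∃ i : M.Index, Function.Injective (timeHom κ (M.line.dom i)) := by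
  obtain ⟨p⟩ := ‹Nonempty M.carrier›
  obtain ⟨i, hi⟩ := M.cover p
  exact ⟨i, timeHom_injective fun t => ⟨⟨fun o => o.elim t (M.chart i p),
    (mem_lineChart_target (M.chart i) _).2 ((M.chart i).map_source hi)⟩, rfl⟩⟩

theorem EvenMetric.isEinsteinFor_iff_frames (g : EvenMetric M)
    (D : ∀ i, AffineConnection κ (M.dom i)) (lam : ℝ) :
    g.IsEinsteinFor (fun i => (D i).cov) lam ↔
      ∀ i I J, ricci (D i).cov (deg I) (deg J) (frame I) (frame J) = lam • g.comp i I J := by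
  refine ⟨fun h i I J => ?_, fun h i _ _ _ _ hX hY => (D i).ricci_eq_of_frames (h i) hX hY⟩
  rw [h i _ _ _ _ (isHomog_frame I) (isHomog_frame J), pair_frame_frame]

variable {g : EvenMetric M} {H : SmoothFn} {h0 : ∀ t, H.1 t ≠ 0}

namespace EvenMetric.LeviCivita

/-- The Levi-Civita connection of the warped product, from that of the fibre. -/
def warp (D : g.LeviCivita) (h0 : ∀ t, H.1 t ≠ 0) :
    (g.warp H.1 H.contDiff h0).LeviCivita where
  conn i := lineConnection (M.line_dom i) 0 (H.logDeriv h0) (H.logDeriv h0) (H * H.deriv)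
    (D.conn i) (g.comp_homog i)
  isLeviCivita i := isLeviCivita_lineConnection (M.line_dom i) (g.comp_homog i) H _
    (H.logDeriv_mul h0) (g.comp_symm i) (D.isLeviCivita i)

/-- The Levi-Civita connection of the fibre, recovered on the slice `t = 0` of the warped
product. -/
def slice (D : (g.warp H.1 H.contDiff h0).LeviCivita) : g.LeviCivita where
  conn i := sliceConnection (M.slice_mem i) (D.conn i)
  isLeviCivita i := isLeviCivita_sliceConnection (M.slice_mem i) (M.line_dom i) (h0 0)
    (D.isLeviCivita i)

theorem semiSymm_warp (D : g.LeviCivita) (D' : (g.warp H.1 H.contDiff h0).LeviCivita)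
    (i : M.Index) :
    semiSymm (D'.conn i).cov ((g.warp H.1 H.contDiff h0).comp i) ((dt M).comp i) =
      (lineConnection (M.line_dom i) (0 - 1) (H.logDeriv h0) (H.logDeriv h0 - 1) (H * H.deriv)
        (D.conn i) (g.comp_homog i)).cov := by
  rw [← semiSymm_lineConnection]
  exact congrArg (fun cov => semiSymm cov _ _) <|
    ((D'.isLeviCivita i).cov_unique ((g.warp H.1 H.contDiff h0).comp_symm i)
      ((g.warp H.1 H.contDiff h0).nondeg i) ((D.warp h0).isLeviCivita i))

theorem isEinsteinFor_semiSymm_warp_iff (D : g.LeviCivita)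
    (D' : (g.warp H.1 H.contDiff h0).LeviCivita) (lam0 : ℝ) :
    (g.warp H.1 H.contDiff h0).IsEinsteinFor (fun i => semiSymm (D'.conn i).cov
        ((g.warp H.1 H.contDiff h0).comp i) ((dt M).comp i)) (-lam0) ↔
      ∀ i : M.Index, timeHom κ (M.line.dom i)
            (((Fintype.card ι : ℝ) - Fintype.card κ) • (H - H.deriv.deriv)) =
          timeHom κ (M.line.dom i) (lam0 • H) ∧
        ∀ I J, SFun.pr (M.line_dom i)
            (ricci (D.conn i).cov (deg I) (deg J) (frame I) (frame J)) =
          -(timeHom κ (M.line.dom i)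
              (H.fibreFn ((Fintype.card ι : ℝ) - Fintype.card κ) lam0) *
            SFun.pr (M.line_dom i) (g.comp i I J)) := by
  have hcov := congrArg ((g.warp H.1 H.contDiff h0).IsEinsteinFor · (-lam0))
    (funext (semiSymm_warp D D'))
  refine (iff_of_eq hcov).trans ((isEinsteinFor_iff_frames _ _ _).trans (forall_congr' fun i => ?_))
  exact ricci_lineConnection_eq_iff (M.line_dom i) (g.comp_homog i) (g.comp_symm i)
    (D.isLeviCivita i) (SmoothFn.isUnit h0) (H.logDeriv_mul h0) lam0

end EvenMetric.LeviCivita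

theorem EvenMetric.isEinsteinSemiSymm_warp_iff [Nonempty (ι ⊕ κ)] [Nonempty M.carrier]
    (g : EvenMetric M) (h0 : ∀ t, H.1 t ≠ 0) (lam0 : ℝ) :
    (g.warp H.1 H.contDiff h0).IsEinsteinSemiSymm (dt M) (-lam0) ↔
      ∃ lamN : ℝ, g.IsEinstein (-lamN) ∧
        ((Fintype.card ι : ℝ) - Fintype.card κ) • (H - H.deriv.deriv) = lam0 • H ∧
        H.fibreFn ((Fintype.card ι : ℝ) - Fintype.card κ) lam0 = algebraMap ℝ SmoothFn lamN := by
  constructor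
  · rintro ⟨D', hD'⟩
    set F := H.fibreFn ((Fintype.card ι : ℝ) - Fintype.card κ) lam0
    have hchart := (D'.slice.isEinsteinFor_semiSymm_warp_iff D' lam0).1 hD'
    have hricci (i : M.Index) (I J : ι ⊕ κ) :
        ricci (D'.slice.conn i).cov (deg I) (deg J) (frame I) (frame J) =
          (-F.1 0) • g.comp i I J := by
      simpa only [slice_pr, map_neg, slice_timeHom_mul_pr, neg_smul] using
        congrArg (slice (M.slice_mem i)) ((hchart i).2 I J)
    obtain ⟨i, hi⟩ := M.exists_timeHom_injective
    refine ⟨F.1 0, ⟨D'.slice, (g.isEinsteinFor_iff_frames _ _).2 hricci⟩, hi (hchart i).1,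
      hi (timeHom_eq_of_forall_mul_pr_eq (M.line_dom i) (g.nondeg i) fun I J => ?_)⟩
    rw [AlgHom.commutes, ← Algebra.smul_def, ← neg_inj, ← (hchart i).2, hricci, map_smul,
      neg_smul]
  · rintro ⟨lamN, ⟨D, hD⟩, htime, hfibre⟩
    refine ⟨D.warp h0, (D.isEinsteinFor_semiSymm_warp_iff _ lam0).2 fun i =>
      ⟨congrArg _ htime, fun I J => ?_⟩⟩
    rw [(g.isEinsteinFor_iff_frames _ _).1 hD, hfibre, AlgHom.commutes, ← Algebra.smul_def,
      map_smul, neg_smul]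

end WarpedEinstein

end SuperGeom

end

theorem theorem4p6_general {ι κ : Type} [Fintype ι] [DecidableEq ι] [Fintype κ] [DecidableEq κ]
    (hm : Fintype.card ι ≠ Fintype.card κ)
    (M₂ : SuperGeom.Supermanifold.{u, v} ι κ) (hM₂ : Nonempty M₂.carrier)
    (g₂ : SuperGeom.EvenMetric M₂) (h : ℝ → ℝ) (hs : ContDiff ℝ ∞ h) (h0 : ∀ t, h t ≠ 0)
    (lam0 : ℝ) :
    (g₂.warp h hs h0).IsEinsteinSemiSymm (SuperGeom.dt M₂) (-lam0) ↔
      ∃ lamN : ℝ, g₂.IsEinstein (-lamN) ∧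
        ((lam0 = 0 ∧ lamN = 0 ∧ ∃ c₁ : ℝ, ∀ t, h t = c₁ * Real.exp t) ∨
          (lam0 = (Fintype.card ι : ℝ) - Fintype.card κ ∧ ∃ c₁ : ℝ,
            (c₁ = √(lamN / ((Fintype.card ι : ℝ) - Fintype.card κ)) ∨
              c₁ = -√(lamN / ((Fintype.card ι : ℝ) - Fintype.card κ))) ∧ ∀ t, h t = c₁)) := by
  have : Nonempty (ι ⊕ κ) := by
    by_contra! hempty
    obtain ⟨_, _⟩ := isEmpty_sum.1 hempty
    exact hm (by rw [Fintype.card_eq_zero, Fintype.card_eq_zero])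
  let H : SuperGeom.SmoothFn := ⟨h, hs⟩
  refine (g₂.isEinsteinSemiSymm_warp_iff (H := H) h0 lam0).trans
    (exists_congr fun lamN => and_congr_right fun _ => ?_)
  rw [← SuperGeom.warping_equations_iff H.hasDerivAt H.deriv.hasDerivAt h0
    (sub_ne_zero.2 (Nat.cast_injective.ne hm)),
    SuperGeom.SmoothFn.ext_iff, SuperGeom.SmoothFn.ext_iff]
  rfl

theorem theorem4p6 (q n : ℕ) (hqn0 : (q : ℤ) - n ≠ 0) (hqn1 : (q : ℤ) - n ≠ 1)
    (M₂ : SuperGeom.Supermanifold.{u, v} (Fin q) (Fin n)) (hM₂ : Nonempty M₂.carrier)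
    (g₂ : SuperGeom.EvenMetric M₂) (h : ℝ → ℝ) (hs : ContDiff ℝ ∞ h) (h0 : ∀ t, h t ≠ 0)
    (lam0 : ℝ) :
    (g₂.warp h hs h0).IsEinsteinSemiSymm (SuperGeom.dt M₂) (-lam0) ↔
      ∃ lamN : ℝ, g₂.IsEinstein (-lamN) ∧
        ((lam0 = 0 ∧ lamN = 0 ∧ ∃ c₁ : ℝ, ∀ t, h t = c₁ * Real.exp t) ∨
          (lam0 = (q : ℝ) - n ∧ ∃ c₁ : ℝ, (c₁ = √(lamN / ((q : ℝ) - n)) ∨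
            c₁ = -√(lamN / ((q : ℝ) - n))) ∧ ∀ t, h t = c₁)) := by
  simpa only [Fintype.card_fin] using
    theorem4p6_general (by simp only [Fintype.card_fin]; omega) M₂ hM₂ g₂ h hs h0 lam0
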